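/- Let $\lambda,\alpha,\delta,u_0>0$. On a filtered probability space $(\Omega,\mathcal F,(\mathcal F_t)_{t\ge 0},\mathrm P)$ let claims of sizes $Y_1,Y_2,\dots$ arrive at times $0=T_0<T_1<T_2<\cdots$, where the gaps $T_{k}-T_{k-1}$ are exponential with parameter $\lambda$, the $Y_k$ are exponential with density $\alpha e^{-\alpha y}$, $y\ge 0$, and all gaps and claim sizes are independent. Put $N(t)=\#\{k\ge 1:T_k\le t\}$ and $S(t)=\sum_{k=1}^{N(t)}Y_k$; arrivals and claim sizes are $(\mathcal F_t)$-adapted, and $S(t)-S(s)$ is independent of $\mathcal F_s$ for $s\le t$. Let $g$ be Lipschitz continuous on $[0,\infty)$ and differentiable on $(0,\infty)$, with $g(x)>u_0$ for all $x\ge 0$. An admissible dividend rate is a measurable $(\mathcal F_t)$-adapted process $u$ with $0\le u(t)\le u_0$ whose cumulative payment $\int_0^t u(s)\,ds$ is $(\mathcal F_t)$-adapted. For an initial surplus $x\ge 0$, the controlled surplus $X$ is the adapted process satisfying almost surely $$X(t)=x+\int_0^t g(X(s))\,ds-S(t)-\int_0^t u(s)\,ds$$ up to and including the ruin time $\tau=\inf\{t\ge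 0: X(t)<0\}$, and stopped at $\tau$. Put $J(x,u)=\mathrm E\int_0^{\tau}e^{-\delta t}u(t)\,dt$, and let $V_R(x)=\sup_u J(x,u)$, the supremum being taken over all admissible rates. Assume that $\psi_1$ is continuous and strictly increasing on $[0,\infty)$, differentiable on $(0,\infty)$, and satisfies $$g(x)\psi_1'(x)-(\lambda+\delta)\psi_1(x)+\lambda\int_0^x\psi_1(x-y)\,\alpha e^{-\alpha y}\,dy=0,\qquad x>0,$$ and that $\psi_2$ is bounded, concave and twice differentiable on $(0,\infty)$ and satisfies $$[g(x)-u_0]\psi_2''(x)+[\alpha g(x)-\alpha u_0+g'(x)-(\lambda+\delta)]\psi_2'(x)-\alpha\delta\,\psi_2(x)=0,\qquad x>0.$$ Assume that there is a unique number $d>0$ such that $\psi_1$ is concave on $(0,d)$, $\psi_2'(d)>0$ and $$\frac{\psi_1(d)}{\psi_1'(d)}-\frac{\psi_2(d)}{\psi_2'(d)}=\frac{u_0}{\delta}.$$ Then for every $x\ge 0$ $$V_R(x)=\begin{cases}\dfrac{\psi_1(x)}{\psi_1'(d)}, & 0\le x<d,\\[2mm] \dfrac{u_0}{\delta}+\dfrac{\psi_2(x)}{\psi_2'(d)},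 & x\ge d.\end{cases}$$ Moreover, for every initial surplus $x\ge 0$ the threshold strategy exists as an admissible rate and is optimal: there are an admissible rate $u^*$ and a corresponding controlled surplus $X^*$ such that, almost surely, for all $t<\tau$, $u^*(t)=0$ if $0\le X^*(t)<d$ and $u^*(t)=u_0$ if $X^*(t)\ge d$; and every such $u^*$ satisfies $J(x,u^*)=V_R(x)$, i.e. it attains the supremum. -/

import Mathlib

open MeasureTheory ProbabilityTheory Set Filter Topology
open scoped NNReal ENNReal

noncomputable section

namespace Dividend

variable {Ω : Type*} {mΩ : MeasurableSpace Ω}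

/-- The number of claims up to time `t`: the number of `k ≥ 1` with `T k ≤ t`. -/
def claimCount (T : ℕ → Ω → ℝ) (t : ℝ) (ω : Ω) : ℕ :=
  {k : ℕ | T (k + 1) ω ≤ t}.ncard

/-- Aggregate claims up to time `t`. The claim arriving at time `T (k + 1)` has size `Y k`. -/
def aggregateClaims (T Y : ℕ → Ω → ℝ) (t : ℝ) (ω : Ω) : ℝ :=
  ∑ k ∈ Finset.range (claimCount T t ω), Y k ω

/-- The claims form a compound Poisson process with intensity `lam` and exponential claim sizes of
parameter `α` (density `α * exp (-α * y)`), relative to the filtration `ℱ`: inter-arrival times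
and claim sizes are independent and exponentially distributed, arrivals and claim sizes are
observed in `ℱ` when they occur, and `ℱ s` does not anticipate the claims after time `s`. -/
structure IsExpClaimProcess (P : Measure Ω) (ℱ : Filtration ℝ≥0 mΩ) (lam α : ℝ)
    (T Y : ℕ → Ω → ℝ) : Prop where
  arrival_zero : ∀ ω, T 0 ω = 0
  arrival_strictMono : ∀ ω, StrictMono fun k => T k ω
  gap_law : ∀ k, HasLaw (fun ω => T (k + 1) ω - T k ω) (expMeasure lam) P
  claim_law : ∀ k, HasLaw (Y k) (expMeasure α) P
  independent : iIndepFun (Sum.elim (fun k ω => T (k + 1) ω - T k ω) Y) P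
  arrival_adapted : ∀ (k : ℕ) (t : ℝ≥0), MeasurableSet[ℱ t] {ω | T k ω ≤ t}
  claim_adapted : ∀ (k : ℕ) (t : ℝ≥0),
    Measurable[ℱ t] ({ω | T (k + 1) ω ≤ t}.indicator (Y k))
  increments_indep : ∀ s t : ℝ≥0, s ≤ t →
    Indep (ℱ s) (MeasurableSpace.comap
      (fun ω => aggregateClaims T Y t ω - aggregateClaims T Y s ω) inferInstance) P

/-- The ruin time `inf {t ≥ 0 : X t < 0}` of a path, equal to `∞` if the path is never negative. -/
def ruinTime (X : ℝ → ℝ) : ℝ≥0∞ :=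
  sInf (ENNReal.ofReal '' {t : ℝ | 0 ≤ t ∧ X t < 0})

/-- Admissible dividend rates: `ℱ`-adapted measurable processes `u` with values in `[0, u₀]` whose
cumulative payment `D t = ∫ s in 0..t, u s` is `ℱ`-adapted. Only times `t ≥ 0` matter. -/
structure IsAdmissibleRate (ℱ : Filtration ℝ≥0 mΩ) (u₀ : ℝ) (u : ℝ → Ω → ℝ) : Prop where
  measurable : Measurable fun p : ℝ × Ω => u p.1 p.2
  adapted : ∀ t : ℝ≥0, Measurable[ℱ t] (u t)
  cumulative_adapted : ∀ t : ℝ≥0, Measurable[ℱ t] fun ω => ∫ s in (0 : ℝ)..t, u s ω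
  nonneg : ∀ t : ℝ, 0 ≤ t → ∀ ω, 0 ≤ u t ω
  le_max : ∀ t : ℝ, 0 ≤ t → ∀ ω, u t ω ≤ u₀

/-- `X` is the controlled surplus with drift function `g`, initial surplus `x` and dividend rate
`u`: it is adapted and, almost surely,
`X t = x + ∫₀ᵗ g (X s) ds - (claims up to time t) - ∫₀ᵗ u s ds` up to and including the ruin time.
The path is stopped at ruin, so that `g` is only evaluated on `[0, ∞)`. -/
structure IsControlledSurplus (P : Measure Ω) (ℱ : Filtration ℝ≥0 mΩ) (T Y : ℕ → Ω → ℝ)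
    (g : ℝ → ℝ) (x : ℝ) (u X : ℝ → Ω → ℝ) : Prop where
  adapted : ∀ t : ℝ≥0, Measurable[ℱ t] (X t)
  dynamics : ∀ᵐ ω ∂P, ∀ t : ℝ, 0 ≤ t → ENNReal.ofReal t ≤ ruinTime (fun r => X r ω) →
    IntervalIntegrable (fun s => g (X s ω)) volume 0 t ∧
    X t ω = x + (∫ s in (0 : ℝ)..t, g (X s ω)) - aggregateClaims T Y t ω
      - ∫ s in (0 : ℝ)..t, u s ω
  stopped : ∀ᵐ ω ∂P, ∀ t : ℝ, 0 ≤ t → ruinTime (fun r => X r ω) ≤ ENNReal.ofReal t →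
    X t ω = X (ruinTime (fun r => X r ω)).toReal ω

/-- The expected present value of the dividends up to ruin,
`E ∫₀^τ exp (-δ t) u t dt`, when the dividend rate is `u` and the surplus is `X`. -/
def expectedDividends (P : Measure Ω) (δ : ℝ) (u X : ℝ → Ω → ℝ) : ℝ :=
  ∫ ω, (∫ t in {t : ℝ | 0 ≤ t ∧ ENNReal.ofReal t < ruinTime (fun r => X r ω)},
    Real.exp (-δ * t) * u t ω) ∂P

/-- The expected present values attained by the admissible rates from initial surplus `x`. -/
def performances (P : Measure Ω) (ℱ : Filtration ℝ≥0 mΩ) (T Y : ℕ → Ω → ℝ)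
    (g : ℝ → ℝ) (u₀ δ x : ℝ) : Set ℝ :=
  {J | ∃ u X : ℝ → Ω → ℝ, IsAdmissibleRate ℱ u₀ u ∧ IsControlledSurplus P ℱ T Y g x u X ∧
    J = expectedDividends P δ u X}

/-- The value function `V_R` of the restricted dividend problem. -/
def restrictedValue (P : Measure Ω) (ℱ : Filtration ℝ≥0 mΩ) (T Y : ℕ → Ω → ℝ)
    (g : ℝ → ℝ) (u₀ δ x : ℝ) : ℝ :=
  sSup (performances P ℱ T Y g u₀ δ x)

/-- The admissible rate `u`, with surplus `X` started at `x`, follows the threshold strategy with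
threshold `d`: until ruin it pays nothing while the surplus is below `d` and pays at the maximal
rate `u₀` while the surplus is at or above `d`. -/
structure IsThresholdStrategy (P : Measure Ω) (ℱ : Filtration ℝ≥0 mΩ) (T Y : ℕ → Ω → ℝ)
    (g : ℝ → ℝ) (u₀ d x : ℝ) (u X : ℝ → Ω → ℝ) : Prop where
  admissible : IsAdmissibleRate ℱ u₀ u
  surplus : IsControlledSurplus P ℱ T Y g x u X
  feedback : ∀ᵐ ω ∂P, ∀ t : ℝ, 0 ≤ t → ENNReal.ofReal t < ruinTime (fun r => X r ω) →
    u t ω = if X t ω < d then 0 else u₀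

/-- `φ` is a classical solution, continuous up to `0`, of
`g φ' - (lam + δ) φ + lam ∫₀ˣ φ (x - y) α exp (-α y) dy = 0` for `x > 0`. -/
structure SolvesIDE (g : ℝ → ℝ) (lam α δ : ℝ) (φ : ℝ → ℝ) : Prop where
  continuousOn : ContinuousOn φ (Ici 0)
  differentiableAt : ∀ x : ℝ, 0 < x → DifferentiableAt ℝ φ x
  equation : ∀ x : ℝ, 0 < x →
    g x * deriv φ x - (lam + δ) * φ x
      + lam * (∫ y in (0 : ℝ)..x, φ (x - y) * (α * Real.exp (-α * y))) = 0

/-- `φ` is a classical solution of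
`(g - u₀) φ'' + (α g - α u₀ + g' - (lam + δ)) φ' - α δ φ = 0` for `x > 0`. -/
structure SolvesODE (g : ℝ → ℝ) (lam α δ u₀ : ℝ) (φ : ℝ → ℝ) : Prop where
  differentiableAt : ∀ x : ℝ, 0 < x → DifferentiableAt ℝ φ x
  differentiableAt_deriv : ∀ x : ℝ, 0 < x → DifferentiableAt ℝ (deriv φ) x
  equation : ∀ x : ℝ, 0 < x →
    (g x - u₀) * deriv (deriv φ) x
      + (α * g x - α * u₀ + deriv g x - (lam + δ)) * deriv φ x - α * δ * φ x = 0

/-- The conditions that single out the threshold `d`. -/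
structure IsThreshold (ψ₁ ψ₂ : ℝ → ℝ) (u₀ δ d : ℝ) : Prop where
  pos : 0 < d
  concaveOn : ConcaveOn ℝ (Ioo 0 d) ψ₁
  deriv_pos : 0 < deriv ψ₂ d
  fit : ψ₁ d / deriv ψ₁ d - ψ₂ d / deriv ψ₂ d = u₀ / δ

end Dividend

end

namespace Dividend

/-! ### Convolution with the exponential distribution -/

/-! This is a verification argument, carried out by discretising time instead of by stochastic
calculus.

Analytic part. Let `w` be the claimed value function, extended by zero to negative surplus. The fit
condition says that the two branches agree at `d`, and the normalisation gives both the slope 1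
there, so `w` is differentiable on the positive axis. Concavity of the branches makes `w' ≥ 1` up to
`d` and `w' ≤ 1` from `d` on; hence the maximiser of `u (1 - w')` over `0 ≤ u ≤ u₀` is the threshold
rule. Below `d` the Hamilton-Jacobi-Bellman equation is the integro-differential equation for `ψ₁`.
Above `d`, the convolution `q` satisfies `q' = α (w - q)`, so the equation for `ψ₂` says that the
residual of the HJB equation, multiplied by `exp (α x)`, is constant; it vanishes at `d` by the fit.
This is `exists_isClassicalSolution_candidate`.

Probabilistic part. Over a step of length `h` the claim increment is independent of the past,
vanishes with probability `exp (-lam h)`, and on the remaining event is one exponential claim up to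
an error `O(h²)` (`increment_law`, `increment_eq_zero`). Adaptedness supplies independence of `X t`
and the increment, so all estimates are written in terms of these two variables. On a path without
claims in the step, the mean value theorem and the HJB equation give the growth of `w (X)` plus
dividends (`exists_value_increment`); Grönwall's inequality bounds the drift uniformly on a bounded
horizon. Together, discounted value plus dividends increases on average by at most `C h²` for any
admissible rate (`exists_step_le`). For a threshold rate it decreases by at most `C h² + ε h`
(`exists_le_step`): only steps crossing `d` lose at first order, and there `w'` is close to 1.
Summing the steps up to a horizon `L`, comparing with Riemann sums of the discounted dividends, and
letting `h → 0`, then `L → ∞`, yields `J ≤ w x` in general and equality for threshold strategies.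

Existence. The drift under the threshold rule jumps at `d`, but the speed is positive on both sides.
The travel time is therefore an increasing bijection of the line, whose inverse solves the equation
between claims (`exists_isThresholdFlow`). Gluing these pieces at the claims gives a surplus that
depends only on claims already seen, hence an admissible rate. -/

theorem integral_expMeasure {α : ℝ} (hα : 0 < α) (f : ℝ → ℝ) :
    ∫ y, f y ∂(expMeasure α) = ∫ y in Ioi 0, f y * (α * Real.exp (-α * y)) := by
  have h1 : expMeasure α = volume.withDensity (exponentialPDF α) := rfl
  have hm : Measurable (exponentialPDF α) := (measurable_exponentialPDFReal α).ennreal_ofReal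
  rw [h1, integral_withDensity_eq_integral_toReal_smul hm (by simp [exponentialPDF])]
  rw [← integral_Ici_eq_integral_Ioi, ← integral_indicator measurableSet_Ici]
  refine integral_congr_ae (Eventually.of_forall fun y => ?_)
  by_cases hy : 0 ≤ y
  · simp only [exponentialPDF_of_nonneg hy, smul_eq_mul, indicator, mem_Ici, hy, if_true]
    rw [ENNReal.toReal_ofReal (by positivity)]
    ring_nf
  · simp [exponentialPDF_of_neg (not_le.mp hy), indicator, hy]

/-- The convolution `∫₀ˣ φ (x - y) α exp (-α y) dy`, in a form that is easy to differentiate. -/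
noncomputable def expConv (α : ℝ) (φ : ℝ → ℝ) (x : ℝ) : ℝ :=
  α * Real.exp (-α * x) * ∫ z in (0 : ℝ)..x, φ z * Real.exp (α * z)

theorem integral_eq_expConv (α : ℝ) (φ : ℝ → ℝ) (x : ℝ) :
    ∫ y in (0 : ℝ)..x, φ (x - y) * (α * Real.exp (-α * y)) = expConv α φ x := by
  have h := intervalIntegral.integral_comp_sub_left (a := 0) (b := x)
    (fun z => φ z * (α * Real.exp (-α * (x - z)))) x
  simp only [sub_sub_cancel, sub_self, sub_zero] at h
  rw [h, expConv, ← intervalIntegral.integral_const_mul]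
  refine intervalIntegral.integral_congr fun z _ => ?_
  have : Real.exp (-α * (x - z)) = Real.exp (-α * x) * Real.exp (α * z) := by
    rw [← Real.exp_add]; ring_nf
  simp only [this]; ring

section expConv

variable {α : ℝ} {φ : ℝ → ℝ}

theorem intervalIntegrable_mul_exp (hφ : ContinuousOn φ (Ici 0)) {a x : ℝ} (ha : 0 ≤ a)
    (hx : 0 ≤ x) : IntervalIntegrable (fun z => φ z * Real.exp (α * z)) volume a x := by
  apply ContinuousOn.intervalIntegrable
  have : uIcc a x ⊆ Ici 0 := fun z hz => by
    rw [mem_uIcc] at hz; simp only [mem_Ici]; rcases hz with h | h <;> linarith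
  exact (hφ.mono this).mul (by fun_prop)

/-- The exponential kernel makes the convolution solve a first-order linear equation. This is what
reduces the integro-differential equation above the threshold to a differential one. -/
theorem hasDerivAt_expConv (hφ : ContinuousOn φ (Ici 0)) {x : ℝ} (hx : 0 < x) :
    HasDerivAt (expConv α φ) (α * φ x - α * expConv α φ x) x := by
  have hc : ContinuousOn (fun z => φ z * Real.exp (α * z)) (Ici 0) := hφ.mul (by fun_prop)
  have h1 : HasDerivAt (fun x => ∫ z in (0 : ℝ)..x, φ z * Real.exp (α * z))
      (φ x * Real.exp (α * x)) x := by
    apply intervalIntegral.integral_hasDerivAt_right (intervalIntegrable_mul_exp hφ le_rfl hx.le)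
    · exact (hc.mono Ioi_subset_Ici_self).stronglyMeasurableAtFilter isOpen_Ioi x hx
    · exact hc.continuousAt (Ici_mem_nhds hx)
  have h2 : HasDerivAt (fun x => α * Real.exp (-α * x)) (α * (Real.exp (-α * x) * (-α * 1))) x :=
    (((hasDerivAt_id x).const_mul (-α)).exp).const_mul α
  have h3 := h2.mul h1
  refine h3.congr_deriv ?_
  have : Real.exp (-α * x) * Real.exp (α * x) = 1 := by
    rw [← Real.exp_add]; simp
  simp only [expConv]
  linear_combination α * φ x * this

theorem continuousAt_expConv (hφ : ContinuousOn φ (Ici 0)) {x : ℝ} (hx : 0 < x) :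
    ContinuousAt (expConv α φ) x := (hasDerivAt_expConv hφ hx).continuousAt

/-- The right endpoint is null and may be left out, so the lower branch of the candidate can be
inserted even at `x = d`. -/
theorem expConv_congr {φ' : ℝ → ℝ} {x : ℝ} (hx : 0 ≤ x) (h : ∀ z ∈ Ico 0 x, φ z = φ' z) :
    expConv α φ x = expConv α φ' x := by
  unfold expConv
  congr 1
  apply intervalIntegral.integral_congr_ae
  have h0 : ∀ᵐ z : ℝ, z ≠ x := by simp [ae_iff, measure_singleton]
  filter_upwards [h0] with z hz hzx
  rw [uIoc_of_le hx] at hzx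
  rw [h z ⟨hzx.1.le, lt_of_le_of_ne hzx.2 hz⟩]

theorem integral_exp_mul (hα : 0 < α) (x : ℝ) :
    α * Real.exp (-α * x) * ∫ z in (0 : ℝ)..x, Real.exp (α * z) = 1 - Real.exp (-α * x) := by
  have h : ∫ z in (0 : ℝ)..x, Real.exp (α * z) = (Real.exp (α * x) - 1) / α := by
    rw [intervalIntegral.integral_comp_mul_left (fun z => Real.exp z) hα.ne', integral_exp]
    simp [div_eq_inv_mul]
  have h2 : Real.exp (-α * x) * Real.exp (α * x) = 1 := by rw [← Real.exp_add]; simp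
  rw [h]
  field_simp
  have h3 : Real.exp (-(α * x)) = Real.exp (-α * x) := by ring_nf
  rw [h3]
  linear_combination h2

theorem expConv_le (hα : 0 < α) (hφ : ContinuousOn φ (Ici 0)) {x C : ℝ} (hx : 0 ≤ x)
    (h : ∀ z ∈ Icc 0 x, φ z ≤ C) : expConv α φ x ≤ C * (1 - Real.exp (-α * x)) := by
  rw [← integral_exp_mul hα x, expConv]
  have : ∫ z in (0 : ℝ)..x, φ z * Real.exp (α * z) ≤ C * ∫ z in (0 : ℝ)..x, Real.exp (α * z) := by
    rw [← intervalIntegral.integral_const_mul]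
    apply intervalIntegral.integral_mono_on hx (intervalIntegrable_mul_exp hφ le_rfl hx)
      (Continuous.intervalIntegrable (by fun_prop) _ _)
    intro z hz
    exact mul_le_mul_of_nonneg_right (h z hz) (Real.exp_pos _).le
  calc _ ≤ α * Real.exp (-α * x) * (C * ∫ z in (0 : ℝ)..x, Real.exp (α * z)) :=
        mul_le_mul_of_nonneg_left this (by positivity)
    _ = _ := by ring

theorem expConv_neg (x : ℝ) : expConv α (fun z => -φ z) x = -expConv α φ x := by
  simp [expConv]

theorem le_expConv (hα : 0 < α) (hφ : ContinuousOn φ (Ici 0)) {x C : ℝ} (hx : 0 ≤ x)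
    (h : ∀ z ∈ Icc 0 x, C ≤ φ z) : C * (1 - Real.exp (-α * x)) ≤ expConv α φ x := by
  have h1 := expConv_le (φ := fun z => -φ z) hα hφ.neg hx (C := -C)
    fun z hz => neg_le_neg (h z hz)
  rw [expConv_neg] at h1
  linarith

theorem expConv_zero : expConv α φ 0 = 0 := by simp [expConv]

/-- Claims exceeding the surplus contribute nothing when `φ` vanishes on the negative axis, so the
convolution is the expected value of `φ` just after a claim. -/
theorem integral_comp_sub_expMeasure (hα : 0 < α) (hφ : ∀ x < 0, φ x = 0) {x : ℝ} (hx : 0 ≤ x) :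
    ∫ y, φ (x - y) ∂(expMeasure α) = expConv α φ x := by
  rw [integral_expMeasure hα, ← integral_eq_expConv, intervalIntegral.integral_of_le hx]
  apply setIntegral_eq_of_subset_of_forall_sdiff_eq_zero measurableSet_Ioi (fun y hy => hy.1)
  intro y hy
  have : x < y := by
    by_contra h
    exact hy.2 ⟨hy.1, not_lt.mp h⟩
  rw [hφ _ (by linarith), zero_mul]

end expConv

/-! ### The candidate value function -/

/-- The candidate for the value function, extended by zero to negative surplus. -/
noncomputable def candidate (ψ₁ ψ₂ : ℝ → ℝ) (u₀ δ d : ℝ) (x : ℝ) : ℝ :=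
  if x < 0 then 0 else
    if x < d then ψ₁ x / deriv ψ₁ d else u₀ / δ + ψ₂ x / deriv ψ₂ d

/-- The properties of a function `w`, extended by zero to the negative axis, that make it the value
function of the restricted dividend problem: it is a classical solution of the
Hamilton-Jacobi-Bellman equation whose derivative crosses the level `1` at `d`. -/
structure IsClassicalSolution (g : ℝ → ℝ) (lam α δ u₀ d M : ℝ) (w : ℝ → ℝ) : Prop where
  eq_zero_of_neg : ∀ x < 0, w x = 0
  monotone : Monotone w
  nonneg : ∀ x, 0 ≤ w x
  le : ∀ x, w x ≤ M
  lip : ∀ x y, 0 ≤ x → x ≤ y → |w y - w x| ≤ M * (y - x)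
  lip_conv : ∀ x y, 0 ≤ x → x ≤ y → |expConv α w y - expConv α w x| ≤ M * (y - x)
  continuousOn : ContinuousOn w (Ici 0)
  differentiableAt : ∀ x, 0 < x → DifferentiableAt ℝ w x
  equation : ∀ x, 0 < x →
    g x * deriv w x + u₀ * max 0 (1 - deriv w x) = (lam + δ) * w x - lam * expConv α w x
  deriv_nonneg : ∀ x, 0 < x → 0 ≤ deriv w x
  deriv_le : ∀ x, 0 < x → deriv w x ≤ M
  one_le_deriv : ∀ x, 0 < x → x ≤ d → 1 ≤ deriv w x
  deriv_le_one : ∀ x, d ≤ x → deriv w x ≤ 1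
  continuousAt_deriv : ContinuousAt (deriv w) d

/-! ### Signs and regularity of `ψ₁` and `ψ₂` -/

section candidate

variable {g ψ₁ ψ₂ : ℝ → ℝ} {lam α δ u₀ d : ℝ}

theorem SolvesIDE.eq_expConv (h : SolvesIDE g lam α δ ψ₁) {x : ℝ} (hx : 0 < x) :
    g x * deriv ψ₁ x = (lam + δ) * ψ₁ x - lam * expConv α ψ₁ x := by
  have := h.equation x hx
  rw [integral_eq_expConv] at this
  linarith

theorem deriv_nonneg_of_monotoneOn {f : ℝ → ℝ} (hf : MonotoneOn f (Ici 0)) {x : ℝ} (hx : 0 < x) :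
    0 ≤ deriv f x := by
  rw [← derivWithin_of_mem_nhds (Ici_mem_nhds hx)]
  exact hf.derivWithin_nonneg

/-- As `x → 0` the convolution disappears from the equation, leaving `(lam + δ) ψ₁ 0` as a limit of
terms that dominate `g ψ₁' ≥ 0`. -/
theorem SolvesIDE.zero_nonneg (h : SolvesIDE g lam α δ ψ₁) (hmono : StrictMonoOn ψ₁ (Ici 0))
    (hlam : 0 < lam) (hα : 0 < α) (hδ : 0 < δ) (hg : ∀ x, 0 < x → 0 < g x) : 0 ≤ ψ₁ 0 := by
  have h1 : ∀ x, 0 < x →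
      0 ≤ (lam + δ) * ψ₁ x - lam * (ψ₁ 0 * (1 - Real.exp (-α * x))) := by
    intro x hx
    have h2 : 0 ≤ g x * deriv ψ₁ x :=
      mul_nonneg (hg x hx).le (deriv_nonneg_of_monotoneOn hmono.monotoneOn hx)
    rw [h.eq_expConv hx] at h2
    have h3 := le_expConv hα h.continuousOn hx.le (C := ψ₁ 0)
      fun z hz => hmono.monotoneOn (mem_Ici.mpr le_rfl) hz.1 hz.1
    nlinarith
  have h2 : Tendsto (fun x => (lam + δ) * ψ₁ x - lam * (ψ₁ 0 * (1 - Real.exp (-α * x)))) (𝓝[>] 0)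
      (𝓝 ((lam + δ) * ψ₁ 0 - lam * (ψ₁ 0 * (1 - Real.exp (-α * 0))))) := by
    have h3 : Tendsto ψ₁ (𝓝[>] 0) (𝓝 (ψ₁ 0)) :=
      (h.continuousOn 0 (mem_Ici.mpr le_rfl)).mono_left (nhdsWithin_mono _ Ioi_subset_Ici_self)
    have h4 : Tendsto (fun x => Real.exp (-α * x)) (𝓝[>] 0) (𝓝 (Real.exp (-α * 0))) :=
      (Continuous.tendsto (by fun_prop) 0).mono_left nhdsWithin_le_nhds
    exact (h3.const_mul _).sub (((tendsto_const_nhds.sub h4).const_mul _).const_mul _)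
  have h3 := ge_of_tendsto h2 (by filter_upwards [self_mem_nhdsWithin] with x hx using h1 x hx)
  simp only [mul_zero, Real.exp_zero, sub_self, sub_zero] at h3
  exact nonneg_of_mul_nonneg_right h3 (by linarith)

/-- Monotonicity bounds the convolution by `ψ₁ x`, so the equation gives `g ψ₁' ≥ δ ψ₁ > 0`. Strict
monotonicity alone would allow a zero of the derivative at `d`. -/
theorem SolvesIDE.deriv_pos (h : SolvesIDE g lam α δ ψ₁) (hmono : StrictMonoOn ψ₁ (Ici 0))
    (hlam : 0 < lam) (hα : 0 < α) (hδ : 0 < δ) (hg : ∀ x, 0 < x → 0 < g x) {x : ℝ} (hx : 0 < x) :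
    0 < deriv ψ₁ x := by
  have h0 := h.zero_nonneg hmono hlam hα hδ hg
  have h1 : 0 < ψ₁ x := h0.trans_lt (hmono (mem_Ici.mpr le_rfl) hx.le hx)
  have h2 := expConv_le hα h.continuousOn hx.le (C := ψ₁ x)
    fun z hz => hmono.monotoneOn hz.1 hx.le hz.2
  have h3 := h.eq_expConv hx
  have h4 : 0 < g x * deriv ψ₁ x := by
    have h5 : expConv α ψ₁ x ≤ ψ₁ x := by
      have := Real.exp_pos (-α * x)
      nlinarith
    nlinarith [mul_pos hδ h1]
  exact (mul_pos_iff_of_pos_left (hg x hx)).mp h4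

/-- Solving the equation for `ψ₁'` expresses it by continuous functions, although only
differentiability is assumed. -/
theorem SolvesIDE.continuousAt_deriv (h : SolvesIDE g lam α δ ψ₁)
    (hg : ∀ x, 0 < x → 0 < g x) (hgd : ∀ x, 0 < x → DifferentiableAt ℝ g x) {x : ℝ} (hx : 0 < x) :
    ContinuousAt (deriv ψ₁) x := by
  have h1 : (fun x => ((lam + δ) * ψ₁ x - lam * expConv α ψ₁ x) / g x) =ᶠ[𝓝 x] deriv ψ₁ := by
    filter_upwards [Ioi_mem_nhds hx] with y hy
    rw [← h.eq_expConv hy, mul_div_cancel_left₀ _ (hg y hy).ne']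
  refine ContinuousAt.congr ?_ h1
  have h2 := (h.differentiableAt x hx).continuousAt
  have h3 := continuousAt_expConv (α := α) h.continuousOn hx
  exact ((continuousAt_const.mul h2).sub (continuousAt_const.mul h3)).div (hgd x hx).continuousAt
    (hg x hx).ne'

/-- Concavity is known only on the open interval, so the comparison with the slope at `d` is a left
limit of comparisons inside it. -/
theorem SolvesIDE.deriv_le_deriv (h : SolvesIDE g lam α δ ψ₁)
    (hg : ∀ x, 0 < x → 0 < g x) (hgd : ∀ x, 0 < x → DifferentiableAt ℝ g x)
    (hconc : ConcaveOn ℝ (Ioo 0 d) ψ₁) {x : ℝ} (hx : 0 < x) (hxd : x ≤ d) :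
    deriv ψ₁ d ≤ deriv ψ₁ x := by
  rcases hxd.eq_or_lt with rfl | hxd
  · exact le_rfl
  have hanti := hconc.antitoneOn_deriv fun y hy => h.differentiableAt y hy.1
  have h1 : Tendsto (deriv ψ₁) (𝓝[<] d) (𝓝 (deriv ψ₁ d)) :=
    (h.continuousAt_deriv hg hgd (hx.trans hxd)).mono_left nhdsWithin_le_nhds
  refine le_of_tendsto h1 ?_
  filter_upwards [Ioo_mem_nhdsLT hxd] with y hy
  exact hanti ⟨hx, hxd⟩ ⟨hx.trans hy.1, hy.2⟩ hy.1.le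

theorem antitoneOn_deriv_of_concave (hconc : ConcaveOn ℝ (Ioi 0) ψ₂)
    (hd : ∀ x, 0 < x → DifferentiableAt ℝ ψ₂ x) : AntitoneOn (deriv ψ₂) (Ioi 0) :=
  hconc.antitoneOn_deriv fun y hy => hd y hy

theorem deriv_nonneg_of_concave_bounded (hconc : ConcaveOn ℝ (Ioi 0) ψ₂)
    (hd : ∀ x, 0 < x → DifferentiableAt ℝ ψ₂ x) {C : ℝ} (hC : ∀ x, 0 < x → |ψ₂ x| ≤ C)
    {x : ℝ} (hx : 0 < x) : 0 ≤ deriv ψ₂ x := by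
  by_contra! hneg
  have hanti := antitoneOn_deriv_of_concave hconc hd
  have h1 : ∀ y, x < y → ψ₂ y - ψ₂ x ≤ deriv ψ₂ x * (y - x) := by
    intro y hxy
    refine (convex_Icc x y).image_sub_le_mul_sub_of_deriv_le (f := ψ₂) ?_ ?_ ?_ x
      ⟨le_rfl, hxy.le⟩ y ⟨hxy.le, le_rfl⟩ hxy.le
    · exact fun z hz => (hd z (hx.trans_le hz.1)).continuousAt.continuousWithinAt
    · intro z hz
      rw [interior_Icc] at hz
      exact (hd z (hx.trans hz.1)).differentiableWithinAt
    · intro z hz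
      rw [interior_Icc] at hz
      exact hanti hx (hx.trans hz.1) hz.1.le
  have hC0 : 0 ≤ C := (abs_nonneg _).trans (hC x hx)
  -- Along this distance the tangent at `x` falls by `2 C + 1`, more than a function bounded by `C`
  -- in absolute value can.
  set s := (2 * C + 1) / (-deriv ψ₂ x) with hs
  have hs0 : 0 < s := div_pos (by linarith) (by linarith)
  have h2 := h1 (x + s) (by linarith)
  have h3 : deriv ψ₂ x * s = -(2 * C + 1) := by
    have hne : deriv ψ₂ x ≠ 0 := hneg.ne
    rw [hs, div_neg, mul_neg, mul_div_cancel₀ _ hne]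
  have h4 := abs_le.mp (hC x hx)
  have h5 := abs_le.mp (hC (x + s) (by linarith))
  rw [add_sub_cancel_left, h3] at h2
  linarith [h4.2, h5.1]

end candidate

/-! ### Smooth fit and the Hamilton-Jacobi-Bellman equation -/

section candidate

variable {g ψ₁ ψ₂ : ℝ → ℝ} {lam α δ u₀ d : ℝ}

theorem candidate_of_neg {x : ℝ} (hx : x < 0) : candidate ψ₁ ψ₂ u₀ δ d x = 0 := if_pos hx

theorem candidate_of_lt {x : ℝ} (hx : 0 ≤ x) (hxd : x < d) :
    candidate ψ₁ ψ₂ u₀ δ d x = ψ₁ x / deriv ψ₁ d := by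
  rw [candidate, if_neg (not_lt.mpr hx), if_pos hxd]

theorem candidate_of_ge (hd : 0 < d) {x : ℝ} (hxd : d ≤ x) :
    candidate ψ₁ ψ₂ u₀ δ d x = u₀ / δ + ψ₂ x / deriv ψ₂ d := by
  rw [candidate, if_neg (by linarith), if_neg (by linarith)]

/-- The fit condition is exactly the equality of the two branches at `d`. -/
theorem candidate_of_le (hd : IsThreshold ψ₁ ψ₂ u₀ δ d) {x : ℝ} (hx : 0 ≤ x) (hxd : x ≤ d) :
    candidate ψ₁ ψ₂ u₀ δ d x = ψ₁ x / deriv ψ₁ d := by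
  rcases hxd.eq_or_lt with rfl | h
  · rw [candidate_of_ge hd.pos le_rfl]
    linarith [hd.fit]
  · exact candidate_of_lt hx h

/-- The derivative of the candidate. -/
theorem hasDerivAt_candidate (hψ₁ : SolvesIDE g lam α δ ψ₁) (hψ₂ : SolvesODE g lam α δ u₀ ψ₂)
    (hd : IsThreshold ψ₁ ψ₂ u₀ δ d) (hd₁ : 0 < deriv ψ₁ d) {x : ℝ} (hx : 0 < x) :
    HasDerivAt (candidate ψ₁ ψ₂ u₀ δ d)
      (if x < d then deriv ψ₁ x / deriv ψ₁ d else deriv ψ₂ x / deriv ψ₂ d) x := by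
  have h1 : HasDerivAt (fun x => ψ₁ x / deriv ψ₁ d) (deriv ψ₁ x / deriv ψ₁ d) x :=
    (hψ₁.differentiableAt x hx).hasDerivAt.div_const _
  have h2 : HasDerivAt (fun x => u₀ / δ + ψ₂ x / deriv ψ₂ d) (deriv ψ₂ x / deriv ψ₂ d) x :=
    ((hψ₂.differentiableAt x hx).hasDerivAt.div_const _).const_add _
  rcases lt_trichotomy x d with h | h | h
  · rw [if_pos h]
    refine h1.congr_of_eventuallyEq ?_
    filter_upwards [Ioo_mem_nhds hx h] with y hy using candidate_of_lt hy.1.le hy.2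
  · subst h
    rw [if_neg (lt_irrefl x)]
    rw [div_self hd₁.ne'] at h1
    rw [div_self hd.deriv_pos.ne'] at h2 ⊢
    -- Both one-sided derivatives at the threshold equal 1 by the normalisation of the branches.
    have h3 : HasDerivWithinAt (candidate ψ₁ ψ₂ u₀ δ x) 1 (Iic x) x := by
      refine h1.hasDerivWithinAt.congr_of_eventuallyEq ?_ (candidate_of_le hd hx.le le_rfl)
      filter_upwards [self_mem_nhdsWithin, mem_nhdsWithin_of_mem_nhds (Ioi_mem_nhds hx)] with y hy hy'
        using candidate_of_le hd (le_of_lt hy') hy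
    have h4 : HasDerivWithinAt (candidate ψ₁ ψ₂ u₀ δ x) 1 (Ici x) x := by
      refine h2.hasDerivWithinAt.congr_of_eventuallyEq ?_ (candidate_of_ge hd.pos le_rfl)
      filter_upwards [self_mem_nhdsWithin] with y hy using candidate_of_ge hd.pos hy
    have h5 := h3.union h4
    rwa [Iic_union_Ici, hasDerivWithinAt_univ] at h5
  · rw [if_neg (by linarith)]
    refine h2.congr_of_eventuallyEq ?_
    filter_upwards [Ioi_mem_nhds h] with y hy using candidate_of_ge hd.pos (le_of_lt hy)

theorem continuousOn_candidate (hψ₁ : SolvesIDE g lam α δ ψ₁) (hψ₂ : SolvesODE g lam α δ u₀ ψ₂)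
    (hd : IsThreshold ψ₁ ψ₂ u₀ δ d) (hd₁ : 0 < deriv ψ₁ d) :
    ContinuousOn (candidate ψ₁ ψ₂ u₀ δ d) (Ici 0) := by
  intro x hx
  rcases (mem_Ici.mp hx).eq_or_lt with rfl | h
  · refine ((hψ₁.continuousOn 0 hx).div_const (deriv ψ₁ d)).congr_of_eventuallyEq ?_
      (candidate_of_le hd le_rfl hd.pos.le)
    filter_upwards [self_mem_nhdsWithin, mem_nhdsWithin_of_mem_nhds (Iio_mem_nhds hd.pos)]
      with y hy hy' using candidate_of_lt hy hy'
  · exact (hasDerivAt_candidate hψ₁ hψ₂ hd hd₁ h).continuousAt.continuousWithinAt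

theorem expConv_div_const (φ : ℝ → ℝ) (c x : ℝ) :
    expConv α (fun z => φ z / c) x = expConv α φ x / c := by
  simp only [expConv, div_mul_eq_mul_div, intervalIntegral.integral_div]
  ring

/-- Above the threshold the ordinary differential equation for `ψ₂`, together with the smooth fit
at the threshold, yields the integro-differential equation for the candidate. -/
theorem candidate_equation_of_ge (hδ : 0 < δ)
    (hψ₁ : SolvesIDE g lam α δ ψ₁) (hψ₂ : SolvesODE g lam α δ u₀ ψ₂)
    (hgd : ∀ x, 0 < x → DifferentiableAt ℝ g x)
    (hd : IsThreshold ψ₁ ψ₂ u₀ δ d) (hd₁ : 0 < deriv ψ₁ d) {x : ℝ} (hx : d ≤ x) :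
    (g x - u₀) * (deriv ψ₂ x / deriv ψ₂ d) + u₀
      = (lam + δ) * candidate ψ₁ ψ₂ u₀ δ d x - lam * expConv α (candidate ψ₁ ψ₂ u₀ δ d) x := by
  set w := candidate ψ₁ ψ₂ u₀ δ d with hw
  have hc := continuousOn_candidate hψ₁ hψ₂ hd hd₁
  set c := deriv ψ₂ d with hcdef
  have hc0 : c ≠ 0 := hd.deriv_pos.ne'
  have hdp := hd.pos
  -- `H` is the residual of the equation to be proved; the differential equation for `ψ₂` amounts to
  -- `H' + α H = 0`.
  let H : ℝ → ℝ := fun x => (g x - u₀) * (deriv ψ₂ x / c) + u₀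
    - ((lam + δ) * (u₀ / δ + ψ₂ x / c) - lam * expConv α w x)
  have hH : ∀ y, d ≤ y → HasDerivAt (fun y => Real.exp (α * y) * H y) 0 y := by
    intro y hy
    have hy0 : 0 < y := hdp.trans_le hy
    have h1 : HasDerivAt H (deriv g y * (deriv ψ₂ y / c) + (g y - u₀) * (deriv (deriv ψ₂) y / c)
        - ((lam + δ) * (deriv ψ₂ y / c) - lam * (α * w y - α * expConv α w y))) y := by
      have e1 := ((hgd y hy0).hasDerivAt.sub_const u₀).mul
        ((hψ₂.differentiableAt_deriv y hy0).hasDerivAt.div_const c)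
      have e2 := (((hψ₂.differentiableAt y hy0).hasDerivAt.div_const c).const_add
        (u₀ / δ)).const_mul (lam + δ)
      have e3 := (hasDerivAt_expConv (α := α) hc hy0).const_mul lam
      exact (e1.add_const u₀).sub (e2.sub e3)
    have h2 : HasDerivAt (fun y => Real.exp (α * y)) (Real.exp (α * y) * (α * 1)) y :=
      ((hasDerivAt_id y).const_mul α).exp
    refine (h2.mul h1).congr_deriv ?_
    have hode := hψ₂.equation y hy0
    have hwy : w y = u₀ / δ + ψ₂ y / c := candidate_of_ge hdp hy
    have hode2 : (g y - u₀) * (deriv (deriv ψ₂) y / c)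
      + (α * g y - α * u₀ + deriv g y - (lam + δ)) * (deriv ψ₂ y / c)
        - α * δ * (ψ₂ y / c) = 0 := by
      field_simp
      linarith
    have hδ' : α * δ * (u₀ / δ) = α * u₀ := by field_simp
    rw [hwy]
    simp only [H]
    linear_combination Real.exp (α * y) * (hode2 - hδ')
  have hHd : H d = 0 := by
    have h1 : (g d * 1 : ℝ) = (lam + δ) * w d - lam * expConv α w d := by
      have h2 : expConv α w d = expConv α ψ₁ d / deriv ψ₁ d := by
        rw [expConv_congr (φ' := fun z => ψ₁ z / deriv ψ₁ d) hdp.le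
          fun z hz => candidate_of_lt hz.1 hz.2, expConv_div_const]
      rw [h2, hw, candidate_of_le hd hdp.le le_rfl]
      have h3 := hψ₁.eq_expConv hdp
      field_simp
      linarith
    have h4 : w d = u₀ / δ + ψ₂ d / c := candidate_of_ge hdp le_rfl
    simp only [H]
    rw [← h4, ← hcdef, div_self hc0]
    linarith
  have h1 := constant_of_has_deriv_right_zero (f := fun y => Real.exp (α * y) * H y)
    (a := d) (b := x) (fun y hy => (hH y hy.1).continuousAt.continuousWithinAt)
    (fun y hy => (hH y hy.1).hasDerivWithinAt) x ⟨hx, le_rfl⟩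
  simp only [hHd, mul_zero, mul_eq_zero, Real.exp_ne_zero, false_or] at h1
  have h4 : w x = u₀ / δ + ψ₂ x / c := candidate_of_ge hdp hx
  rw [h4]
  simp only [H] at h1
  linarith

theorem exists_isClassicalSolution_candidate (hlam : 0 < lam) (hα : 0 < α) (hδ : 0 < δ)
    (hu₀ : 0 < u₀) (hgd : ∀ x, 0 < x → DifferentiableAt ℝ g x) (hg : ∀ x, 0 ≤ x → u₀ < g x)
    (hψ₁ : SolvesIDE g lam α δ ψ₁) (hψ₁_mono : StrictMonoOn ψ₁ (Ici 0))
    (hψ₂ : SolvesODE g lam α δ u₀ ψ₂) (hψ₂_bdd : ∃ C : ℝ, ∀ x : ℝ, 0 < x → |ψ₂ x| ≤ C)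
    (hψ₂_conc : ConcaveOn ℝ (Ioi 0) ψ₂) (hd : IsThreshold ψ₁ ψ₂ u₀ δ d) :
    ∃ M, 0 ≤ M ∧ IsClassicalSolution g lam α δ u₀ d M (candidate ψ₁ ψ₂ u₀ δ d) := by
  have hg0 : ∀ x, 0 < x → 0 < g x := fun x hx => hu₀.trans (hg x hx.le)
  have hd₁ : 0 < deriv ψ₁ d := hψ₁.deriv_pos hψ₁_mono hlam hα hδ hg0 hd.pos
  have hd₂ := hd.deriv_pos
  have hdp := hd.pos
  obtain ⟨C, hC⟩ := hψ₂_bdd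
  set w := candidate ψ₁ ψ₂ u₀ δ d with hw
  have hder := fun x (hx : 0 < x) => hasDerivAt_candidate hψ₁ hψ₂ hd hd₁ hx
  have hcont : ContinuousOn w (Ici 0) := continuousOn_candidate hψ₁ hψ₂ hd hd₁
  have hdiff : ∀ x, 0 < x → DifferentiableAt ℝ w x := fun x hx => (hder x hx).differentiableAt
  have hlow : ∀ x, 0 < x → x ≤ d → deriv w x = deriv ψ₁ x / deriv ψ₁ d := by
    intro x hx hxd
    rw [(hder x hx).deriv]
    rcases hxd.eq_or_lt with rfl | h
    · rw [if_neg (lt_irrefl _), div_self hd₁.ne', div_self hd₂.ne']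
    · rw [if_pos h]
  have hup : ∀ x, d ≤ x → deriv w x = deriv ψ₂ x / deriv ψ₂ d := by
    intro x hx
    rw [(hder x (hdp.trans_le hx)).deriv, if_neg (not_lt.mpr hx)]
  have hone : ∀ x, 0 < x → x ≤ d → 1 ≤ deriv w x := by
    intro x hx hxd
    rw [hlow x hx hxd, one_le_div hd₁]
    exact hψ₁.deriv_le_deriv hg0 hgd hd.concaveOn hx hxd
  have hle1 : ∀ x, d ≤ x → deriv w x ≤ 1 := by
    intro x hx
    rw [hup x hx, div_le_one hd₂]
    exact antitoneOn_deriv_of_concave hψ₂_conc hψ₂.differentiableAt hdp (hdp.trans_le hx) hx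
  have hnn : ∀ x, 0 < x → 0 ≤ deriv w x := by
    intro x hx
    rcases le_total x d with h | h
    · exact zero_le_one.trans (hone x hx h)
    · rw [hup x h]
      exact div_nonneg (deriv_nonneg_of_concave_bounded hψ₂_conc hψ₂.differentiableAt hC hx) hd₂.le
  have hmonoOn : MonotoneOn w (Ici 0) := by
    apply monotoneOn_of_deriv_nonneg (convex_Ici 0) hcont
    · intro x hx
      rw [interior_Ici] at hx
      exact (hdiff x hx).differentiableWithinAt
    · intro x hx
      rw [interior_Ici] at hx
      exact hnn x hx
  have hw0 : 0 ≤ w 0 := by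
    rw [hw, candidate_of_le hd le_rfl hdp.le]
    exact div_nonneg (hψ₁.zero_nonneg hψ₁_mono hlam hα hδ hg0) hd₁.le
  have hneg : ∀ x < 0, w x = 0 := fun x hx => candidate_of_neg hx
  have hwnn : ∀ x, 0 ≤ w x := by
    intro x
    rcases lt_or_ge x 0 with h | h
    · rw [hneg x h]
    · exact hw0.trans (hmonoOn (mem_Ici.mpr le_rfl) h h)
  have hmono : Monotone w := by
    intro x y hxy
    rcases lt_or_ge x 0 with h | h
    · rw [hneg x h]; exact hwnn y
    · exact hmonoOn h (h.trans hxy) hxy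
  have hbd : ∀ x, w x ≤ u₀ / δ + C / deriv ψ₂ d := by
    intro x
    refine (hmono (le_max_left x d)).trans ?_
    rw [hw, candidate_of_ge hdp (le_max_right x d)]
    have : ψ₂ (max x d) ≤ C := (le_abs_self _).trans (hC _ (hdp.trans_le (le_max_right x d)))
    gcongr
  have heq : ∀ x, 0 < x → g x * deriv w x + u₀ * max 0 (1 - deriv w x)
      = (lam + δ) * w x - lam * expConv α w x := by
    intro x hx
    rcases lt_or_ge x d with h | h
    · rw [max_eq_left (by linarith [hone x hx h.le]), hlow x hx h.le]
      have h2 : expConv α w x = expConv α ψ₁ x / deriv ψ₁ d := by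
        rw [expConv_congr (φ' := fun z => ψ₁ z / deriv ψ₁ d) hx.le
          fun z hz => candidate_of_lt hz.1 (hz.2.trans h), expConv_div_const]
      rw [h2, hw, candidate_of_lt hx.le h]
      have h3 := hψ₁.eq_expConv hx
      field_simp
      linarith
    · rw [max_eq_right (by linarith [hle1 x h]), hup x h,
        ← candidate_equation_of_ge hδ hψ₁ hψ₂ hgd hd hd₁ h]
      ring
  set B := u₀ / δ + C / deriv ψ₂ d with hB
  have hB0 : 0 ≤ B := (hwnn 0).trans (hbd 0)
  have hqnn : ∀ x, 0 ≤ x → 0 ≤ expConv α w x := by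
    intro x hx
    simpa using le_expConv hα hcont hx (C := 0) fun z _ => hwnn z
  have hqle : ∀ x, 0 ≤ x → expConv α w x ≤ w x * (1 - Real.exp (-α * x)) := fun x hx =>
    expConv_le hα hcont hx fun z hz => hmono hz.2
  -- Below `d` the equation gives `u₀ w' ≤ g w' ≤ (lam + δ) B`; above `d` the slope is at most 1.
  set D := max 1 ((lam + δ) * B / u₀) with hD
  have hdle : ∀ x, 0 < x → deriv w x ≤ D := by
    intro x hx
    rcases le_total x d with h | h
    · refine le_trans ?_ (le_max_right _ _)
      have h1 := heq x hx
      rw [max_eq_left (by linarith [hone x hx h])] at h1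
      rw [le_div_iff₀ hu₀]
      have h2 : deriv w x * u₀ ≤ deriv w x * g x :=
        mul_le_mul_of_nonneg_left (hg x hx.le).le (hnn x hx)
      have h3 := mul_nonneg hlam.le (hqnn x hx.le)
      have h4 : (lam + δ) * w x ≤ (lam + δ) * B :=
        mul_le_mul_of_nonneg_left (hbd x) (by linarith)
      linarith
    · exact (hle1 x h).trans (le_max_left _ _)
  have hlip : ∀ x y, 0 ≤ x → x ≤ y → |w y - w x| ≤ D * (y - x) := by
    intro x y hx hxy
    rw [abs_of_nonneg (sub_nonneg.mpr (hmono hxy))]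
    refine (convex_Ici (0 : ℝ)).image_sub_le_mul_sub_of_deriv_le hcont ?_ ?_ x hx y (hx.trans hxy) hxy
    · intro z hz
      rw [interior_Ici] at hz
      exact (hdiff z hz).differentiableWithinAt
    · intro z hz
      rw [interior_Ici] at hz
      exact hdle z hz
  have hlipc : ∀ x y, 0 ≤ x → x ≤ y → |expConv α w y - expConv α w x| ≤ (α * B) * (y - x) := by
    intro x y hx hxy
    rcases hx.eq_or_lt with rfl | hx
    · rw [expConv_zero, sub_zero, abs_of_nonneg (hqnn y hxy), sub_zero]
      refine (hqle y hxy).trans ?_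
      have h1 : 1 - Real.exp (-α * y) ≤ α * y := by
        have := Real.add_one_le_exp (-α * y)
        linarith
      have h2 : 0 ≤ 1 - Real.exp (-α * y) := by
        have : Real.exp (-α * y) ≤ 1 := Real.exp_le_one_iff.mpr (by nlinarith)
        linarith
      calc w y * (1 - Real.exp (-α * y)) ≤ B * (α * y) :=
            mul_le_mul (hbd y) h1 h2 hB0
        _ = _ := by ring
    · have hdq : ∀ z ∈ Ioi (0 : ℝ), HasDerivAt (expConv α w) (α * w z - α * expConv α w z) z :=
        fun z hz => hasDerivAt_expConv hcont hz
      have := (convex_Ioi (0 : ℝ)).norm_image_sub_le_of_norm_hasDerivWithin_le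
        (f := expConv α w) (C := α * B) (x := x) (y := y)
        (fun z hz => (hdq z hz).hasDerivWithinAt) ?_ hx (hx.trans_le hxy)
      · simpa [Real.norm_eq_abs, abs_of_nonneg (sub_nonneg.mpr hxy)] using this
      · intro z hz
        have hz' : 0 ≤ z := le_of_lt hz
        have h1 := hqle z hz'
        have h2 := hqnn z hz'
        have h3 : 0 ≤ w z * Real.exp (-α * z) := mul_nonneg (hwnn z) (Real.exp_pos _).le
        have h4 := hbd z
        rw [Real.norm_eq_abs, ← mul_sub, abs_mul, abs_of_pos hα]
        refine mul_le_mul_of_nonneg_left ?_ hα.le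
        rw [abs_le]
        constructor <;> nlinarith
  have hcd : ContinuousAt (deriv w) d := by
    rw [continuousAt_iff_continuous_left_right]
    constructor
    · have h1 : ContinuousWithinAt (fun x => deriv ψ₁ x / deriv ψ₁ d) (Iic d) d :=
        ((hψ₁.continuousAt_deriv hg0 hgd hdp).div_const _).continuousWithinAt
      refine h1.congr_of_eventuallyEq ?_ (hlow d hdp le_rfl)
      filter_upwards [self_mem_nhdsWithin, mem_nhdsWithin_of_mem_nhds (Ioi_mem_nhds hdp)]
        with y hy hy' using hlow y hy' hy
    · have h1 : ContinuousWithinAt (fun x => deriv ψ₂ x / deriv ψ₂ d) (Ici d) d :=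
        ((hψ₂.differentiableAt_deriv d hdp).continuousAt.div_const _).continuousWithinAt
      refine h1.congr_of_eventuallyEq ?_ (hup d le_rfl)
      filter_upwards [self_mem_nhdsWithin] with y hy using hup y hy
  have hD1 : 0 ≤ D := zero_le_one.trans (le_max_left _ _)
  refine ⟨max (max B D) (α * B), hB0.trans (le_max_of_le_left (le_max_left _ _)), ?_⟩
  exact
    { eq_zero_of_neg := hneg
      monotone := hmono
      nonneg := hwnn
      le := fun x => (hbd x).trans (le_max_of_le_left (le_max_left _ _))
      lip := fun x y hx hxy => (hlip x y hx hxy).trans <| mul_le_mul_of_nonneg_right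
        (le_max_of_le_left (le_max_right _ _)) (sub_nonneg.mpr hxy)
      lip_conv := fun x y hx hxy => (hlipc x y hx hxy).trans <| mul_le_mul_of_nonneg_right
        (le_max_right _ _) (sub_nonneg.mpr hxy)
      continuousOn := hcont
      differentiableAt := hdiff
      equation := heq
      deriv_nonneg := hnn
      deriv_le := fun x hx => (hdle x hx).trans (le_max_of_le_left (le_max_right _ _))
      one_le_deriv := hone
      deriv_le_one := hle1
      continuousAt_deriv := hcd }

end candidate

/-! ### The number of claims along a path -/

section count

variable {Ω : Type*} {T Y : ℕ → Ω → ℝ} {ω : Ω} {t : ℝ} {n : ℕ}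

theorem claimCount_eq (hT : Monotone fun k => T k ω) (h₁ : T n ω ≤ t) (h₂ : t < T (n + 1) ω) :
    claimCount T t ω = n := by
  have : {k : ℕ | T (k + 1) ω ≤ t} = (Finset.range n : Set ℕ) := by
    ext k
    simp only [mem_ofPred_eq, Finset.coe_range, mem_Iio]
    constructor
    · intro h
      by_contra! hk
      exact absurd (h₂.trans_le (hT (by omega : n + 1 ≤ k + 1))) (not_lt.mpr h)
    · intro h
      exact (hT (by omega : k + 1 ≤ n)).trans h₁
  rw [claimCount, this, ncard_coe_finset, Finset.card_range]

/-- `ncard` is 0 on infinite sets, so the count 0 may also mean infinitely many arrivals by time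
`t`; a nonzero count is reliable. -/
theorem claimCount_spec (hT : Monotone fun k => T k ω) (hn : claimCount T t ω = n) (h0 : n ≠ 0) :
    T n ω ≤ t ∧ t < T (n + 1) ω := by
  have hfin : {k : ℕ | T (k + 1) ω ≤ t}.Finite := by
    by_contra h
    exact h0 (hn ▸ Set.Infinite.ncard h)
  by_cases hall : ∀ k, T (k + 1) ω ≤ t
  · exact absurd (hfin.subset fun k _ => hall k) (infinite_univ (α := ℕ))
  · push Not at hall
    classical
    have hm := Nat.find_spec hall
    have hlt : ∀ k < Nat.find hall, T (k + 1) ω ≤ t := fun k hk => not_lt.mp (Nat.find_min hall hk)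
    set m := Nat.find hall
    rcases Nat.eq_zero_or_pos m with h | h
    · exfalso
      apply h0
      rw [← hn, claimCount, ncard_eq_zero hfin]
      ext k
      simp only [mem_ofPred_eq, mem_empty_iff_false, iff_false, not_le]
      exact hm.trans_le (hT (by omega))
    · have h1 : T m ω ≤ t := by
        have := hlt (m - 1) (by omega)
        rwa [Nat.sub_add_cancel h] at this
      have h2 := claimCount_eq hT h1 hm
      rw [hn] at h2
      rw [h2]
      exact ⟨h1, hm⟩

theorem exists_claimCount_eq (hT : Monotone fun k => T k ω) (h0 : T 0 ω = 0)
    (hlim : Tendsto (fun k => T k ω) atTop atTop) (ht : 0 ≤ t) :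
    T (claimCount T t ω) ω ≤ t ∧ t < T (claimCount T t ω + 1) ω := by
  rcases Nat.eq_zero_or_pos (claimCount T t ω) with h | h
  · rw [h]
    refine ⟨h0.trans_le ht, ?_⟩
    by_contra! hle
    obtain ⟨m, hm⟩ := (hlim.eventually_gt_atTop t).exists
    have hfin : {k : ℕ | T (k + 1) ω ≤ t}.Finite :=
      (finite_lt_nat m).subset fun k hk => by
        by_contra hkm
        exact absurd (hm.trans_le (hT (by simp only [mem_ofPred_eq] at hkm; omega : m ≤ k + 1)))
          (not_lt.mpr hk)
    rw [claimCount, ncard_eq_zero hfin] at h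
    have : (0 : ℕ) ∈ {k : ℕ | T (k + 1) ω ≤ t} := hle
    rw [h] at this
    exact this
  · exact claimCount_spec hT rfl h.ne'

theorem claimCount_mono (hT : Monotone fun k => T k ω) (h0 : T 0 ω = 0)
    (hlim : Tendsto (fun k => T k ω) atTop atTop) {s : ℝ} (hs : 0 ≤ s) (hst : s ≤ t) :
    claimCount T s ω ≤ claimCount T t ω := by
  have h1 := exists_claimCount_eq hT h0 hlim hs
  have h2 := exists_claimCount_eq hT h0 hlim (hs.trans hst)
  by_contra! h
  have := hT (by omega : claimCount T t ω + 1 ≤ claimCount T s ω)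
  simp only at this
  linarith [h1.1, h2.2]

theorem aggregateClaims_sub (hT : Monotone fun k => T k ω) (h0 : T 0 ω = 0)
    (hlim : Tendsto (fun k => T k ω) atTop atTop) {s : ℝ} (hs : 0 ≤ s) (hst : s ≤ t) :
    aggregateClaims T Y t ω - aggregateClaims T Y s ω
      = ∑ k ∈ Finset.Ico (claimCount T s ω) (claimCount T t ω), Y k ω :=
  (Finset.sum_Ico_eq_sub _ (claimCount_mono hT h0 hlim hs hst)).symm

theorem aggregateClaims_mono (hT : Monotone fun k => T k ω) (h0 : T 0 ω = 0)
    (hlim : Tendsto (fun k => T k ω) atTop atTop) (hY : ∀ k, 0 < Y k ω) {s : ℝ} (hs : 0 ≤ s)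
    (hst : s ≤ t) : aggregateClaims T Y s ω ≤ aggregateClaims T Y t ω := by
  rw [← sub_nonneg, aggregateClaims_sub hT h0 hlim hs hst]
  exact Finset.sum_nonneg fun k _ => (hY k).le

theorem aggregateClaims_pos (hT : Monotone fun k => T k ω) (h0 : T 0 ω = 0)
    (hlim : Tendsto (fun k => T k ω) atTop atTop) (hY : ∀ k, 0 < Y k ω) {s : ℝ} (hs : 0 ≤ s)
    (hst : s ≤ t) (h : claimCount T s ω < claimCount T t ω) :
    0 < aggregateClaims T Y t ω - aggregateClaims T Y s ω := by
  rw [aggregateClaims_sub hT h0 hlim hs hst]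
  exact Finset.sum_pos (fun k _ => hY k) (Finset.nonempty_Ico.mpr h)

variable [MeasurableSpace Ω]

theorem measurable_claimCount (hmono : ∀ ω, Monotone fun k => T k ω)
    (hT : ∀ k, Measurable (T k)) {t : Ω → ℝ} (ht : Measurable t) :
    Measurable fun ω => claimCount T (t ω) ω := by
  have h1 : ∀ n : ℕ, n ≠ 0 → MeasurableSet ((fun ω => claimCount T (t ω) ω) ⁻¹' {n}) := by
    intro n hn
    have : (fun ω => claimCount T (t ω) ω) ⁻¹' {n} = {ω | T n ω ≤ t ω} ∩ {ω | t ω < T (n + 1) ω} := by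
      ext ω
      simp only [mem_preimage, mem_singleton_iff, mem_inter_iff, mem_ofPred_eq]
      exact ⟨fun h => claimCount_spec (hmono ω) h hn, fun h => claimCount_eq (hmono ω) h.1 h.2⟩
    rw [this]
    exact (measurableSet_le (hT n) ht).inter (measurableSet_lt ht (hT (n + 1)))
  apply measurable_to_countable'
  intro n
  rcases eq_or_ne n 0 with rfl | hn
  -- The count 0 includes the paths with infinitely many arrivals, so its fibre is described as the
  -- complement of the others.
  · have : (fun ω => claimCount T (t ω) ω) ⁻¹' {0}
        = (⋃ m : ℕ, (fun ω => claimCount T (t ω) ω) ⁻¹' {m + 1})ᶜ := by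
      ext ω
      simp only [mem_preimage, mem_singleton_iff, mem_compl_iff, mem_iUnion, not_exists]
      constructor
      · intro h m; omega
      · intro h
        by_contra h'
        exact h (claimCount T (t ω) ω - 1) (by omega)
    rw [this]
    exact (MeasurableSet.iUnion fun m => h1 _ (by omega)).compl
  · exact h1 n hn

theorem Measurable.nat_apply {β : Type*} [MeasurableSpace β] {f : ℕ → Ω → β} {N : Ω → ℕ}
    (hf : ∀ n, Measurable (f n)) (hN : Measurable N) : Measurable fun ω => f (N ω) ω := by
  have : Measurable fun p : ℕ × Ω => f p.1 p.2 := measurable_from_prod_countable_right hf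
  exact this.comp (hN.prodMk measurable_id)

theorem measurable_aggregateClaims (hmono : ∀ ω, Monotone fun k => T k ω)
    (hT : ∀ k, Measurable (T k)) (hY : ∀ k, Measurable (Y k)) (t : ℝ) :
    Measurable (aggregateClaims T Y t) :=
  Measurable.nat_apply (f := fun n ω => ∑ k ∈ Finset.range n, Y k ω)
    (fun _ => Finset.measurable_sum _ fun k _ => hY k)
    (measurable_claimCount hmono hT measurable_const)

end count

/-! ### The exponential claim process -/

theorem expMeasure_Ioi {r a : ℝ} (hr : 0 < r) (ha : 0 ≤ a) :
    expMeasure r (Ioi a) = ENNReal.ofReal (Real.exp (-(r * a))) := by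
  have := isProbabilityMeasure_expMeasure hr
  have h1 : (expMeasure r).real (Iic a) = 1 - Real.exp (-(r * a)) := by
    rw [← cdf_eq_real, cdf_expMeasure_eq hr, if_pos ha]
  have h2 : (expMeasure r).real (Ioi a) = Real.exp (-(r * a)) := by
    rw [← compl_Iic, probReal_compl_eq_one_sub measurableSet_Iic, h1]; ring
  rw [← h2, ofReal_measureReal]

theorem expMeasure_ae_pos {r : ℝ} (hr : 0 < r) : ∀ᵐ y ∂(expMeasure r), 0 < y := by
  have := isProbabilityMeasure_expMeasure hr
  have h := expMeasure_Ioi hr le_rfl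
  simp only [mul_zero, neg_zero, Real.exp_zero, ENNReal.ofReal_one] at h
  exact (prob_compl_eq_zero_iff measurableSet_Ioi).mpr h

namespace IsExpClaimProcess

variable {Ω : Type*} {mΩ : MeasurableSpace Ω} {P : Measure Ω}
  {ℱ : Filtration ℝ≥0 mΩ} {lam α : ℝ} {T Y : ℕ → Ω → ℝ}

section

variable (h : IsExpClaimProcess P ℱ lam α T Y)
include h

theorem mono (ω : Ω) : Monotone fun k => T k ω := (h.arrival_strictMono ω).monotone

theorem arrival_nonneg (k : ℕ) (ω : Ω) : 0 ≤ T k ω := by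
  rw [← h.arrival_zero ω]
  exact h.mono ω (Nat.zero_le k)

theorem measurable_arrival (k : ℕ) : Measurable (T k) := by
  refine measurable_of_Iic fun t => ?_
  rcases lt_or_ge t 0 with ht | ht
  · have : T k ⁻¹' Iic t = ∅ := by
      ext ω
      simp only [mem_preimage, mem_Iic, mem_empty_iff_false, iff_false, not_le]
      exact ht.trans_le (h.arrival_nonneg k ω)
    rw [this]
    exact MeasurableSet.empty
  · exact ℱ.le _ _ (h.arrival_adapted k ⟨t, ht⟩)

theorem measurable_claim (k : ℕ) : Measurable (Y k) := by
  refine measurable_of_tendsto_metrizable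
    (f := fun n : ℕ => {ω | T (k + 1) ω ≤ ((n : ℝ≥0) : ℝ)}.indicator (Y k))
    (fun n => (h.claim_adapted k n).mono (ℱ.le _) le_rfl) ?_
  rw [tendsto_pi_nhds]
  intro ω
  refine tendsto_const_nhds.congr' ?_
  filter_upwards [(tendsto_natCast_atTop_atTop (R := ℝ)).eventually_ge_atTop (T (k + 1) ω)] with n hn
  rw [indicator_of_mem]
  simpa using hn

theorem measurable_gap (k : ℕ) : Measurable fun ω => T (k + 1) ω - T k ω :=
  (h.measurable_arrival _).sub (h.measurable_arrival _)

theorem measurable_family (j : ℕ ⊕ ℕ) :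
    Measurable (Sum.elim (fun k ω => T (k + 1) ω - T k ω) Y j) := by
  rcases j with k | k
  · exact h.measurable_gap k
  · exact h.measurable_claim k

theorem ae_claim_pos (hα : 0 < α) : ∀ᵐ ω ∂P, ∀ k, 0 < Y k ω := by
  rw [ae_all_iff]
  intro k
  exact ((h.claim_law k).ae_iff (p := fun y => 0 < y)
    (measurableSet_setOfPred.mp measurableSet_Ioi)).mpr (expMeasure_ae_pos hα)

/-- The strong law of large numbers, applied to the gaps truncated at 1, makes the arrival times
grow at least linearly. Truncation gives integrability at once and keeps the mean positive. -/
theorem ae_tendsto_arrival [IsProbabilityMeasure P] : ∀ᵐ ω ∂P, Tendsto (fun k => T k ω) atTop atTop := by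
  let Z : ℕ → Ω → ℝ := fun k ω => min (T (k + 1) ω - T k ω) 1
  have hmin : Measurable fun x : ℝ => min x 1 := by fun_prop
  have hZm : ∀ k, Measurable (Z k) := fun k => hmin.comp (h.measurable_gap k)
  have hpos : ∀ k ω, 0 < Z k ω := fun k ω =>
    lt_min (sub_pos.mpr (h.arrival_strictMono ω (Nat.lt_succ_self k))) one_pos
  have hint : Integrable (Z 0) P := by
    refine Integrable.of_bound (hZm 0).aestronglyMeasurable 1 (Eventually.of_forall fun ω => ?_)
    rw [Real.norm_eq_abs, abs_of_pos (hpos 0 ω)]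
    exact min_le_right _ _
  have hindep : Pairwise fun i j => IndepFun (Z i) (Z j) P := by
    intro i j hij
    have h1 := h.independent.indepFun (i := Sum.inl i) (j := Sum.inl j) (by simpa using hij)
    exact h1.comp hmin hmin
  have hident : ∀ i, IdentDistrib (Z i) (Z 0) P P := by
    intro i
    have h1 : IdentDistrib (fun ω => T (i + 1) ω - T i ω) (fun ω => T (0 + 1) ω - T 0 ω) P P :=
      ⟨(h.gap_law i).aemeasurable, (h.gap_law 0).aemeasurable, by
        rw [(h.gap_law i).map_eq, (h.gap_law 0).map_eq]⟩
    exact h1.comp hmin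
  have hmean : 0 < ∫ ω, Z 0 ω ∂P := by
    rw [integral_pos_iff_support_of_nonneg (fun ω => (hpos 0 ω).le) hint]
    have : Function.support (Z 0) = univ := by
      ext ω; simp [(hpos 0 ω).ne']
    rw [this, measure_univ]
    exact one_pos
  filter_upwards [strong_law_ae_real Z hint hindep hident] with ω hω
  have h2 : Tendsto (fun n : ℕ => ∑ i ∈ Finset.range n, Z i ω) atTop atTop := by
    have h3 := hω.pos_mul_atTop hmean (tendsto_natCast_atTop_atTop (R := ℝ))
    refine h3.congr' ?_
    filter_upwards [eventually_ne_atTop 0] with n hn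
    field_simp
  refine tendsto_atTop_mono (fun n => ?_) h2
  have h4 : T n ω = ∑ i ∈ Finset.range n, (T (i + 1) ω - T i ω) := by
    rw [Finset.sum_range_sub (fun i => T i ω), h.arrival_zero, sub_zero]
  rw [h4]
  exact Finset.sum_le_sum fun i _ => min_le_left _ _

theorem measurable_aggregateClaims (t : ℝ) : Measurable (aggregateClaims T Y t) :=
  Dividend.measurable_aggregateClaims h.mono h.measurable_arrival h.measurable_claim t

/-- The arrival times up to the `n`-th are independent of each later gap and of each claim. -/
theorem indepFun_arrivals (n : ℕ) (j : ℕ ⊕ ℕ) (hj : ∀ i < n, j ≠ Sum.inl i) :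
    IndepFun (fun ω (m : Fin (n + 1)) => T m ω)
      (Sum.elim (fun k ω => T (k + 1) ω - T k ω) Y j) P := by
  classical
  let S : Finset (ℕ ⊕ ℕ) := (Finset.range n).map Function.Embedding.inl
  have hdisj : Disjoint S {j} := by
    rw [Finset.disjoint_singleton_right]
    simp only [S, Finset.mem_map, Finset.mem_range, not_exists, not_and]
    intro i hi hij
    exact hj i hi hij.symm
  have h1 := h.independent.indepFun_finset S {j} hdisj h.measurable_family
  -- This map recovers the arrival times from the first `n` gaps; the default 0 is never used, since
  -- all indices below `m ≤ n` lie in `S`.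
  let φ : (S → ℝ) → (Fin (n + 1) → ℝ) := fun v m =>
    ∑ i ∈ Finset.range m, if hi : Sum.inl i ∈ S then v ⟨Sum.inl i, hi⟩ else 0
  have hφ : Measurable φ := by
    refine measurable_pi_lambda _ fun m => Finset.measurable_sum _ fun i _ => ?_
    by_cases hi : Sum.inl i ∈ S
    · simp only [hi, dif_pos]
      exact measurable_pi_apply _
    · simp only [hi, dif_neg, not_false_eq_true]
      exact measurable_const
  have hψ : Measurable fun v : (({j} : Finset (ℕ ⊕ ℕ)) → ℝ) => v ⟨j, Finset.mem_singleton_self j⟩ :=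
    measurable_pi_apply _
  have h2 := h1.comp hφ hψ
  convert! h2 using 1
  ext ω m
  simp only [Function.comp_apply, φ]
  have h4 : T m ω = ∑ i ∈ Finset.range m, (T (i + 1) ω - T i ω) := by
    rw [Finset.sum_range_sub (fun i => T i ω), h.arrival_zero, sub_zero]
  rw [h4]
  refine Finset.sum_congr rfl fun i hi => ?_
  have hmem : Sum.inl i ∈ S := by
    have hm := m.2
    rw [Finset.mem_range] at hi
    simp only [S, Finset.mem_map, Finset.mem_range]
    exact ⟨i, by omega, rfl⟩
  rw [dif_pos hmem]
  rfl

end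

end IsExpClaimProcess

/-! ### The law of the claim increment over a short interval -/

namespace IsExpClaimProcess

variable {Ω : Type*} {mΩ : MeasurableSpace Ω} {P : Measure Ω}
  {ℱ : Filtration ℝ≥0 mΩ} {lam α : ℝ} {T Y : ℕ → Ω → ℝ}

section

variable (h : IsExpClaimProcess P ℱ lam α T Y)
include h

theorem indepFun_arrival_gap (n : ℕ) :
    IndepFun (T n) (fun ω => T (n + 1) ω - T n ω) P := by
  have h1 := h.indepFun_arrivals n (Sum.inl n) (by intro i hi; simp; omega)
  exact h1.comp (measurable_pi_apply (⟨n, by omega⟩ : Fin (n + 1))) measurable_id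

/-- The integral conditions on `T n = s`: the next gap is independent of it and must exceed `t + η -
s`. -/
theorem measure_no_arrival_aux [IsProbabilityMeasure P] (hlam : 0 < lam) (n : ℕ) {t η : ℝ} (hη : 0 ≤ η) :
    P {ω | T n ω ≤ t ∧ t + η < T (n + 1) ω}
      = ∫⁻ s in Iic t, ENNReal.ofReal (Real.exp (-(lam * (t + η - s)))) ∂(P.map (T n)) := by
  have := isProbabilityMeasure_expMeasure hlam
  have hmap := (indepFun_iff_map_prod_eq_prod_map_map (h.measurable_arrival n).aemeasurable
    (h.measurable_gap n).aemeasurable).mp (h.indepFun_arrival_gap n)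
  rw [(h.gap_law n).map_eq] at hmap
  let A : Set (ℝ × ℝ) := {p | p.1 ≤ t ∧ t + η - p.1 < p.2}
  have hA : MeasurableSet A := by
    apply (measurableSet_le measurable_fst measurable_const).inter
    exact measurableSet_lt (measurable_const.sub measurable_fst) measurable_snd
  have h1 : {ω | T n ω ≤ t ∧ t + η < T (n + 1) ω}
      = (fun ω => (T n ω, T (n + 1) ω - T n ω)) ⁻¹' A := by
    ext ω
    simp only [mem_ofPred_eq, mem_preimage, A]
    exact and_congr_right fun _ => (sub_lt_sub_iff_right _).symm
  rw [h1, ← Measure.map_apply ((h.measurable_arrival n).prodMk (h.measurable_gap n)) hA, hmap,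
    Measure.prod_apply hA, ← lintegral_indicator measurableSet_Iic]
  refine lintegral_congr fun s => ?_
  by_cases hs : s ≤ t
  · rw [indicator_of_mem (mem_Iic.mpr hs), ← expMeasure_Ioi hlam (by linarith)]
    congr 1
    ext y
    simp [A, hs]
  · rw [indicator_of_notMem (by simpa using hs)]
    have : Prod.mk s ⁻¹' A = ∅ := by
      ext y
      simp [A, hs]
    rw [this, measure_empty]

/-- Memorylessness of the exponential gap: the factor `exp (-lam η)` comes out of the integral over
`T n`. -/
theorem measure_no_arrival [IsProbabilityMeasure P] (hlam : 0 < lam) (n : ℕ) {t η : ℝ} (hη : 0 ≤ η) :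
    P {ω | T n ω ≤ t ∧ t + η < T (n + 1) ω}
      = ENNReal.ofReal (Real.exp (-(lam * η))) * P {ω | T n ω ≤ t ∧ t < T (n + 1) ω} := by
  have h0 := h.measure_no_arrival_aux hlam n (t := t) (le_refl (0 : ℝ))
  simp only [add_zero] at h0
  rw [h.measure_no_arrival_aux hlam n hη, h0, ← lintegral_const_mul _ (by fun_prop)]
  refine lintegral_congr fun s => ?_
  rw [← ENNReal.ofReal_mul (Real.exp_pos _).le, ← Real.exp_add]
  ring_nf

/-- The event that `n` claims have arrived by time `t` and that at least one more arrives by time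
`t + η`. -/
def nextArrival (_ : IsExpClaimProcess P ℱ lam α T Y) (n : ℕ) (t η : ℝ) : Set Ω :=
  {ω | T n ω ≤ t ∧ t < T (n + 1) ω ∧ T (n + 1) ω ≤ t + η}

theorem measurableSet_nextArrival (n : ℕ) (t η : ℝ) : MeasurableSet (h.nextArrival n t η) :=
  (measurableSet_le (h.measurable_arrival _) measurable_const).inter
    ((measurableSet_lt measurable_const (h.measurable_arrival _)).inter
      (measurableSet_le (h.measurable_arrival _) measurable_const))

theorem measure_nextArrival [IsProbabilityMeasure P] (hlam : 0 < lam) (n : ℕ) {t η : ℝ} (hη : 0 ≤ η) :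
    P (h.nextArrival n t η) = ENNReal.ofReal (1 - Real.exp (-(lam * η)))
      * P {ω | T n ω ≤ t ∧ t < T (n + 1) ω} := by
  have hq : Real.exp (-(lam * η)) ≤ 1 := Real.exp_le_one_iff.mpr (by nlinarith)
  have h1 : {ω | T n ω ≤ t ∧ t < T (n + 1) ω}
      = {ω | T n ω ≤ t ∧ t + η < T (n + 1) ω} ∪ h.nextArrival n t η := by
    ext ω
    simp only [nextArrival, mem_union, mem_ofPred_eq]
    constructor
    · intro hω
      rcases le_or_gt (T (n + 1) ω) (t + η) with h2 | h2
      · exact Or.inr ⟨hω.1, hω.2, h2⟩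
      · exact Or.inl ⟨hω.1, h2⟩
    · rintro (hω | hω)
      · exact ⟨hω.1, by linarith [hω.2]⟩
      · exact ⟨hω.1, hω.2.1⟩
  have h2 : P {ω | T n ω ≤ t ∧ t < T (n + 1) ω}
      = P {ω | T n ω ≤ t ∧ t + η < T (n + 1) ω} + P (h.nextArrival n t η) := by
    conv_lhs => rw [h1]
    refine measure_union ?_ (h.measurableSet_nextArrival n t η)
    rw [Set.disjoint_left]
    intro ω hω hω'
    exact absurd hω.2 (not_lt.mpr hω'.2.2)
  rw [h.measure_no_arrival hlam n hη] at h2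
  set p := P {ω | T n ω ≤ t ∧ t < T (n + 1) ω} with hp
  have hpt : p ≠ ⊤ := measure_ne_top _ _
  have hqt : ENNReal.ofReal (Real.exp (-(lam * η))) * p ≠ ⊤ :=
    ENNReal.mul_ne_top ENNReal.ofReal_ne_top hpt
  apply (ENNReal.add_right_inj hqt).mp
  rw [← h2, ← add_mul, ← ENNReal.ofReal_add (Real.exp_pos _).le (by linarith)]
  simp

/-- Two arrivals within length `η` force the second gap to be at most `η`, and that gap is
independent of the earlier arrivals. Combined with `measure_nextArrival`, this makes two claims in
one step an event of order `η²`. -/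
theorem measure_nextArrival_inter_le (hlam : 0 < lam) (n : ℕ) {t η : ℝ} (hη : 0 ≤ η) :
    P (h.nextArrival n t η ∩ {ω | T (n + 2) ω ≤ t + η})
      ≤ ENNReal.ofReal (1 - Real.exp (-(lam * η))) * P (h.nextArrival n t η) := by
  have := isProbabilityMeasure_expMeasure hlam
  let A : Set (Fin (n + 2) → ℝ) :=
    {v | v ⟨n, by omega⟩ ≤ t ∧ t < v ⟨n + 1, by omega⟩ ∧ v ⟨n + 1, by omega⟩ ≤ t + η}
  have hA : MeasurableSet A :=
    (measurableSet_le (measurable_pi_apply _) measurable_const).inter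
      ((measurableSet_lt measurable_const (measurable_pi_apply _)).inter
        (measurableSet_le (measurable_pi_apply _) measurable_const))
  have h1 := h.indepFun_arrivals (n + 1) (Sum.inl (n + 1)) (by intro i hi; simp; omega)
  have h2 := h1.measure_inter_preimage_eq_mul A (Iic η) hA measurableSet_Iic
  have h3 : P ((Sum.elim (fun k ω => T (k + 1) ω - T k ω) Y (Sum.inl (n + 1))) ⁻¹' Iic η)
      = ENNReal.ofReal (1 - Real.exp (-(lam * η))) := by
    have h4 := (h.gap_law (n + 1)).map_eq
    have h5 : P ((fun ω => T (n + 1 + 1) ω - T (n + 1) ω) ⁻¹' Iic η) = expMeasure lam (Iic η) := by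
      rw [← h4, Measure.map_apply (h.measurable_gap _) measurableSet_Iic]
    simp only [Sum.elim_inl]
    rw [h5, ← ofReal_measureReal, ← cdf_eq_real, cdf_expMeasure_eq hlam, if_pos hη]
  rw [h3] at h2
  calc P (h.nextArrival n t η ∩ {ω | T (n + 2) ω ≤ t + η})
      ≤ P ((fun ω (m : Fin (n + 1 + 1)) => T m ω) ⁻¹' A ∩
          (Sum.elim (fun k ω => T (k + 1) ω - T k ω) Y (Sum.inl (n + 1))) ⁻¹' Iic η) := by
        refine measure_mono fun ω hω => ⟨hω.1, ?_⟩
        simp only [Sum.elim_inl, mem_preimage, mem_Iic]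
        have e1 := hω.1.2.1
        have e2 : T (n + 1 + 1) ω ≤ t + η := hω.2
        linarith
    _ = P (h.nextArrival n t η) * ENNReal.ofReal (1 - Real.exp (-(lam * η))) := h2
    _ = _ := mul_comm _ _

/-- The event depends on the arrival times up to index `n + 2` only, and these are independent of
the claim size. -/
theorem lintegral_one_arrival (n : ℕ) (t η : ℝ) {f : ℝ → ℝ≥0∞} (hf : Measurable f) :
    ∫⁻ ω in h.nextArrival n t η \ {ω | T (n + 2) ω ≤ t + η}, f (Y n ω) ∂P
      = P (h.nextArrival n t η \ {ω | T (n + 2) ω ≤ t + η}) * ∫⁻ y, f y ∂(expMeasure α) := by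
  let A : Set (Fin (n + 2 + 1) → ℝ) :=
    {v | v ⟨n, by omega⟩ ≤ t ∧ t < v ⟨n + 1, by omega⟩ ∧ v ⟨n + 1, by omega⟩ ≤ t + η}
      \ {v | v ⟨n + 2, by omega⟩ ≤ t + η}
  have hA : MeasurableSet A :=
    ((measurableSet_le (measurable_pi_apply _) measurable_const).inter
      ((measurableSet_lt measurable_const (measurable_pi_apply _)).inter
        (measurableSet_le (measurable_pi_apply _) measurable_const))).diff
      (measurableSet_le (measurable_pi_apply _) measurable_const)
  have hBm : MeasurableSet (h.nextArrival n t η \ {ω | T (n + 2) ω ≤ t + η}) :=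
    (h.measurableSet_nextArrival n t η).diff
      (measurableSet_le (h.measurable_arrival _) measurable_const)
  have h1 := h.indepFun_arrivals (n + 2) (Sum.inr n) (by intro i hi; simp)
  have hIm : Measurable (A.indicator fun _ => (1 : ℝ≥0∞)) := measurable_const.indicator hA
  have h2 := h1.comp hIm hf
  have hvm : Measurable fun ω (m : Fin (n + 2 + 1)) => T m ω :=
    measurable_pi_lambda _ fun m => h.measurable_arrival m
  have h3 := lintegral_mul_eq_lintegral_mul_lintegral_of_indepFun''
    (hIm.comp hvm).aemeasurable
    (hf.comp (h.measurable_claim n)).aemeasurable h2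
  have hind : ∀ ω, (A.indicator (fun _ => (1 : ℝ≥0∞)) ∘ fun ω (m : Fin (n + 2 + 1)) => T m ω) ω
      = (h.nextArrival n t η \ {ω | T (n + 2) ω ≤ t + η}).indicator (fun _ => 1) ω := fun ω => rfl
  simp only [hind] at h3
  rw [lintegral_indicator hBm, lintegral_one, Measure.restrict_apply_univ] at h3
  have h4 : ∫⁻ ω, f (Y n ω) ∂P = ∫⁻ y, f y ∂(expMeasure α) := by
    rw [← (h.claim_law n).map_eq, lintegral_map hf (h.measurable_claim n)]
  rw [← h4, ← lintegral_indicator hBm]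
  refine Eq.trans (lintegral_congr fun ω => ?_) h3
  by_cases hω : ω ∈ h.nextArrival n t η \ {ω | T (n + 2) ω ≤ t + η}
  · simp [indicator_of_mem hω]
  · simp [indicator_of_notMem hω]

/-- Since claims are positive, the aggregate increment itself detects arrivals. This matters because
independence of the past is given for increments of the aggregate claims, not for the counting
process. -/
theorem mem_nextArrival_iff {ω : Ω} (hlim : Tendsto (fun k => T k ω) atTop atTop)
    (hY : ∀ k, 0 < Y k ω) {t η : ℝ} (ht : 0 ≤ t) (hη : 0 ≤ η) (n : ℕ) :
    ω ∈ h.nextArrival n t η ↔ claimCount T t ω = n ∧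
      aggregateClaims T Y (t + η) ω - aggregateClaims T Y t ω ≠ 0 := by
  have h1 := exists_claimCount_eq (h.mono ω) (h.arrival_zero ω) hlim ht
  have h2 := exists_claimCount_eq (h.mono ω) (h.arrival_zero ω) hlim (by linarith : 0 ≤ t + η)
  constructor
  · intro hω
    have hn := claimCount_eq (h.mono ω) hω.1 hω.2.1
    refine ⟨hn, (aggregateClaims_pos (h.mono ω) (h.arrival_zero ω) hlim hY ht (by linarith) ?_).ne'⟩
    rw [hn]
    by_contra! hle
    have := h.mono ω (by omega : claimCount T (t + η) ω + 1 ≤ n + 1)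
    simp only at this
    linarith [hω.2.2]
  · rintro ⟨rfl, hD⟩
    refine ⟨h1.1, h1.2, ?_⟩
    by_contra! hlt
    have hm := claimCount_eq (h.mono ω) (n := claimCount T t ω) (t := t + η)
      (by linarith [h1.1]) hlt
    rw [aggregateClaims_sub (h.mono ω) (h.arrival_zero ω) hlim ht (by linarith), hm] at hD
    simp at hD

theorem aggregateClaims_sub_of_one_arrival {ω : Ω} {n : ℕ} {t η : ℝ}
    (hω : ω ∈ h.nextArrival n t η \ {ω | T (n + 2) ω ≤ t + η}) :
    aggregateClaims T Y (t + η) ω - aggregateClaims T Y t ω = Y n ω := by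
  have h1 := claimCount_eq (h.mono ω) hω.1.1 hω.1.2.1
  have h2 := claimCount_eq (h.mono ω) (n := n + 1) hω.1.2.2 (not_le.mp hω.2)
  rw [aggregateClaims, aggregateClaims, h1, h2, Finset.sum_range_succ, add_sub_cancel_left]

theorem pairwise_disjoint_nextArrival (t η : ℝ) :
    Pairwise (Function.onFun Disjoint fun n => h.nextArrival n t η) := by
  intro n m hnm
  rw [Function.onFun, Set.disjoint_left]
  intro ω h1 h2
  exact hnm ((claimCount_eq (h.mono ω) h1.1 h1.2.1).symm.trans
    (claimCount_eq (h.mono ω) h2.1 h2.2.1))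

theorem ne_zero_ae_eq_iUnion [IsProbabilityMeasure P] (hα : 0 < α) {t η : ℝ} (ht : 0 ≤ t)
    (hη : 0 ≤ η) :
    {ω | aggregateClaims T Y (t + η) ω - aggregateClaims T Y t ω ≠ 0}
      =ᵐ[P] ⋃ n, h.nextArrival n t η := by
  filter_upwards [h.ae_tendsto_arrival, h.ae_claim_pos hα] with ω h1 h2
  apply propext
  change (aggregateClaims T Y (t + η) ω - aggregateClaims T Y t ω ≠ 0) ↔
    ω ∈ ⋃ n, h.nextArrival n t η
  rw [mem_iUnion]
  simp only [h.mem_nextArrival_iff h1 h2 ht hη]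
  simp

theorem tsum_measure_claimCount [IsProbabilityMeasure P] {t : ℝ} (ht : 0 ≤ t) :
    ∑' n, P {ω | T n ω ≤ t ∧ t < T (n + 1) ω} = 1 := by
  rw [← measure_iUnion]
  · rw [← measure_univ (μ := P)]
    apply measure_congr
    filter_upwards [h.ae_tendsto_arrival] with ω h1
    apply propext
    change ω ∈ (⋃ n, {ω | T n ω ≤ t ∧ t < T (n + 1) ω}) ↔ ω ∈ univ
    simp only [mem_iUnion, mem_univ, iff_true]
    exact ⟨_, exists_claimCount_eq (h.mono ω) (h.arrival_zero ω) h1 ht⟩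
  · intro n m hnm
    rw [Function.onFun, Set.disjoint_left]
    intro ω h1 h2
    exact hnm ((claimCount_eq (h.mono ω) h1.1 h1.2).symm.trans
      (claimCount_eq (h.mono ω) h2.1 h2.2))
  · exact fun n => (measurableSet_le (h.measurable_arrival _) measurable_const).inter
      (measurableSet_lt measurable_const (h.measurable_arrival _))

theorem tsum_measure_nextArrival [IsProbabilityMeasure P] (hlam : 0 < lam) {t η : ℝ} (ht : 0 ≤ t)
    (hη : 0 ≤ η) :
    ∑' n, P (h.nextArrival n t η) = ENNReal.ofReal (1 - Real.exp (-(lam * η))) := by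
  simp only [h.measure_nextArrival hlam _ hη]
  rw [ENNReal.tsum_mul_left, h.tsum_measure_claimCount ht, mul_one]

/-- The event of a nonzero increment is split by the number `n` of earlier claims and by whether a
second claim follows. One claim contributes its exact law; the rest has probability at most `p²`,
with `p` the probability of a nonzero increment. -/
theorem lintegral_increment_bounds [IsProbabilityMeasure P] (hlam : 0 < lam) (hα : 0 < α) {t η : ℝ}
    (ht : 0 ≤ t) (hη : 0 ≤ η) {f : ℝ → ℝ≥0∞} (hf : Measurable f) {C : ℝ≥0∞} (hC : ∀ y, f y ≤ C) :
    (∫⁻ ω in {ω | aggregateClaims T Y (t + η) ω - aggregateClaims T Y t ω ≠ 0},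
        f (aggregateClaims T Y (t + η) ω - aggregateClaims T Y t ω) ∂P
      ≤ ENNReal.ofReal (1 - Real.exp (-(lam * η))) * (∫⁻ y, f y ∂(expMeasure α))
        + C * ENNReal.ofReal (1 - Real.exp (-(lam * η))) ^ 2) ∧
    (ENNReal.ofReal (1 - Real.exp (-(lam * η))) * (∫⁻ y, f y ∂(expMeasure α))
      ≤ ∫⁻ ω in {ω | aggregateClaims T Y (t + η) ω - aggregateClaims T Y t ω ≠ 0},
          f (aggregateClaims T Y (t + η) ω - aggregateClaims T Y t ω) ∂P
        + C * ENNReal.ofReal (1 - Real.exp (-(lam * η))) ^ 2) := by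
  have := isProbabilityMeasure_expMeasure hα
  set D : Ω → ℝ := fun ω => aggregateClaims T Y (t + η) ω - aggregateClaims T Y t ω with hD
  set p := ENNReal.ofReal (1 - Real.exp (-(lam * η))) with hp
  set m := ∫⁻ y, f y ∂(expMeasure α) with hm
  have hmC : m ≤ C := by
    calc m ≤ ∫⁻ _, C ∂(expMeasure α) := lintegral_mono hC
      _ = C := by simp
  have hsum : ∫⁻ ω in {ω | D ω ≠ 0}, f (D ω) ∂P
      = ∑' n, ∫⁻ ω in h.nextArrival n t η, f (D ω) ∂P := by
    rw [setLIntegral_congr (h.ne_zero_ae_eq_iUnion hα ht hη),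
      lintegral_iUnion (fun n => h.measurableSet_nextArrival n t η)
        (h.pairwise_disjoint_nextArrival t η)]
  have hA2 : ∀ n, MeasurableSet {ω | T (n + 2) ω ≤ t + η} := fun n =>
    measurableSet_le (h.measurable_arrival _) measurable_const
  have hsplit : ∀ n, ∫⁻ ω in h.nextArrival n t η, f (D ω) ∂P
      = ∫⁻ ω in h.nextArrival n t η ∩ {ω | T (n + 2) ω ≤ t + η}, f (D ω) ∂P
        + P (h.nextArrival n t η \ {ω | T (n + 2) ω ≤ t + η}) * m := by
    intro n
    rw [← lintegral_inter_add_sdiff _ _ (hA2 n), ← h.lintegral_one_arrival n t η hf]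
    congr 1
    refine setLIntegral_congr_fun ((h.measurableSet_nextArrival n t η).diff (hA2 n)) ?_
    intro ω hω
    simp only [hD, h.aggregateClaims_sub_of_one_arrival hω]
  have hmeas : ∀ n, P (h.nextArrival n t η)
      = P (h.nextArrival n t η ∩ {ω | T (n + 2) ω ≤ t + η})
        + P (h.nextArrival n t η \ {ω | T (n + 2) ω ≤ t + η}) := fun n =>
    (measure_inter_add_sdiff _ (hA2 n)).symm
  have htwo : ∀ n, P (h.nextArrival n t η ∩ {ω | T (n + 2) ω ≤ t + η})
      ≤ p * P (h.nextArrival n t η) := fun n => h.measure_nextArrival_inter_le hlam n hη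
  have htot := h.tsum_measure_nextArrival hlam ht hη
  have e1 : p * m + C * p ^ 2
      = ∑' n, (P (h.nextArrival n t η) * m + C * (p * P (h.nextArrival n t η))) := by
    rw [ENNReal.tsum_add, ENNReal.tsum_mul_right, ENNReal.tsum_mul_left, ENNReal.tsum_mul_left,
      htot, sq]
  constructor
  · rw [hsum, e1]
    refine ENNReal.tsum_le_tsum fun n => ?_
    rw [hsplit, add_comm]
    refine add_le_add ?_ ?_
    · gcongr
      exact sdiff_subset
    · calc _ ≤ ∫⁻ _ in h.nextArrival n t η ∩ {ω | T (n + 2) ω ≤ t + η}, C ∂P :=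
            lintegral_mono fun ω => hC _
        _ = C * P (h.nextArrival n t η ∩ {ω | T (n + 2) ω ≤ t + η}) := by
            rw [setLIntegral_const]
        _ ≤ _ := by gcongr; exact htwo n
  · have e2 : p * m = ∑' n, P (h.nextArrival n t η) * m := by
      rw [ENNReal.tsum_mul_right, htot]
    have e3 : C * p ^ 2 = ∑' n, C * (p * P (h.nextArrival n t η)) := by
      rw [ENNReal.tsum_mul_left, ENNReal.tsum_mul_left, htot, sq]
    rw [hsum, e2, e3, ← ENNReal.tsum_add]
    refine ENNReal.tsum_le_tsum fun n => ?_
    rw [hsplit, hmeas n, add_mul, add_comm, ← hmeas n, add_right_comm, add_comm (P _ * m)]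
    refine add_le_add_left ?_ _
    refine le_add_left ?_
    calc _ ≤ p * P (h.nextArrival n t η) * C := by gcongr; exact htwo n
      _ = _ := mul_comm _ _

/-- The law of the increment of the aggregate claims over a time interval of length `η`, up to
errors of order `η ^ 2`. -/
theorem increment_law [IsProbabilityMeasure P] (hlam : 0 < lam) (hα : 0 < α) {t η : ℝ}
    (ht : 0 ≤ t) (hη : 0 ≤ η) {f : ℝ → ℝ} (hf : Measurable f) {C : ℝ} (hf0 : ∀ y, 0 ≤ f y)
    (hC : ∀ y, f y ≤ C) :
    |∫ y in {0}ᶜ, f y ∂(P.map fun ω => aggregateClaims T Y (t + η) ω - aggregateClaims T Y t ω)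
      - (1 - Real.exp (-(lam * η))) * ∫ y, f y ∂(expMeasure α)|
      ≤ C * (1 - Real.exp (-(lam * η))) ^ 2 := by
  have := isProbabilityMeasure_expMeasure hα
  have hDm : Measurable fun ω => aggregateClaims T Y (t + η) ω - aggregateClaims T Y t ω :=
    (h.measurable_aggregateClaims _).sub (h.measurable_aggregateClaims _)
  have hC0 : 0 ≤ C := (hf0 0).trans (hC 0)
  have hp0 : 0 ≤ 1 - Real.exp (-(lam * η)) := by
    have : Real.exp (-(lam * η)) ≤ 1 := Real.exp_le_one_iff.mpr (by nlinarith)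
    linarith
  have hb := h.lintegral_increment_bounds hlam hα ht hη (f := fun y => ENNReal.ofReal (f y))
    (by fun_prop) (C := ENNReal.ofReal C) fun y => ENNReal.ofReal_le_ofReal (hC y)
  have := Measure.isProbabilityMeasure_map (μ := P) hDm.aemeasurable
  set ν := P.map fun ω => aggregateClaims T Y (t + η) ω - aggregateClaims T Y t ω with hν
  have hint : ∀ μ : Measure ℝ, IsFiniteMeasure μ → Integrable f μ := fun μ _ =>
    Integrable.of_bound hf.aestronglyMeasurable C
      (Eventually.of_forall fun y => by rw [Real.norm_eq_abs, abs_of_nonneg (hf0 y)]; exact hC y)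
  have e1 : ∫⁻ ω in {ω | aggregateClaims T Y (t + η) ω - aggregateClaims T Y t ω ≠ 0},
      ENNReal.ofReal (f (aggregateClaims T Y (t + η) ω - aggregateClaims T Y t ω)) ∂P
      = ENNReal.ofReal (∫ y in {0}ᶜ, f y ∂ν) := by
    rw [ofReal_integral_eq_lintegral_ofReal (hint _ inferInstance)
      (Eventually.of_forall hf0), hν,
      setLIntegral_map (measurableSet_singleton (0 : ℝ)).compl (by fun_prop) hDm]
    rfl
  have e2 : ∫⁻ y, ENNReal.ofReal (f y) ∂(expMeasure α)
      = ENNReal.ofReal (∫ y, f y ∂(expMeasure α)) :=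
    (ofReal_integral_eq_lintegral_ofReal (hint _ inferInstance) (Eventually.of_forall hf0)).symm
  have hm0 : 0 ≤ ∫ y, f y ∂(expMeasure α) := integral_nonneg hf0
  have hI0 : 0 ≤ ∫ y in {0}ᶜ, f y ∂ν := integral_nonneg hf0
  simp only [e1, e2] at hb
  rw [← ENNReal.ofReal_pow hp0, ← ENNReal.ofReal_mul hp0, ← ENNReal.ofReal_mul hC0,
    ← ENNReal.ofReal_add (by positivity) (by positivity),
    ← ENNReal.ofReal_add (by positivity) (by positivity),
    ENNReal.ofReal_le_ofReal_iff (by positivity), ENNReal.ofReal_le_ofReal_iff (by positivity)] at hb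
  rw [abs_le]
  constructor <;> linarith [hb.1, hb.2]

theorem increment_eq_zero [IsProbabilityMeasure P] (hlam : 0 < lam) (hα : 0 < α) {t η : ℝ}
    (ht : 0 ≤ t) (hη : 0 ≤ η) :
    (P.map fun ω => aggregateClaims T Y (t + η) ω - aggregateClaims T Y t ω).real {0}
      = Real.exp (-(lam * η)) := by
  have hDm : Measurable fun ω => aggregateClaims T Y (t + η) ω - aggregateClaims T Y t ω :=
    (h.measurable_aggregateClaims _).sub (h.measurable_aggregateClaims _)
  have := Measure.isProbabilityMeasure_map (μ := P) hDm.aemeasurable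
  have hp0 : 0 ≤ 1 - Real.exp (-(lam * η)) := by
    have : Real.exp (-(lam * η)) ≤ 1 := Real.exp_le_one_iff.mpr (by nlinarith)
    linarith
  have h1 : (P.map fun ω => aggregateClaims T Y (t + η) ω - aggregateClaims T Y t ω).real {0}ᶜ
      = 1 - Real.exp (-(lam * η)) := by
    rw [measureReal_def, Measure.map_apply hDm (measurableSet_singleton (0 : ℝ)).compl]
    have h2 := measure_congr (h.ne_zero_ae_eq_iUnion hα ht hη)
    rw [measure_iUnion (h.pairwise_disjoint_nextArrival t η)
      (fun n => h.measurableSet_nextArrival n t η), h.tsum_measure_nextArrival hlam ht hη] at h2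
    have h3 : (fun ω => aggregateClaims T Y (t + η) ω - aggregateClaims T Y t ω) ⁻¹' {0}ᶜ
      = {ω | aggregateClaims T Y (t + η) ω - aggregateClaims T Y t ω ≠ 0} := rfl
    rw [h3, h2, ENNReal.toReal_ofReal hp0]
  rw [probReal_compl_eq_one_sub (measurableSet_singleton _)] at h1
  linarith

end

end IsExpClaimProcess

/-! ### Paths of the controlled surplus -/

/-- A path `X` of the surplus controlled by the rate `u`, when the aggregate claims are `S`. -/
structure IsSurplusPath (g S : ℝ → ℝ) (u₀ x : ℝ) (u X : ℝ → ℝ) : Prop where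
  measurable_rate : Measurable u
  rate_nonneg : ∀ t, 0 ≤ t → 0 ≤ u t
  rate_le : ∀ t, 0 ≤ t → u t ≤ u₀
  claims_zero : S 0 = 0
  claims_mono : MonotoneOn S (Ici 0)
  dynamics : ∀ t : ℝ, 0 ≤ t → ENNReal.ofReal t ≤ ruinTime X →
    IntervalIntegrable (fun s => g (X s)) volume 0 t ∧
    X t = x + (∫ s in (0 : ℝ)..t, g (X s)) - S t - ∫ s in (0 : ℝ)..t, u s
  stopped : ∀ t : ℝ, 0 ≤ t → ruinTime X ≤ ENNReal.ofReal t → X t = X (ruinTime X).toReal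

namespace IsSurplusPath

variable {g S u X : ℝ → ℝ} {u₀ x : ℝ}

theorem intervalIntegrable_rate (h : IsSurplusPath g S u₀ x u X) {s t : ℝ} (hs : 0 ≤ s)
    (hst : s ≤ t) : IntervalIntegrable u volume s t := by
  rw [intervalIntegrable_iff_integrableOn_Ioc_of_le hst]
  refine Measure.integrableOn_of_bounded (M := u₀) (by simp)
    h.measurable_rate.aestronglyMeasurable ?_
  filter_upwards [ae_restrict_mem measurableSet_Ioc] with r hr
  have hr0 : 0 ≤ r := hs.trans hr.1.le
  rw [Real.norm_eq_abs, abs_of_nonneg (h.rate_nonneg r hr0)]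
  exact h.rate_le r hr0

theorem integral_rate_nonneg (h : IsSurplusPath g S u₀ x u X) {s t : ℝ} (hs : 0 ≤ s)
    (hst : s ≤ t) : 0 ≤ ∫ r in s..t, u r :=
  intervalIntegral.integral_nonneg hst fun r hr => h.rate_nonneg r (hs.trans hr.1)

theorem integral_rate_le (h : IsSurplusPath g S u₀ x u X) {s t : ℝ} (hs : 0 ≤ s)
    (hst : s ≤ t) : ∫ r in s..t, u r ≤ u₀ * (t - s) := by
  have := intervalIntegral.integral_mono_on hst (h.intervalIntegrable_rate hs hst)
    (intervalIntegrable_const (c := u₀)) fun r hr => h.rate_le r (hs.trans hr.1)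
  simpa [mul_comm] using this

/-- A path stopped at a nonnegative value would never be negative, which would make the ruin time
infinite. Hence the value at a finite ruin time is negative, and ruin can be read off from the sign
of the surplus at a single time. -/
theorem lt_ruinTime_iff (h : IsSurplusPath g S u₀ x u X) {t : ℝ} (ht : 0 ≤ t) :
    ENNReal.ofReal t < ruinTime X ↔ 0 ≤ X t := by
  constructor
  · intro hlt
    by_contra! hneg
    exact absurd hlt (not_lt.mpr (sInf_le ⟨t, ⟨ht, hneg⟩, rfl⟩))
  · intro hX
    by_contra! hle
    rw [h.stopped t ht hle] at hX
    have : ruinTime X = ⊤ := by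
      rw [ruinTime, sInf_eq_top]
      rintro _ ⟨s, ⟨hs, hs'⟩, rfl⟩
      have h2 : ruinTime X ≤ ENNReal.ofReal s := sInf_le ⟨s, ⟨hs, hs'⟩, rfl⟩
      rw [h.stopped s hs h2] at hs'
      exact absurd hX (not_le.mpr hs')
    rw [this] at hle
    exact absurd hle (by simp)

theorem nonneg_of_lt (h : IsSurplusPath g S u₀ x u X) {s t : ℝ} (hs : 0 ≤ s) (hst : s < t)
    (ht : ENNReal.ofReal t ≤ ruinTime X) : 0 ≤ X s := by
  rw [← h.lt_ruinTime_iff hs]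
  exact ((ENNReal.ofReal_lt_ofReal_iff (hs.trans_lt hst)).mpr hst).trans_le ht

theorem neg_of_neg (h : IsSurplusPath g S u₀ x u X) {s t : ℝ} (hs : 0 ≤ s) (hst : s ≤ t)
    (hX : X s < 0) : X t < 0 := by
  by_contra! ht
  rw [← h.lt_ruinTime_iff (hs.trans hst)] at ht
  have := (ENNReal.ofReal_le_ofReal hst).trans_lt ht
  rw [h.lt_ruinTime_iff hs] at this
  linarith

theorem intervalIntegrable_drift (h : IsSurplusPath g S u₀ x u X) {s t : ℝ} (hs : 0 ≤ s)
    (hst : s ≤ t) (ht : ENNReal.ofReal t ≤ ruinTime X) :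
    IntervalIntegrable (fun r => g (X r)) volume s t :=
  (h.dynamics s hs ((ENNReal.ofReal_le_ofReal hst).trans ht)).1.symm.trans
    (h.dynamics t (hs.trans hst) ht).1

theorem sub_eq (h : IsSurplusPath g S u₀ x u X) {s t : ℝ} (hs : 0 ≤ s)
    (hst : s ≤ t) (ht : ENNReal.ofReal t ≤ ruinTime X) :
    X t = X s - (S t - S s) + ((∫ r in s..t, g (X r)) - ∫ r in s..t, u r) := by
  have h1 := h.dynamics s hs ((ENNReal.ofReal_le_ofReal hst).trans ht)
  have h2 := h.dynamics t (hs.trans hst) ht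
  rw [h1.2, h2.2, ← intervalIntegral.integral_add_adjacent_intervals h1.1
    (h.intervalIntegrable_drift hs hst ht),
    ← intervalIntegral.integral_add_adjacent_intervals (h.intervalIntegrable_rate le_rfl hs)
    (h.intervalIntegrable_rate hs hst)]
  ring

theorem integral_rate_lt (h : IsSurplusPath g S u₀ x u X) (hg : ∀ y, 0 ≤ y → u₀ < g y) {s t : ℝ}
    (hs : 0 ≤ s) (hst : s < t) (ht : ENNReal.ofReal t ≤ ruinTime X) :
    ∫ r in s..t, u r < ∫ r in s..t, g (X r) := by
  have h1 := h.intervalIntegrable_drift hs hst.le ht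
  have h2 := h.intervalIntegrable_rate hs hst.le
  rw [← sub_pos, ← intervalIntegral.integral_sub h1 h2]
  refine intervalIntegral.intervalIntegral_pos_of_pos_on (h1.sub h2) (fun r hr => ?_) hst
  have hr0 : 0 ≤ r := hs.trans hr.1.le
  have := hg _ (h.nonneg_of_lt hr0 hr.2 ht)
  linarith [h.rate_le r hr0]

theorem sub_le (h : IsSurplusPath g S u₀ x u X) (hg : ∀ y, 0 ≤ y → u₀ < g y) {s t : ℝ}
    (hs : 0 ≤ s) (hst : s ≤ t) (ht : ENNReal.ofReal t ≤ ruinTime X) :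
    X s - (S t - S s) ≤ X t := by
  rcases hst.eq_or_lt with rfl | hst
  · simp
  · linarith [h.sub_eq hs hst.le ht, h.integral_rate_lt hg hs hst ht]

/-- Ruin is only caused by claims: it does not occur as long as the surplus can pay for the claims
without further income. -/
theorem le_of_sub_nonneg (h : IsSurplusPath g S u₀ x u X) (hg : ∀ y, 0 ≤ y → u₀ < g y) {s t : ℝ}
    (hs : 0 ≤ s) (hst : s ≤ t) (hX : 0 ≤ X s) (hD : 0 ≤ X s - (S t - S s)) :
    X s - (S t - S s) ≤ X t := by
  refine h.sub_le hg hs hst ?_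
  by_contra! hlt
  have hne : ruinTime X ≠ ⊤ := (hlt.trans_le le_top).ne
  set r := (ruinTime X).toReal with hr
  have hr' : ENNReal.ofReal r = ruinTime X := ENNReal.ofReal_toReal hne
  have hr0 : 0 ≤ r := ENNReal.toReal_nonneg
  rw [← h.lt_ruinTime_iff hs, ← hr'] at hX
  have hsr : s < r := by
    by_contra! hle
    exact absurd hX (not_lt.mpr (ENNReal.ofReal_le_ofReal hle))
  rw [← hr'] at hlt
  have hrt : r ≤ t := by
    by_contra! hle
    exact absurd hlt (not_lt.mpr (ENNReal.ofReal_le_ofReal hle.le))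
  -- At the supposed ruin time `r` the surplus would still be nonnegative, contradicting
  -- `lt_ruinTime_iff` there.
  have h1 := h.sub_le hg hs hsr.le hr'.le
  have h2 := h.claims_mono (mem_Ici.mpr hr0) (mem_Ici.mpr (hr0.trans hrt)) hrt
  have h3 : 0 ≤ X r := by linarith
  rw [← h.lt_ruinTime_iff hr0, hr'] at h3
  exact lt_irrefl _ h3

/-- A bound for the surplus up to time `L`, from Grönwall's inequality. -/
noncomputable def surplusBound (g : ℝ → ℝ) (K : ℝ≥0) (x L : ℝ) : ℝ :=
  x + gronwallBound 0 K (g 0 + K * x) L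

theorem le_surplusBound (h : IsSurplusPath g S u₀ x u X) (hx : 0 ≤ x) (hg : ∀ y, 0 ≤ y → 0 < g y)
    {K : ℝ≥0} (hK : LipschitzOnWith K g (Ici 0)) {t L : ℝ} (ht : 0 ≤ t) (htL : t ≤ L)
    (hX : 0 ≤ X t) : X t ≤ surplusBound g K x L := by
  have hτ : ENNReal.ofReal t ≤ ruinTime X := ((h.lt_ruinTime_iff ht).mpr hX).le
  have hnn : ∀ s, 0 ≤ s → s ≤ t → 0 ≤ X s := by
    intro s hs hst
    rcases hst.eq_or_lt with rfl | hst
    · exact hX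
    · exact h.nonneg_of_lt hs hst hτ
  have hint := h.intervalIntegrable_drift le_rfl ht hτ
  let I : ℝ → ℝ := fun s => ∫ r in (0 : ℝ)..s, g (X r)
  have hI : ContinuousOn I (Icc 0 t) := by
    have := intervalIntegral.continuousOn_primitive_interval' hint (left_mem_uIcc)
    rwa [uIcc_of_le ht] at this
  have hXI : ∀ s, 0 ≤ s → s ≤ t → X s ≤ x + I s := by
    intro s hs hst
    rw [(h.dynamics s hs ((ENNReal.ofReal_le_ofReal hst).trans hτ)).2]
    have h1 := h.integral_rate_nonneg le_rfl hs
    have h2 := h.claims_mono (mem_Ici.mpr le_rfl) hs hs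
    rw [h.claims_zero] at h2
    simp only [I]
    linarith
  have hI0 : ∀ s, 0 ≤ s → s ≤ t → 0 ≤ I s := fun s hs hst =>
    intervalIntegral.integral_nonneg hs fun r hr => (hg _ (hnn r hr.1 (hr.2.trans hst))).le
  set a := g 0 + K * x with ha
  have hgX : ∀ s, 0 ≤ s → s ≤ t → g (X s) ≤ a + K * I s := by
    intro s hs hst
    have h1 := hK.dist_le_mul (X s) (hnn s hs hst) 0 (mem_Ici.mpr le_rfl)
    rw [Real.dist_eq, Real.dist_eq, sub_zero, abs_of_nonneg (hnn s hs hst)] at h1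
    have h2 := (le_abs_self _).trans h1
    have h3 := mul_le_mul_of_nonneg_left (hXI s hs hst) K.2
    have h4 : (K : ℝ) * (x + I s) = K * x + K * I s := by ring
    change (K : ℝ) * X s ≤ K * (x + I s) at h3
    linarith
  let p : ℝ → ℝ := fun s => max 0 (min s t)
  have hp : Continuous p := by fun_prop
  have hpm : ∀ s, p s ∈ Icc 0 t := fun s => ⟨le_max_left _ _, max_le ht (min_le_right _ _)⟩
  have hpe : ∀ s ∈ Icc 0 t, p s = s := fun s hs => by
    simp only [p, min_eq_left hs.2, max_eq_right hs.1]
  let F : ℝ → ℝ := fun s => a + K * I (p s)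
  have hF : Continuous F :=
    continuous_const.add (continuous_const.mul (hI.comp_continuous hp hpm))
  let J : ℝ → ℝ := fun s => ∫ r in (0 : ℝ)..s, F r
  have hJ : ∀ s, HasDerivAt J (F s) s := fun s => by
    exact (hF.integral_hasStrictDerivAt 0 s).hasDerivAt
  have hIJ : ∀ s ∈ Icc 0 t, I s ≤ J s := by
    intro s hs
    refine intervalIntegral.integral_mono_on hs.1
      (h.intervalIntegrable_drift le_rfl hs.1 ((ENNReal.ofReal_le_ofReal hs.2).trans hτ))
      (hF.intervalIntegrable _ _) fun r hr => ?_
    have hr' : r ∈ Icc 0 t := ⟨hr.1, hr.2.trans hs.2⟩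
    simp only [F, hpe r hr']
    exact hgX r hr'.1 hr'.2
  have ha0 : 0 ≤ a := add_nonneg (hg 0 le_rfl).le (mul_nonneg K.2 hx)
  have hbound := norm_le_gronwallBound_of_norm_deriv_right_le (f := J) (f' := F) (δ := 0) (K := K)
    (ε := a) (a := 0) (b := t) (fun s _ => (hJ s).continuousAt.continuousWithinAt)
    (fun s _ => (hJ s).hasDerivWithinAt) (by simp [J]) (by
      intro s hs
      have hs' : s ∈ Icc 0 t := ⟨hs.1, hs.2.le⟩
      have h1 : 0 ≤ I s := hI0 s hs'.1 hs'.2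
      have h2 : 0 ≤ J s := h1.trans (hIJ s hs')
      have h3 : 0 ≤ (K : ℝ) * I s := mul_nonneg K.2 h1
      have h4 : (K : ℝ) * I s ≤ K * J s := mul_le_mul_of_nonneg_left (hIJ s hs') K.2
      simp only [F, hpe s hs', Real.norm_eq_abs]
      rw [abs_of_nonneg (by linarith), abs_of_nonneg h2]
      linarith)
  have h1 := hbound t ⟨ht, le_rfl⟩
  have h2 := hIJ t ⟨ht, le_rfl⟩
  have h3 := hXI t ht le_rfl
  have h4 : gronwallBound 0 K a (t - 0) ≤ gronwallBound 0 K a L :=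
    gronwallBound_mono le_rfl ha0 K.2 (by linarith)
  rw [surplusBound]
  linarith [le_abs_self (J t), Real.norm_eq_abs (J t)]

/-- A bound for the drift of the surplus up to time `L`. -/
noncomputable def driftBound (g : ℝ → ℝ) (K : ℝ≥0) (x L : ℝ) : ℝ := g 0 + K * surplusBound g K x L

theorem drift_le (h : IsSurplusPath g S u₀ x u X) (hx : 0 ≤ x) (hg : ∀ y, 0 ≤ y → 0 < g y)
    {K : ℝ≥0} (hK : LipschitzOnWith K g (Ici 0)) {t L : ℝ} (ht : 0 ≤ t) (htL : t ≤ L)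
    (hX : 0 ≤ X t) : g (X t) ≤ driftBound g K x L := by
  have h1 := hK.dist_le_mul (X t) hX 0 (mem_Ici.mpr le_rfl)
  rw [Real.dist_eq, Real.dist_eq, sub_zero, abs_of_nonneg hX] at h1
  have h2 := (le_abs_self _).trans h1
  have h3 := mul_le_mul_of_nonneg_left (h.le_surplusBound hx hg hK ht htL hX) K.2
  change (K : ℝ) * X t ≤ K * _ at h3
  rw [driftBound]
  linarith

theorem le_sub_add (h : IsSurplusPath g S u₀ x u X) {s t c : ℝ} (hs : 0 ≤ s) (hst : s ≤ t)
    (hc : ∀ r, 0 ≤ r → r ≤ t → 0 ≤ X r → g (X r) ≤ c) (hX : 0 ≤ X t) :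
    X t ≤ X s - (S t - S s) + c * (t - s) := by
  have hτ : ENNReal.ofReal t ≤ ruinTime X := ((h.lt_ruinTime_iff (hs.trans hst)).mpr hX).le
  have h1 := h.sub_eq hs hst hτ
  have h2 := h.integral_rate_nonneg hs hst
  have h3 : ∫ r in s..t, g (X r) ≤ ∫ _ in s..t, c := by
    refine intervalIntegral.integral_mono_on_of_le_Ioo hst (h.intervalIntegrable_drift hs hst hτ)
      intervalIntegrable_const fun r hr => ?_
    exact hc r (hs.trans hr.1.le) hr.2.le (h.nonneg_of_lt (hs.trans hr.1.le) hr.2 hτ)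
  rw [intervalIntegral.integral_const, smul_eq_mul] at h3
  linarith

/-- Between claims the value of the surplus plus the dividends paid grows as prescribed by the
Hamilton-Jacobi-Bellman equation, up to the loss from paying dividends at a wrong rate. -/
theorem exists_value_increment {lam α δ d M c η t : ℝ} {K : ℝ≥0} {w : ℝ → ℝ}
    (h : IsSurplusPath g S u₀ x u X) (hw : IsClassicalSolution g lam α δ u₀ d M w)
    (hlam : 0 ≤ lam) (hδ : 0 ≤ δ) (hM : 0 ≤ M) (hu₀ : 0 ≤ u₀)
    (hg : ∀ y, 0 ≤ y → u₀ < g y) (hK : LipschitzOnWith K g (Ici 0)) (ht : 0 ≤ t) (hη : 0 < η)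
    (hc : ∀ r, 0 ≤ r → r ≤ t + η → 0 ≤ X r → g (X r) ≤ c) (hX : 0 ≤ X t)
    (hS : S (t + η) - S t = 0) :
    ∃ ξ, X t < ξ ∧ ξ < X (t + η) ∧ X (t + η) ≤ X t + c * η ∧
      |w (X (t + η)) + (∫ s in t..t + η, u s) - (w (X t)
          + ((lam + δ) * w (X t) - lam * expConv α w (X t)) * η
          + ((1 - deriv w ξ) * (∫ s in t..t + η, u s) - u₀ * max 0 (1 - deriv w ξ) * η))|
        ≤ (M * K * c + ((lam + δ) + lam) * M * c) * η ^ 2 := by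
  have htη : t ≤ t + η := by linarith
  have hX' : X t ≤ X (t + η) := by
    have := h.le_of_sub_nonneg hg ht htη hX (by rwa [hS, sub_zero])
    rwa [hS, sub_zero] at this
  have h0' : 0 ≤ X (t + η) := hX.trans hX'
  have hτ : ENNReal.ofReal (t + η) ≤ ruinTime X :=
    ((h.lt_ruinTime_iff (by linarith)).mpr h0').le
  have heq := h.sub_eq ht htη hτ
  have hlt := h.integral_rate_lt hg ht (by linarith : t < t + η) hτ
  rw [hS, sub_zero] at heq
  have hXlt : X t < X (t + η) := by linarith
  have hup : X (t + η) ≤ X t + c * η := by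
    have := h.le_sub_add ht htη hc h0'
    rwa [hS, sub_zero, add_sub_cancel_left] at this
  have hc0 : 0 ≤ c := (hu₀.trans (hg _ hX).le).trans (hc t ht htη hX)
  -- The rate is merely measurable, so the chain rule in time is avoided: the mean value theorem in
  -- space gives `w' ξ` times the displacement, and the HJB equation is then used at `ξ`.
  obtain ⟨ξ, ⟨hξ1, hξ2⟩, hξ⟩ := exists_deriv_eq_slope w hXlt
    (hw.continuousOn.mono fun y hy => hX.trans hy.1)
    fun y hy => (hw.differentiableAt y (hX.trans_lt hy.1)).differentiableWithinAt
  have hξ0 : 0 < ξ := hX.trans_lt hξ1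
  rw [eq_div_iff (by linarith)] at hξ
  refine ⟨ξ, hξ1, hξ2, hup, ?_⟩
  set G := ∫ r in t..t + η, g (X r) with hG
  set U := ∫ s in t..t + η, u s with hU
  have hGξ : |G - g ξ * η| ≤ K * (c * η) * η := by
    have h1 : G - g ξ * η = ∫ r in t..t + η, (g (X r) - g ξ) := by
      rw [intervalIntegral.integral_sub (h.intervalIntegrable_drift ht htη hτ)
        intervalIntegrable_const, intervalIntegral.integral_const, smul_eq_mul]
      ring
    have h2 := intervalIntegral.norm_integral_le_of_norm_le_const (a := t) (b := t + η)
      (f := fun r => g (X r) - g ξ) (C := K * (c * η)) ?_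
    · rw [h1, ← Real.norm_eq_abs]
      rwa [add_sub_cancel_left, abs_of_pos hη] at h2
    · intro r hr
      rw [uIoc_of_le htη] at hr
      have hr0 : 0 ≤ r := ht.trans hr.1.le
      have hm1 := h.claims_mono (mem_Ici.mpr ht) (mem_Ici.mpr hr0) hr.1.le
      have hm2 := h.claims_mono (mem_Ici.mpr hr0) (mem_Ici.mpr (by linarith)) hr.2
      have hSr : S r - S t = 0 := by linarith
      have hSr' : S (t + η) - S r = 0 := by linarith
      have e1 := h.le_of_sub_nonneg hg ht hr.1.le hX (by rwa [hSr, sub_zero])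
      rw [hSr, sub_zero] at e1
      have hXr : 0 ≤ X r := hX.trans e1
      have e2 := h.le_of_sub_nonneg hg hr0 hr.2 hXr (by rwa [hSr', sub_zero])
      rw [hSr', sub_zero] at e2
      have e3 := hK.dist_le_mul (X r) hXr ξ hξ0.le
      rw [Real.dist_eq, Real.dist_eq] at e3
      rw [Real.norm_eq_abs]
      refine e3.trans (mul_le_mul_of_nonneg_left ?_ K.2)
      rw [abs_le]
      constructor <;> linarith
  have hHJB := hw.equation ξ hξ0
  have hl1 := hw.lip (X t) ξ hX hξ1.le
  have hl2 := hw.lip_conv (X t) ξ hX hξ1.le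
  have hd0 := hw.deriv_nonneg ξ hξ0
  have hdM := hw.deriv_le ξ hξ0
  have hξt : M * (ξ - X t) ≤ M * (c * η) := mul_le_mul_of_nonneg_left (by linarith) hM
  have hid : w (X (t + η)) + U - (w (X t) + ((lam + δ) * w (X t) - lam * expConv α w (X t)) * η
      + ((1 - deriv w ξ) * U - u₀ * max 0 (1 - deriv w ξ) * η))
      = deriv w ξ * (G - g ξ * η)
        + ((lam + δ) * (w ξ - w (X t)) - lam * (expConv α w ξ - expConv α w (X t))) * η := by
    have hXX : X (t + η) - X t = G - U := by linarith
    rw [hXX] at hξ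
    linear_combination -hξ + η * hHJB
  rw [hid]
  have b1 : |deriv w ξ * (G - g ξ * η)| ≤ M * (K * (c * η) * η) := by
    rw [abs_mul, abs_of_nonneg hd0]
    exact mul_le_mul hdM hGξ (abs_nonneg _) hM
  have b2 : |((lam + δ) * (w ξ - w (X t)) - lam * (expConv α w ξ - expConv α w (X t))) * η|
      ≤ ((lam + δ) * (M * (c * η)) + lam * (M * (c * η))) * η := by
    rw [abs_mul, abs_of_pos hη]
    refine mul_le_mul_of_nonneg_right ?_ hη.le
    refine (abs_sub _ _).trans (add_le_add ?_ ?_)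
    · rw [abs_mul, abs_of_nonneg (by linarith)]
      exact mul_le_mul_of_nonneg_left (hl1.trans hξt) (by linarith)
    · rw [abs_mul, abs_of_nonneg hlam]
      exact mul_le_mul_of_nonneg_left (hl2.trans hξt) hlam
  refine (abs_add_le _ _).trans ((add_le_add b1 b2).trans (le_of_eq ?_))
  ring

/-- Between claims no rate does better than what the Hamilton-Jacobi-Bellman equation prescribes. -/
theorem value_increment_le {lam α δ d M c η t : ℝ} {K : ℝ≥0} {w : ℝ → ℝ}
    (h : IsSurplusPath g S u₀ x u X) (hw : IsClassicalSolution g lam α δ u₀ d M w)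
    (hlam : 0 ≤ lam) (hδ : 0 ≤ δ) (hM : 0 ≤ M) (hu₀ : 0 ≤ u₀)
    (hg : ∀ y, 0 ≤ y → u₀ < g y) (hK : LipschitzOnWith K g (Ici 0)) (ht : 0 ≤ t) (hη : 0 < η)
    (hc : ∀ r, 0 ≤ r → r ≤ t + η → 0 ≤ X r → g (X r) ≤ c) (hX : 0 ≤ X t)
    (hS : S (t + η) - S t = 0) :
    w (X (t + η)) + (∫ s in t..t + η, u s)
      ≤ w (X t) + ((lam + δ) * w (X t) - lam * expConv α w (X t)) * η
        + (M * K * c + ((lam + δ) + lam) * M * c) * η ^ 2 := by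
  obtain ⟨ξ, -, -, -, hξ⟩ :=
    h.exists_value_increment hw hlam hδ hM hu₀ hg hK ht hη hc hX hS
  have h1 := (abs_le.mp hξ).2
  have hU0 := h.integral_rate_nonneg ht (by linarith : t ≤ t + η)
  have hU1 := h.integral_rate_le ht (by linarith : t ≤ t + η)
  rw [add_sub_cancel_left] at hU1
  have h2 : (1 - deriv w ξ) * (∫ s in t..t + η, u s) ≤ u₀ * max 0 (1 - deriv w ξ) * η := by
    rcases le_total 0 (1 - deriv w ξ) with h3 | h3
    · rw [max_eq_right h3]
      calc _ ≤ (1 - deriv w ξ) * (u₀ * η) := mul_le_mul_of_nonneg_left hU1 h3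
        _ = _ := by ring
    · rw [max_eq_left h3]
      nlinarith
  linarith

/-- Between claims the threshold rate does almost as well as the Hamilton-Jacobi-Bellman equation
prescribes. -/
theorem le_value_increment {lam α δ d M c η t ε ρ : ℝ} {K : ℝ≥0} {w : ℝ → ℝ}
    (h : IsSurplusPath g S u₀ x u X) (hw : IsClassicalSolution g lam α δ u₀ d M w)
    (hlam : 0 ≤ lam) (hδ : 0 ≤ δ) (hM : 0 ≤ M) (hu₀ : 0 ≤ u₀)
    (hg : ∀ y, 0 ≤ y → u₀ < g y) (hK : LipschitzOnWith K g (Ici 0)) (ht : 0 ≤ t) (hη : 0 < η)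
    (hc : ∀ r, 0 ≤ r → r ≤ t + η → 0 ≤ X r → g (X r) ≤ c) (hX : 0 ≤ X t)
    (hS : S (t + η) - S t = 0)
    (hu : ∀ s, 0 ≤ s → ENNReal.ofReal s < ruinTime X → u s = if X s < d then 0 else u₀)
    (hε : 0 ≤ ε) (hρ : ∀ y, |y - d| < ρ → |deriv w y - 1| ≤ ε) (hηρ : c * η < ρ) :
    w (X t) + ((lam + δ) * w (X t) - lam * expConv α w (X t)) * η
        - (M * K * c + ((lam + δ) + lam) * M * c) * η ^ 2 - 2 * ε * u₀ * η
      ≤ w (X (t + η)) + (∫ s in t..t + η, u s) := by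
  obtain ⟨ξ, hξ1, hξ2, hξ3, hξ⟩ :=
    h.exists_value_increment hw hlam hδ hM hu₀ hg hK ht hη hc hX hS
  have htη : t ≤ t + η := by linarith
  have h1 := (abs_le.mp hξ).1
  have hU0 := h.integral_rate_nonneg ht htη
  have hU1 := h.integral_rate_le ht htη
  rw [add_sub_cancel_left] at hU1
  have hξ0 : 0 < ξ := hX.trans_lt hξ1
  have hpath : ∀ r, t ≤ r → r ≤ t + η → u r = (if X r < d then 0 else u₀) ∧ X t ≤ X r ∧
      X r ≤ X (t + η) := by
    intro r hr1 hr2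
    have hr0 : 0 ≤ r := ht.trans hr1
    have hm1 := h.claims_mono (mem_Ici.mpr ht) (mem_Ici.mpr hr0) hr1
    have hm2 := h.claims_mono (mem_Ici.mpr hr0) (mem_Ici.mpr (by linarith)) hr2
    have hSr : S r - S t = 0 := by linarith
    have hSr' : S (t + η) - S r = 0 := by linarith
    have e1 := h.le_of_sub_nonneg hg ht hr1 hX (by rwa [hSr, sub_zero])
    rw [hSr, sub_zero] at e1
    have hXr : 0 ≤ X r := hX.trans e1
    have e2 := h.le_of_sub_nonneg hg hr0 hr2 hXr (by rwa [hSr', sub_zero])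
    rw [hSr', sub_zero] at e2
    exact ⟨hu r hr0 ((h.lt_ruinTime_iff hr0).mpr hXr), e1, e2⟩
  have h2 : -(2 * ε * u₀ * η)
      ≤ (1 - deriv w ξ) * (∫ s in t..t + η, u s) - u₀ * max 0 (1 - deriv w ξ) * η := by
    have hpos : 0 ≤ 2 * ε * u₀ * η := by positivity
    -- Without claims the path increases, so it stays above `d`, stays below `d`, or crosses once.
    -- In the first two cases the rate is optimal for the sign of `1 - w' ξ`.
    rcases le_or_gt d (X t) with hd1 | hd1
    · have hU : ∫ s in t..t + η, u s = u₀ * η := by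
        rw [intervalIntegral.integral_congr (g := fun _ => u₀)]
        · rw [intervalIntegral.integral_const, smul_eq_mul]; ring
        · intro r hr
          rw [uIcc_of_le htη] at hr
          have := hpath r hr.1 hr.2
          simp only [this.1, if_neg (not_lt.mpr (hd1.trans this.2.1))]
      have := hw.deriv_le_one ξ (hd1.trans hξ1.le)
      rw [hU, max_eq_right (by linarith)]
      linarith
    · rcases lt_or_ge (X (t + η)) d with hd2 | hd2
      · have hU : ∫ s in t..t + η, u s = 0 := by
          rw [intervalIntegral.integral_congr (g := fun _ => 0)]
          · simp
          · intro r hr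
            rw [uIcc_of_le htη] at hr
            have := hpath r hr.1 hr.2
            simp only [this.1, if_pos (this.2.2.trans_lt hd2)]
        have := hw.one_le_deriv ξ hξ0 (hξ2.trans hd2).le
        rw [hU, max_eq_left (by linarith)]
        linarith
      -- In a crossing step the path moves by less than `ρ`, so `w' ξ` is within `ε` of 1; the
      -- maximum and the actual dividend term each cost at most `ε u₀ η`.
      · have hdist : |ξ - d| < ρ := by
          rw [abs_lt]
          constructor <;> linarith
        have hder := abs_le.mp (hρ ξ hdist)
        have e1 : u₀ * max 0 (1 - deriv w ξ) * η ≤ u₀ * ε * η := by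
          gcongr
          exact max_le hε (by linarith)
        have e2 : -ε * (u₀ * η) ≤ (1 - deriv w ξ) * (∫ s in t..t + η, u s) := by
          have : -ε * (∫ s in t..t + η, u s) ≤ (1 - deriv w ξ) * (∫ s in t..t + η, u s) :=
            mul_le_mul_of_nonneg_right (by linarith) hU0
          have : ε * (∫ s in t..t + η, u s) ≤ ε * (u₀ * η) := mul_le_mul_of_nonneg_left hU1 hε
          linarith
        linarith
  linarith

end IsSurplusPath

/-! ### The one-step estimate -/

section elementary

theorem abs_exp_neg_sub_le {z : ℝ} (hz : 0 ≤ z) : |Real.exp (-z) - (1 - z)| ≤ z ^ 2 := by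
  have h1 := Real.add_one_le_exp (-z)
  have h2 : Real.exp (-z) ≤ 1 - z + z ^ 2 := by
    have h3 := Real.add_one_le_exp z
    have h4 : Real.exp (-z) * Real.exp z = 1 := by rw [← Real.exp_add]; simp
    have h5 : 0 ≤ 1 - z + z ^ 2 := by nlinarith [sq_nonneg (z - 1)]
    -- From `exp z ≥ 1 + z` and `(1 - z + z²)(1 + z) = 1 + z³`.
    have h6 : 1 ≤ (1 - z + z ^ 2) * Real.exp z := by
      have : (1 - z + z ^ 2) * (z + 1) ≤ (1 - z + z ^ 2) * Real.exp z :=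
        mul_le_mul_of_nonneg_left h3 h5
      nlinarith [pow_nonneg hz 3]
    have h7 := mul_le_mul_of_nonneg_left h6 (Real.exp_pos (-z)).le
    nlinarith [Real.exp_pos z]
  rw [abs_le]
  constructor <;> nlinarith [sq_nonneg z]

theorem one_sub_exp_neg_le (z : ℝ) : 1 - Real.exp (-z) ≤ z := by
  linarith [Real.add_one_le_exp (-z)]

theorem one_sub_exp_neg_nonneg {z : ℝ} (hz : 0 ≤ z) : 0 ≤ 1 - Real.exp (-z) := by
  linarith [Real.exp_le_one_iff.mpr (neg_nonpos.mpr hz)]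

/-- The first-order terms cancel: discounting and the chance of a claim take away `(lam + δ) W h`,
which the growth between claims restores, and the gain `lam Q h` from claims cancels in the same
way. Here `W` is the present value and `Q` the expected value after a claim. -/
theorem discount_expansion {lam δ h W Q M : ℝ} (hlam : 0 ≤ lam) (hδ : 0 ≤ δ) (hh : 0 ≤ h)
    (hW0 : 0 ≤ W) (hWM : W ≤ M) (hQ0 : 0 ≤ Q) (hQM : Q ≤ M) :
    |Real.exp (-(lam * h)) * (Real.exp (-(δ * h)) * (W + ((lam + δ) * W - lam * Q) * h))
      + (1 - Real.exp (-(lam * h))) * (Real.exp (-(δ * h)) * Q) - W|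
      ≤ ((lam + δ) ^ 2 + (lam + δ) * ((lam + δ) + lam) + (δ ^ 2 + (lam + δ) ^ 2)) * M * h ^ 2 := by
  have hM : 0 ≤ M := hW0.trans hWM
  set q := Real.exp (-(lam * h))
  set a := Real.exp (-(δ * h))
  have hqa : q * a = Real.exp (-((lam + δ) * h)) := by
    rw [← Real.exp_add]; ring_nf
  have e1 := abs_exp_neg_sub_le (z := (lam + δ) * h) (by positivity)
  have e2 := abs_exp_neg_sub_le (z := δ * h) (by positivity)
  have e3 : |q * a - 1| ≤ (lam + δ) * h := by
    rw [hqa, abs_sub_comm, abs_of_nonneg (one_sub_exp_neg_nonneg (by positivity))]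
    exact one_sub_exp_neg_le _
  rw [← hqa] at e1
  have e4 : |(lam + δ) * W - lam * Q| ≤ ((lam + δ) + lam) * M := by
    refine (abs_sub _ _).trans ?_
    rw [abs_of_nonneg (by positivity), abs_of_nonneg (by positivity)]
    have e5 := mul_le_mul_of_nonneg_left hWM (add_nonneg hlam hδ)
    have e6 := mul_le_mul_of_nonneg_left hQM hlam
    linarith
  have hid : q * (a * (W + ((lam + δ) * W - lam * Q) * h)) + (1 - q) * (a * Q) - W
      = (q * a - (1 - (lam + δ) * h)) * W + (q * a - 1) * (((lam + δ) * W - lam * Q) * h)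
        + ((a - (1 - δ * h)) - (q * a - (1 - (lam + δ) * h))) * Q := by ring
  rw [hid]
  have b1 : |(q * a - (1 - (lam + δ) * h)) * W| ≤ ((lam + δ) * h) ^ 2 * M := by
    rw [abs_mul, abs_of_nonneg hW0]
    gcongr
  have b2 : |(q * a - 1) * (((lam + δ) * W - lam * Q) * h)|
      ≤ ((lam + δ) * h) * ((((lam + δ) + lam) * M) * h) := by
    rw [abs_mul, abs_mul, abs_of_nonneg hh]
    gcongr
  have b3 : |((a - (1 - δ * h)) - (q * a - (1 - (lam + δ) * h))) * Q|
      ≤ ((δ * h) ^ 2 + ((lam + δ) * h) ^ 2) * M := by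
    rw [abs_mul, abs_of_nonneg hQ0]
    gcongr
    exact (abs_sub _ _).trans (add_le_add e2 e1)
  refine (abs_add_le _ _).trans ((add_le_add ((abs_add_le _ _).trans (add_le_add b1 b2)) b3).trans
    (le_of_eq ?_))
  ring

end elementary

/-! ### Averaging over an independent claim increment -/

section mixture

variable {Ω : Type*} {mΩ : MeasurableSpace Ω} {P : Measure Ω} [IsProbabilityMeasure P]

theorem measurable_integral_sub {μ : Measure ℝ} [SFinite μ] {f : ℝ → ℝ} (hf : Measurable f) :
    Measurable fun x => ∫ y, f (x - y) ∂μ := by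
  have : StronglyMeasurable fun p : ℝ × ℝ => f (p.1 - p.2) :=
    (hf.comp (measurable_fst.sub measurable_snd)).stronglyMeasurable
  exact this.integral_prod_right'.measurable

theorem integral_mem_Icc {μ : Measure ℝ} [IsProbabilityMeasure μ] {f : ℝ → ℝ} (hf : Measurable f)
    {C : ℝ} (hf0 : ∀ y, 0 ≤ f y) (hfC : ∀ y, f y ≤ C) (x : ℝ) :
    ∫ y, f (x - y) ∂μ ∈ Icc 0 C := by
  refine ⟨integral_nonneg fun y => hf0 _, ?_⟩
  have : ∫ y, f (x - y) ∂μ ≤ ∫ _, C ∂μ := by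
    refine integral_mono (Integrable.of_bound
      (hf.comp (measurable_const.sub measurable_id)).aestronglyMeasurable C
      (Eventually.of_forall fun y => ?_)) (integrable_const C) fun y => hfC _
    rw [Real.norm_eq_abs, abs_of_nonneg (hf0 _)]
    exact hfC _
  simpa using this

/-- Expectation of a function of the surplus `ξ` and of an independent increment `D` of the claims,
whose law is known up to errors of second order. -/
theorem integral_increment {ξ D : Ω → ℝ} (hξ : Measurable ξ) (hD : Measurable D)
    (hind : IndepFun ξ D P) {μ : Measure ℝ} [IsProbabilityMeasure μ] {A f : ℝ → ℝ}
    (hA : Measurable A) {CA : ℝ} (hCA : ∀ x, |A x| ≤ CA) (hf : Measurable f) {C q : ℝ}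
    (hf0 : ∀ y, 0 ≤ f y) (hfC : ∀ y, f y ≤ C) (hq0 : 0 ≤ q) (hq1 : q ≤ 1)
    (hq : (P.map D).real {0} = q)
    (hlaw : ∀ f' : ℝ → ℝ, Measurable f' → (∀ y, 0 ≤ f' y) → (∀ y, f' y ≤ C) →
      |∫ y in {0}ᶜ, f' y ∂(P.map D) - (1 - q) * ∫ y, f' y ∂μ| ≤ C * (1 - q) ^ 2) :
    |∫ ω, (if ξ ω < 0 then 0 else if D ω = 0 then A (ξ ω) else f (ξ ω - D ω)) ∂P
      - ∫ ω, (if ξ ω < 0 then 0 else q * A (ξ ω) + (1 - q) * ∫ y, f (ξ ω - y) ∂μ) ∂P|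
      ≤ C * (1 - q) ^ 2 := by
  have hνp := Measure.isProbabilityMeasure_map (μ := P) hD.aemeasurable
  have hξp := Measure.isProbabilityMeasure_map (μ := P) hξ.aemeasurable
  have hC0 : 0 ≤ C := (hf0 0).trans (hfC 0)
  have hCA0 : 0 ≤ CA := (abs_nonneg _).trans (hCA 0)
  set ν := P.map D with hν
  let k : ℝ × ℝ → ℝ := fun p => if p.1 < 0 then 0 else if p.2 = 0 then A p.1 else f (p.1 - p.2)
  have hk : Measurable k := by
    refine Measurable.ite (measurableSet_lt measurable_fst measurable_const) measurable_const ?_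
    refine Measurable.ite (measurableSet_eq_fun measurable_snd measurable_const)
      (hA.comp measurable_fst) (hf.comp (measurable_fst.sub measurable_snd))
  have hkb : ∀ p, ‖k p‖ ≤ max CA C := by
    intro p
    simp only [k, Real.norm_eq_abs]
    split_ifs
    · simpa using le_max_of_le_left hCA0
    · exact le_max_of_le_left (hCA _)
    · rw [abs_of_nonneg (hf0 _)]
      exact le_max_of_le_right (hfC _)
  have hmap := (indepFun_iff_map_prod_eq_prod_map_map hξ.aemeasurable hD.aemeasurable).mp hind
  have hkint : ∀ m : Measure (ℝ × ℝ), IsFiniteMeasure m → Integrable k m := fun m _ =>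
    Integrable.of_bound hk.aestronglyMeasurable _ (Eventually.of_forall hkb)
  have h1 : ∫ ω, k (ξ ω, D ω) ∂P = ∫ ω, (∫ y, k (ξ ω, y) ∂ν) ∂P := by
    rw [← integral_map (φ := fun ω => (ξ ω, D ω)) (hξ.prodMk hD).aemeasurable
      hk.aestronglyMeasurable, hmap, integral_prod _ (hkint _ inferInstance),
      integral_map hξ.aemeasurable]
    exact (hk.stronglyMeasurable.integral_prod_right').aestronglyMeasurable
  change |∫ ω, k (ξ ω, D ω) ∂P - _| ≤ _
  have hm1 : Measurable fun ω => ∫ y, k (ξ ω, y) ∂ν :=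
    (hk.stronglyMeasurable.integral_prod_right' (ν := ν)).measurable.comp hξ
  have hm2 : Measurable fun ω => if ξ ω < 0 then 0 else
      q * A (ξ ω) + (1 - q) * ∫ y, f (ξ ω - y) ∂μ := by
    refine Measurable.ite (measurableSet_lt hξ measurable_const) measurable_const ?_
    exact ((hA.comp hξ).const_mul _).add (((measurable_integral_sub hf).comp hξ).const_mul _)
  have hpt : ∀ ω, ‖(∫ y, k (ξ ω, y) ∂ν) - (if ξ ω < 0 then 0 else
      q * A (ξ ω) + (1 - q) * ∫ y, f (ξ ω - y) ∂μ)‖ ≤ C * (1 - q) ^ 2 := by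
    intro ω
    by_cases hω : ξ ω < 0
    · simp only [k, hω, if_true, integral_zero, sub_zero, norm_zero]
      positivity
    · have h2 : ∫ y, k (ξ ω, y) ∂ν = q * A (ξ ω) + ∫ y in {0}ᶜ, f (ξ ω - y) ∂ν := by
        have hki : Integrable (fun y => k (ξ ω, y)) ν :=
          Integrable.of_bound (hk.comp (measurable_const.prodMk measurable_id)).aestronglyMeasurable
            _ (Eventually.of_forall fun y => hkb _)
        rw [← integral_add_compl (measurableSet_singleton (0 : ℝ)) hki]
        congr 1
        · rw [setIntegral_congr_fun (g := fun _ => A (ξ ω)) (measurableSet_singleton (0 : ℝ))]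
          · rw [setIntegral_const, hq, smul_eq_mul]
          · intro y hy
            simp only [mem_singleton_iff] at hy
            simp [k, hω, hy]
        · refine setIntegral_congr_fun (measurableSet_singleton (0 : ℝ)).compl fun y hy => ?_
          simp only [mem_compl_iff, mem_singleton_iff] at hy
          simp [k, hω, hy]
      rw [h2, if_neg hω, add_sub_add_left_eq_sub, Real.norm_eq_abs]
      exact hlaw (fun y => f (ξ ω - y)) (hf.comp (measurable_const.sub measurable_id))
        (fun y => hf0 _) fun y => hfC _
  have hi1 : Integrable (fun ω => ∫ y, k (ξ ω, y) ∂ν) P := by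
    refine Integrable.of_bound hm1.aestronglyMeasurable (max CA C) (Eventually.of_forall fun ω => ?_)
    have := norm_integral_le_of_norm_le_const (μ := ν) (f := fun y => k (ξ ω, y))
      (Eventually.of_forall fun y => hkb (ξ ω, y))
    simpa using this
  have hi2 : Integrable (fun ω => if ξ ω < 0 then 0 else
      q * A (ξ ω) + (1 - q) * ∫ y, f (ξ ω - y) ∂μ) P := by
    refine Integrable.of_bound hm2.aestronglyMeasurable (CA + C) (Eventually.of_forall fun ω => ?_)
    rw [Real.norm_eq_abs]
    split_ifs
    · simp; positivity
    · have h3 := integral_mem_Icc (μ := μ) hf hf0 hfC (ξ ω)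
      refine (abs_add_le _ _).trans (add_le_add ?_ ?_)
      · rw [abs_mul, abs_of_nonneg hq0]
        calc _ ≤ 1 * CA := mul_le_mul hq1 (hCA _) (abs_nonneg _) zero_le_one
          _ = CA := one_mul _
      · rw [abs_mul, abs_of_nonneg (by linarith), abs_of_nonneg h3.1]
        calc _ ≤ 1 * C := mul_le_mul (by linarith) h3.2 h3.1 zero_le_one
          _ = C := one_mul _
  rw [h1, ← integral_sub hi1 hi2]
  have := norm_integral_le_of_norm_le_const (μ := P) (Eventually.of_forall hpt)
  simpa using this

end mixture

/-! ### Measurability and independence for one time step -/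

section step

variable {Ω : Type*} {mΩ : MeasurableSpace Ω} {P : Measure Ω}
  {ℱ : Filtration ℝ≥0 mΩ} {lam α δ u₀ d M x : ℝ} {T Y : ℕ → Ω → ℝ} {g w : ℝ → ℝ}
  {u X : ℝ → Ω → ℝ}

theorem IsClassicalSolution.measurable (hw : IsClassicalSolution g lam α δ u₀ d M w) :
    Measurable w := hw.monotone.measurable

theorem IsExpClaimProcess.aggregateClaims_zero (h : IsExpClaimProcess P ℱ lam α T Y) (ω : Ω) :
    aggregateClaims T Y 0 ω = 0 := by
  have h1 : claimCount T 0 ω = 0 := claimCount_eq (h.mono ω) (h.arrival_zero ω).le (by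
    rw [← h.arrival_zero ω]
    exact h.arrival_strictMono ω (Nat.lt_succ_self 0))
  simp [aggregateClaims, h1]

/-- The surplus obeys its dynamics, and the aggregate claims are nondecreasing. -/
structure IsGoodPath (T Y : ℕ → Ω → ℝ) (g : ℝ → ℝ) (u₀ x : ℝ) (u X : ℝ → Ω → ℝ) (ω : Ω) : Prop where
  path : IsSurplusPath g (fun t => aggregateClaims T Y t ω) u₀ x (fun t => u t ω) (fun t => X t ω)

theorem IsControlledSurplus.ae_isGoodPath [IsProbabilityMeasure P]
    (hX : IsControlledSurplus P ℱ T Y g x u X) (hu : IsAdmissibleRate ℱ u₀ u)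
    (h : IsExpClaimProcess P ℱ lam α T Y) (hα : 0 < α) :
    ∀ᵐ ω ∂P, IsGoodPath T Y g u₀ x u X ω := by
  filter_upwards [h.ae_tendsto_arrival, h.ae_claim_pos hα, hX.dynamics, hX.stopped]
    with ω h1 h2 h3 h4
  refine ⟨?_⟩
  exact
    { measurable_rate := hu.measurable.comp (measurable_id.prodMk measurable_const)
      rate_nonneg := fun t ht => hu.nonneg t ht ω
      rate_le := fun t ht => hu.le_max t ht ω
      claims_zero := h.aggregateClaims_zero ω
      claims_mono := fun s hs t _ hst =>
        aggregateClaims_mono (h.mono ω) (h.arrival_zero ω) h1 h2 hs hst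
      dynamics := h3
      stopped := h4 }

theorem IsControlledSurplus.measurable (hX : IsControlledSurplus P ℱ T Y g x u X) {t : ℝ}
    (ht : 0 ≤ t) : Measurable (X t) :=
  (hX.adapted ⟨t, ht⟩).mono (ℱ.le _) le_rfl

theorem IsAdmissibleRate.intervalIntegrable (hu : IsAdmissibleRate ℱ u₀ u) (ω : Ω) {s t : ℝ}
    (hs : 0 ≤ s) (ht : 0 ≤ t) : IntervalIntegrable (fun r => u r ω) volume s t := by
  rw [intervalIntegrable_iff]
  have hm : Measurable fun r => u r ω := hu.measurable.comp (measurable_id.prodMk measurable_const)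
  refine Measure.integrableOn_of_bounded (M := u₀) (by simp [uIoc]) hm.aestronglyMeasurable ?_
  filter_upwards [ae_restrict_mem measurableSet_uIoc] with r hr
  have hr0 : 0 ≤ r := (le_min hs ht).trans hr.1.le
  rw [Real.norm_eq_abs, abs_of_nonneg (hu.nonneg r hr0 ω)]
  exact hu.le_max r hr0 ω

theorem IsAdmissibleRate.measurable_integral (hu : IsAdmissibleRate ℱ u₀ u) {s t : ℝ}
    (hs : 0 ≤ s) (ht : 0 ≤ t) : Measurable fun ω => ∫ r in s..t, u r ω := by
  have h1 : ∀ r, 0 ≤ r → Measurable fun ω => ∫ s in (0 : ℝ)..r, u s ω := fun r hr =>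
    (hu.cumulative_adapted ⟨r, hr⟩).mono (ℱ.le _) le_rfl
  have h2 : (fun ω => ∫ r in s..t, u r ω)
      = fun ω => (∫ r in (0 : ℝ)..t, u r ω) - ∫ r in (0 : ℝ)..s, u r ω := by
    ext ω
    rw [intervalIntegral.integral_interval_sub_left (hu.intervalIntegrable ω le_rfl ht)
      (hu.intervalIntegrable ω le_rfl hs)]
  rw [h2]
  exact (h1 t ht).sub (h1 s hs)

theorem IsAdmissibleRate.integral_nonneg (hu : IsAdmissibleRate ℱ u₀ u) (ω : Ω) {s t : ℝ}
    (hs : 0 ≤ s) (hst : s ≤ t) : 0 ≤ ∫ r in s..t, u r ω :=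
  intervalIntegral.integral_nonneg hst fun r hr => hu.nonneg r (hs.trans hr.1) ω

theorem IsAdmissibleRate.integral_le (hu : IsAdmissibleRate ℱ u₀ u) (ω : Ω) {s t : ℝ}
    (hs : 0 ≤ s) (hst : s ≤ t) : ∫ r in s..t, u r ω ≤ u₀ * (t - s) := by
  have := intervalIntegral.integral_mono_on hst (hu.intervalIntegrable ω hs (hs.trans hst))
    (intervalIntegrable_const (c := u₀)) fun r hr => hu.le_max r (hs.trans hr.1) ω
  simpa [mul_comm] using this

/-- The dividends paid between `t` and `t + h`, unless the surplus is ruined by time `t`. -/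
noncomputable def cellDividends (u X : ℝ → Ω → ℝ) (t h : ℝ) (ω : Ω) : ℝ :=
  if X t ω < 0 then 0 else ∫ r in t..t + h, u r ω

theorem measurable_cellDividends (hu : IsAdmissibleRate ℱ u₀ u)
    (hX : IsControlledSurplus P ℱ T Y g x u X) {t h : ℝ} (ht : 0 ≤ t) (hh : 0 ≤ h) :
    Measurable (cellDividends u X t h) :=
  Measurable.ite (measurableSet_lt (hX.measurable ht) measurable_const) measurable_const
    (hu.measurable_integral ht (by linarith))

theorem cellDividends_mem_Icc (hu : IsAdmissibleRate ℱ u₀ u) (hu₀ : 0 ≤ u₀) {t h : ℝ} (ht : 0 ≤ t)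
    (hh : 0 ≤ h) (ω : Ω) : cellDividends u X t h ω ∈ Icc 0 (u₀ * h) := by
  rw [cellDividends]
  split_ifs
  · exact ⟨le_rfl, by positivity⟩
  · have := hu.integral_le ω ht (by linarith : t ≤ t + h)
    rw [add_sub_cancel_left] at this
    exact ⟨hu.integral_nonneg ω ht (by linarith), this⟩

theorem integrable_cellDividends [IsProbabilityMeasure P] (hu : IsAdmissibleRate ℱ u₀ u)
    (hX : IsControlledSurplus P ℱ T Y g x u X) (hu₀ : 0 ≤ u₀) {t h : ℝ} (ht : 0 ≤ t) (hh : 0 ≤ h) :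
    Integrable (cellDividends u X t h) P := by
  refine Integrable.of_bound (measurable_cellDividends hu hX ht hh).aestronglyMeasurable (u₀ * h)
    (Eventually.of_forall fun ω => ?_)
  have := cellDividends_mem_Icc (X := X) hu hu₀ ht hh ω
  rw [Real.norm_eq_abs, abs_of_nonneg this.1]
  exact this.2

theorem IsClassicalSolution.integrable_comp [IsProbabilityMeasure P]
    (hw : IsClassicalSolution g lam α δ u₀ d M w) {ξ : Ω → ℝ} (hξ : Measurable ξ) :
    Integrable (fun ω => w (ξ ω)) P := by
  refine Integrable.of_bound (hw.measurable.comp hξ).aestronglyMeasurable M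
    (Eventually.of_forall fun ω => ?_)
  rw [Real.norm_eq_abs, abs_of_nonneg (hw.nonneg _)]
  exact hw.le _

theorem IsControlledSurplus.indepFun_increment (hX : IsControlledSurplus P ℱ T Y g x u X)
    (h : IsExpClaimProcess P ℱ lam α T Y) {t η : ℝ} (ht : 0 ≤ t) (hη : 0 ≤ η) :
    IndepFun (X t) (fun ω => aggregateClaims T Y (t + η) ω - aggregateClaims T Y t ω) P := by
  have h1 := h.increments_indep ⟨t, ht⟩ ⟨t + η, by linarith⟩
    (show t ≤ t + η by linarith)
  rw [IndepFun_iff_Indep]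
  exact indep_of_indep_of_le_left h1 (hX.adapted ⟨t, ht⟩).comap_le

/-- The convolution of the candidate with the claim size distribution, for all arguments. -/
theorem IsClassicalSolution.integral_eq (hw : IsClassicalSolution g lam α δ u₀ d M w) (hα : 0 < α)
    {y : ℝ} (hy : 0 ≤ y) : ∫ z, w (y - z) ∂(expMeasure α) = expConv α w y :=
  integral_comp_sub_expMeasure hα hw.eq_zero_of_neg hy

/-- The setting of the verification theorem. -/
structure Setting (P : Measure Ω) (ℱ : Filtration ℝ≥0 mΩ) (lam α δ u₀ d M x : ℝ) (K : ℝ≥0)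
    (T Y : ℕ → Ω → ℝ) (g w : ℝ → ℝ) (u X : ℝ → Ω → ℝ) : Prop where
  lam_pos : 0 < lam
  α_pos : 0 < α
  δ_pos : 0 < δ
  u₀_pos : 0 < u₀
  M_nonneg : 0 ≤ M
  x_nonneg : 0 ≤ x
  d_pos : 0 < d
  lt_drift : ∀ y, 0 ≤ y → u₀ < g y
  lipschitz : LipschitzOnWith K g (Ici 0)
  claims : IsExpClaimProcess P ℱ lam α T Y
  solution : IsClassicalSolution g lam α δ u₀ d M w
  rate : IsAdmissibleRate ℱ u₀ u
  surplus : IsControlledSurplus P ℱ T Y g x u X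

namespace Setting

variable {K : ℝ≥0} [IsProbabilityMeasure P]

theorem ae_isGoodPath (s : Setting P ℱ lam α δ u₀ d M x K T Y g w u X) :
    ∀ᵐ ω ∂P, IsGoodPath T Y g u₀ x u X ω :=
  s.surplus.ae_isGoodPath s.rate s.claims s.α_pos

omit [IsProbabilityMeasure P] in
theorem drift_le (s : Setting P ℱ lam α δ u₀ d M x K T Y g w u X) {ω : Ω}
    (hω : IsGoodPath T Y g u₀ x u X ω) {L : ℝ} : ∀ r, 0 ≤ r → r ≤ L → 0 ≤ X r ω →
      g (X r ω) ≤ IsSurplusPath.driftBound g K x L := fun _ hr hrL hXr =>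
  hω.path.drift_le s.x_nonneg (fun y hy => s.u₀_pos.trans (s.lt_drift y hy)) s.lipschitz hr hrL hXr

omit [IsProbabilityMeasure P] in
theorem driftBound_nonneg (s : Setting P ℱ lam α δ u₀ d M x K T Y g w u X) {L : ℝ} (hL : 0 ≤ L) :
    0 ≤ IsSurplusPath.driftBound g K x L := by
  have hg0 := s.u₀_pos.trans (s.lt_drift 0 le_rfl)
  have h1 : 0 ≤ gronwallBound 0 K (g 0 + K * x) L := by
    have := gronwallBound_mono (δ := 0) (K := K) (ε := g 0 + K * x) le_rfl
      (add_nonneg hg0.le (mul_nonneg K.2 s.x_nonneg)) K.2 hL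
    rwa [gronwallBound_x0] at this
  have h2 : 0 ≤ (K : ℝ) * IsSurplusPath.surplusBound g K x L :=
    mul_nonneg K.2 (add_nonneg s.x_nonneg h1)
  rw [IsSurplusPath.driftBound]
  linarith

/-- The law of an increment of the claims, in the form used by `integral_increment`. -/
theorem abs_integral_step_le (s : Setting P ℱ lam α δ u₀ d M x K T Y g w u X) {t h : ℝ}
    (ht : 0 ≤ t) (hh : 0 ≤ h) {A f : ℝ → ℝ} (hA : Measurable A) {CA C : ℝ}
    (hCA : ∀ x, |A x| ≤ CA) (hf : Measurable f) (hf0 : ∀ y, 0 ≤ f y) (hfC : ∀ y, f y ≤ C) :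
    |∫ ω, (if X t ω < 0 then 0 else
        if aggregateClaims T Y (t + h) ω - aggregateClaims T Y t ω = 0 then A (X t ω)
          else f (X t ω - (aggregateClaims T Y (t + h) ω - aggregateClaims T Y t ω))) ∂P
      - ∫ ω, (if X t ω < 0 then 0 else Real.exp (-(lam * h)) * A (X t ω)
          + (1 - Real.exp (-(lam * h))) * ∫ y, f (X t ω - y) ∂(expMeasure α)) ∂P|
      ≤ C * (lam * h) ^ 2 := by
  have := isProbabilityMeasure_expMeasure s.α_pos
  have hlh : 0 ≤ lam * h := mul_nonneg s.lam_pos.le hh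
  have hC : 0 ≤ C := (hf0 0).trans (hfC 0)
  have h1 := integral_increment (P := P) (s.surplus.measurable ht)
    ((s.claims.measurable_aggregateClaims (t + h)).sub (s.claims.measurable_aggregateClaims t))
    (s.surplus.indepFun_increment s.claims ht hh) (μ := expMeasure α) hA hCA hf hf0 hfC
    (Real.exp_pos (-(lam * h))).le (by linarith [one_sub_exp_neg_nonneg hlh])
    (s.claims.increment_eq_zero s.lam_pos s.α_pos ht hh)
    (fun f' hf' h0 hC => s.claims.increment_law s.lam_pos s.α_pos ht hh hf' h0 hC)
  refine h1.trans (mul_le_mul_of_nonneg_left ?_ hC)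
  exact pow_le_pow_left₀ (one_sub_exp_neg_nonneg hlh) (one_sub_exp_neg_le _) 2

end Setting

end step

/-! ### The expected change of value over one time step -/

namespace Setting

variable {Ω : Type*} {mΩ : MeasurableSpace Ω} {P : Measure Ω}
  {ℱ : Filtration ℝ≥0 mΩ} {lam α δ u₀ d M x : ℝ} {T Y : ℕ → Ω → ℝ} {g w : ℝ → ℝ}
  {u X : ℝ → Ω → ℝ} {K : ℝ≥0}

/-- The expectation of the mixed increment, evaluated with the Hamilton-Jacobi-Bellman equation. -/
theorem abs_mixture_sub_le (s : Setting P ℱ lam α δ u₀ d M x K T Y g w u X) {h : ℝ} (y : ℝ)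
    (hh : 0 ≤ h) :
    |Real.exp (-(lam * h)) * (Real.exp (-(δ * h))
          * (w y + ((lam + δ) * w y - lam * ∫ z, w (y - z) ∂(expMeasure α)) * h))
        + (1 - Real.exp (-(lam * h))) * (Real.exp (-(δ * h)) * ∫ z, w (y - z) ∂(expMeasure α))
        - w y|
      ≤ ((lam + δ) ^ 2 + (lam + δ) * ((lam + δ) + lam) + (δ ^ 2 + (lam + δ) ^ 2)) * M * h ^ 2 := by
  have := isProbabilityMeasure_expMeasure s.α_pos
  have hQ := integral_mem_Icc (μ := expMeasure α) s.solution.measurable s.solution.nonneg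
    s.solution.le y
  exact discount_expansion s.lam_pos.le s.δ_pos.le hh (s.solution.nonneg y) (s.solution.le y)
    hQ.1 hQ.2

theorem abs_generator_le (s : Setting P ℱ lam α δ u₀ d M x K T Y g w u X) (y : ℝ) :
    |(lam + δ) * w y - lam * ∫ z, w (y - z) ∂(expMeasure α)| ≤ ((lam + δ) + lam) * M := by
  have := isProbabilityMeasure_expMeasure s.α_pos
  have hQ := integral_mem_Icc (μ := expMeasure α) s.solution.measurable s.solution.nonneg
    s.solution.le y
  have h1 := s.lam_pos.le
  have h2 := s.δ_pos.le
  have h3 := s.solution.nonneg y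
  refine (abs_sub _ _).trans ?_
  rw [abs_of_nonneg (mul_nonneg (by linarith) h3), abs_of_nonneg (mul_nonneg h1 hQ.1)]
  have e5 := mul_le_mul_of_nonneg_left (s.solution.le y) (add_nonneg h1 h2)
  have e6 := mul_le_mul_of_nonneg_left hQ.2 h1
  linarith

theorem measurable_generator (s : Setting P ℱ lam α δ u₀ d M x K T Y g w u X) :
    Measurable fun y => (lam + δ) * w y - lam * ∫ z, w (y - z) ∂(expMeasure α) := by
  have := isProbabilityMeasure_expMeasure s.α_pos
  exact (s.solution.measurable.const_mul _).sub
    ((measurable_integral_sub s.solution.measurable).const_mul _)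

variable [IsProbabilityMeasure P]

/-- Integrability of the mixed increments. -/
theorem integrable_mixed (s : Setting P ℱ lam α δ u₀ d M x K T Y g w u X) {t h : ℝ}
    (ht : 0 ≤ t) {A f : ℝ → ℝ} (hA : Measurable A) {CA C : ℝ}
    (hCA : ∀ x, |A x| ≤ CA) (hf : Measurable f) (hf0 : ∀ y, 0 ≤ f y) (hfC : ∀ y, f y ≤ C) :
    Integrable (fun ω => if X t ω < 0 then 0 else
        if aggregateClaims T Y (t + h) ω - aggregateClaims T Y t ω = 0 then A (X t ω)
          else f (X t ω - (aggregateClaims T Y (t + h) ω - aggregateClaims T Y t ω))) P := by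
  have hξ := s.surplus.measurable ht
  have hD := (s.claims.measurable_aggregateClaims (t + h)).sub
    (s.claims.measurable_aggregateClaims t)
  have hCA0 : 0 ≤ CA := (abs_nonneg _).trans (hCA 0)
  refine Integrable.of_bound (C := max CA C) (Measurable.aestronglyMeasurable ?_)
    (Eventually.of_forall fun ω => ?_)
  · exact Measurable.ite (measurableSet_lt hξ measurable_const) measurable_const
      (Measurable.ite (measurableSet_eq_fun hD measurable_const) (hA.comp hξ)
        (hf.comp (hξ.sub hD)))
  · rw [Real.norm_eq_abs]
    split_ifs
    · simpa using le_max_of_le_left hCA0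
    · exact le_max_of_le_left (hCA _)
    · rw [abs_of_nonneg (hf0 _)]
      exact le_max_of_le_right (hfC _)

theorem integrable_average (s : Setting P ℱ lam α δ u₀ d M x K T Y g w u X) {t h : ℝ}
    (ht : 0 ≤ t) (hh : 0 ≤ h) {A f : ℝ → ℝ} (hA : Measurable A) {CA C : ℝ}
    (hCA : ∀ x, |A x| ≤ CA) (hf : Measurable f) (hf0 : ∀ y, 0 ≤ f y) (hfC : ∀ y, f y ≤ C) :
    Integrable (fun ω => if X t ω < 0 then 0 else Real.exp (-(lam * h)) * A (X t ω)
          + (1 - Real.exp (-(lam * h))) * ∫ y, f (X t ω - y) ∂(expMeasure α)) P := by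
  have := isProbabilityMeasure_expMeasure s.α_pos
  have hξ := s.surplus.measurable ht
  have hCA0 : 0 ≤ CA := (abs_nonneg _).trans (hCA 0)
  have hC0 : 0 ≤ C := (hf0 0).trans (hfC 0)
  have hlh : 0 ≤ lam * h := mul_nonneg s.lam_pos.le hh
  have hq := one_sub_exp_neg_nonneg hlh
  have hq' := Real.exp_pos (-(lam * h))
  refine Integrable.of_bound (C := CA + C) (Measurable.aestronglyMeasurable ?_)
    (Eventually.of_forall fun ω => ?_)
  · exact Measurable.ite (measurableSet_lt hξ measurable_const) measurable_const
      (((hA.comp hξ).const_mul _).add (((measurable_integral_sub hf).comp hξ).const_mul _))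
  · rw [Real.norm_eq_abs]
    split_ifs
    · simp; positivity
    · have h3 := integral_mem_Icc (μ := expMeasure α) hf hf0 hfC (X t ω)
      refine (abs_add_le _ _).trans (add_le_add ?_ ?_)
      · rw [abs_mul, abs_of_pos hq']
        calc _ ≤ 1 * CA := mul_le_mul (by linarith) (hCA _) (abs_nonneg _) zero_le_one
          _ = CA := one_mul _
      · rw [abs_mul, abs_of_nonneg hq, abs_of_nonneg h3.1]
        calc _ ≤ 1 * C := mul_le_mul (by linarith) h3.2 h3.1 zero_le_one
          _ = C := one_mul _

/-- Over a short time the discounted value, together with the dividends paid, does not increase on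
average, up to an error of second order. -/
theorem exists_step_le (s : Setting P ℱ lam α δ u₀ d M x K T Y g w u X) {L : ℝ} (hL : 0 ≤ L) :
    ∃ C, 0 ≤ C ∧ ∀ t h, 0 ≤ t → 0 < h → h ≤ 1 → t + h ≤ L →
      ∫ ω, (Real.exp (-(δ * h)) * w (X (t + h) ω) + cellDividends u X t h ω) ∂P
        ≤ (∫ ω, w (X t ω) ∂P) + C * h ^ 2 := by
  have := isProbabilityMeasure_expMeasure s.α_pos
  set c := IsSurplusPath.driftBound g K x L with hc
  have hc0 : 0 ≤ c := s.driftBound_nonneg hL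
  have hlam := s.lam_pos
  have hδ := s.δ_pos
  have hu₀ := s.u₀_pos
  have hM := s.M_nonneg
  have hw := s.solution
  set B := M * K * c + ((lam + δ) + lam) * M * c with hB
  have hB0 : 0 ≤ B := by positivity
  set E := ((lam + δ) ^ 2 + (lam + δ) * ((lam + δ) + lam) + (δ ^ 2 + (lam + δ) ^ 2)) * M with hE
  have hE0 : 0 ≤ E := by positivity
  -- In order: discount expansion, growth between claims, dividends left undiscounted within the
  -- step, drift in a step with claims, dividends in such a step, and the error in the law of the
  -- increment.
  refine ⟨E + B + δ * u₀ + lam * (M * c) + lam * u₀ + (M + u₀) * lam ^ 2, by positivity, ?_⟩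
  intro t h ht hh hh1 htL
  set a := Real.exp (-(δ * h)) with ha
  have ha0 : 0 < a := Real.exp_pos _
  have ha1 : a ≤ 1 := by
    have := one_sub_exp_neg_nonneg (z := δ * h) (by positivity)
    linarith
  have ha2 : 1 - a ≤ δ * h := one_sub_exp_neg_le _
  set q := Real.exp (-(lam * h)) with hq
  have hq0 : 0 < q := Real.exp_pos _
  have hq1 : 0 ≤ 1 - q := one_sub_exp_neg_nonneg (by positivity)
  have hq2 : 1 - q ≤ lam * h := one_sub_exp_neg_le _
  let R : ℝ → ℝ := fun y => (lam + δ) * w y - lam * ∫ z, w (y - z) ∂(expMeasure α)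
  -- `A` bounds the gain of a step without claims and `f` that of a step with claims. In the latter
  -- the surplus is at most its initial value minus the claims plus `c h`, and at most `u₀ h` is
  -- paid.
  let A : ℝ → ℝ := fun y => a * (w y + R y * h + B * h ^ 2) + δ * h * (u₀ * h)
  let f : ℝ → ℝ := fun z => a * w (z + c * h) + u₀ * h
  have hA : Measurable A :=
    ((((hw.measurable.add (s.measurable_generator.mul_const h)).add_const _).const_mul a).add_const
      _)
  have hf : Measurable f :=
    ((hw.measurable.comp (measurable_id.add_const _)).const_mul a).add_const _
  have hf0 : ∀ y, 0 ≤ f y := fun y => by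
    have := hw.nonneg (y + c * h)
    positivity
  have hfC : ∀ y, f y ≤ M + u₀ := fun y => by
    have h1 := hw.le (y + c * h)
    have h2 := hw.nonneg (y + c * h)
    have h3 : a * w (y + c * h) ≤ 1 * M := mul_le_mul ha1 h1 h2 zero_le_one
    have h4 : u₀ * h ≤ u₀ * 1 := mul_le_mul_of_nonneg_left hh1 hu₀.le
    simp only [f]
    linarith
  have hCA : ∀ y, |A y| ≤ (M + ((lam + δ) + lam) * M * h + B * h ^ 2) + δ * h * (u₀ * h) := by
    intro y
    refine (abs_add_le _ _).trans (add_le_add ?_ (le_of_eq (abs_of_nonneg (by positivity))))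
    rw [abs_mul, abs_of_pos ha0]
    have h1 : |w y + R y * h + B * h ^ 2| ≤ M + ((lam + δ) + lam) * M * h + B * h ^ 2 := by
      refine (abs_add_three _ _ _).trans ?_
      rw [abs_of_nonneg (hw.nonneg y), abs_mul, abs_of_pos hh,
        abs_of_nonneg (by positivity : 0 ≤ B * h ^ 2)]
      have e1 := hw.le y
      have e2 := mul_le_mul_of_nonneg_right (s.abs_generator_le y) hh.le
      linarith
    calc _ ≤ 1 * (M + ((lam + δ) + lam) * M * h + B * h ^ 2) :=
          mul_le_mul ha1 h1 (abs_nonneg _) zero_le_one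
      _ = _ := one_mul _
  have hlaw := s.abs_integral_step_le ht hh.le hA hCA hf hf0 hfC
  have hpath : ∀ᵐ ω ∂P, a * w (X (t + h) ω) + cellDividends u X t h ω
      ≤ (if X t ω < 0 then 0 else
        if aggregateClaims T Y (t + h) ω - aggregateClaims T Y t ω = 0 then A (X t ω)
          else f (X t ω - (aggregateClaims T Y (t + h) ω - aggregateClaims T Y t ω))) := by
    filter_upwards [s.ae_isGoodPath] with ω hω
    have hth : t ≤ t + h := by linarith
    have hcω : ∀ r, 0 ≤ r → r ≤ t + h → 0 ≤ X r ω → g (X r ω) ≤ c := fun r hr hrt hXr =>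
      s.drift_le hω r hr (hrt.trans htL) hXr
    rw [cellDividends]
    split_ifs with h1 h2
    · rw [hw.eq_zero_of_neg _ (hω.path.neg_of_neg ht hth h1)]
      simp
    · have h3 := hω.path.value_increment_le hw hlam.le hδ.le hM hu₀.le s.lt_drift s.lipschitz ht hh
        hcω (not_lt.mp h1) h2
      have h4 := hω.path.integral_rate_nonneg ht hth
      have h5 := hω.path.integral_rate_le ht hth
      rw [add_sub_cancel_left] at h5
      rw [← hw.integral_eq s.α_pos (not_lt.mp h1)] at h3
      have h6 := mul_le_mul_of_nonneg_left h3 ha0.le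
      have h7 : (1 - a) * (∫ r in t..t + h, u r ω) ≤ (δ * h) * (u₀ * h) :=
        mul_le_mul ha2 h5 h4 (by positivity)
      simp only [A, R]
      linarith
    · have h5 := hω.path.integral_rate_le ht hth
      rw [add_sub_cancel_left] at h5
      have h8 : w (X (t + h) ω)
          ≤ w (X t ω - (aggregateClaims T Y (t + h) ω - aggregateClaims T Y t ω) + c * h) := by
        rcases lt_or_ge (X (t + h) ω) 0 with h9 | h9
        · rw [hw.eq_zero_of_neg _ h9]
          exact hw.nonneg _
        · refine hw.monotone ?_
          have := hω.path.le_sub_add ht hth hcω h9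
          rwa [add_sub_cancel_left] at this
      have h9 := mul_le_mul_of_nonneg_left h8 ha0.le
      simp only [f]
      linarith
  have hI1 : Integrable (fun ω => a * w (X (t + h) ω) + cellDividends u X t h ω) P :=
    ((hw.integrable_comp (s.surplus.measurable (by linarith))).const_mul _).add
      (integrable_cellDividends s.rate s.surplus hu₀.le ht hh.le)
  have hle1 := integral_mono_ae hI1 (s.integrable_mixed ht hA hCA hf hf0 hfC) hpath
  have hle2 : ∫ ω, (if X t ω < 0 then 0 else q * A (X t ω)
      + (1 - q) * ∫ y, f (X t ω - y) ∂(expMeasure α)) ∂P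
      ≤ ∫ ω, (w (X t ω) + (E + B + δ * u₀ + lam * (M * c) + lam * u₀) * h ^ 2) ∂P := by
    refine integral_mono (s.integrable_average ht hh.le hA hCA hf hf0 hfC)
      ((hw.integrable_comp (s.surplus.measurable ht)).add (integrable_const _)) fun ω => ?_
    simp only
    split_ifs with h1
    · have := hw.nonneg (X t ω)
      positivity
    · have hX0 := not_lt.mp h1
      set y := X t ω with hy
      have h2 := (abs_le.mp (s.abs_mixture_sub_le y hh.le)).2
      have h3 : ∫ z, f (y - z) ∂(expMeasure α)
          ≤ a * (∫ z, w (y - z) ∂(expMeasure α)) + a * (M * (c * h)) + u₀ * h := by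
        have e1 : ∫ z, f (y - z) ∂(expMeasure α)
            = a * (∫ z, w (y + c * h - z) ∂(expMeasure α)) + u₀ * h := by
          have e2 : ∀ z, f (y - z) = a * w (y + c * h - z) + u₀ * h := fun z => by
            simp only [f]
            congr 3
            ring
          simp only [e2]
          rw [integral_add, integral_const_mul]
          · simp
          · exact (hw.integrable_comp (measurable_const.sub measurable_id)).const_mul _
          · exact integrable_const _
        have e3 := hw.lip_conv y (y + c * h) hX0 (by nlinarith)
        rw [e1, hw.integral_eq s.α_pos hX0, hw.integral_eq s.α_pos (by positivity)]
        rw [add_sub_cancel_left] at e3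
        have e4 := mul_le_mul_of_nonneg_left ((le_abs_self _).trans e3) ha0.le
        linarith
      have h4 := mul_le_mul_of_nonneg_left h3 hq1
      have h5 : q * (a * (B * h ^ 2)) ≤ B * h ^ 2 := by
        have : q * a ≤ 1 := mul_le_one₀ (by linarith) ha0.le ha1
        calc q * (a * (B * h ^ 2)) = q * a * (B * h ^ 2) := by ring
          _ ≤ 1 * (B * h ^ 2) := mul_le_mul_of_nonneg_right this (by positivity)
          _ = _ := one_mul _
      have h6 : q * (δ * h * (u₀ * h)) ≤ δ * u₀ * h ^ 2 := by
        calc _ ≤ 1 * (δ * h * (u₀ * h)) := mul_le_mul_of_nonneg_right (by linarith) (by positivity)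
          _ = _ := by ring
      have h7 : (1 - q) * (a * (M * (c * h))) ≤ lam * (M * c) * h ^ 2 := by
        calc _ ≤ (lam * h) * (1 * (M * (c * h))) := by gcongr
          _ = _ := by ring
      have h8 : (1 - q) * (u₀ * h) ≤ lam * u₀ * h ^ 2 := by
        calc _ ≤ (lam * h) * (u₀ * h) := by gcongr
          _ = _ := by ring
      simp only [A, R]
      linarith
  rw [integral_add (hw.integrable_comp (s.surplus.measurable ht)) (integrable_const _)] at hle2
  simp only [integral_const, probReal_univ, one_smul] at hle2
  have := (abs_le.mp hlaw).2
  linarith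

/-- Over a short time the threshold strategy preserves the discounted value on average, up to an
error that is small compared to the length of the time interval. -/
theorem exists_le_step (s : Setting P ℱ lam α δ u₀ d M x K T Y g w u X) {L : ℝ} (hL : 0 ≤ L)
    (hu : ∀ᵐ ω ∂P, ∀ t : ℝ, 0 ≤ t → ENNReal.ofReal t < ruinTime (fun r => X r ω) →
      u t ω = if X t ω < d then 0 else u₀) :
    ∃ C, 0 ≤ C ∧ ∀ ε, 0 < ε → ∃ η, 0 < η ∧ ∀ t h, 0 ≤ t → 0 < h → h < η → t + h ≤ L →
      (∫ ω, w (X t ω) ∂P) - C * h ^ 2 - ε * h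
        ≤ ∫ ω, (Real.exp (-(δ * h)) * w (X (t + h) ω) + cellDividends u X t h ω) ∂P := by
  have := isProbabilityMeasure_expMeasure s.α_pos
  set c := IsSurplusPath.driftBound g K x L with hc
  have hc0 : 0 ≤ c := s.driftBound_nonneg hL
  have hlam := s.lam_pos
  have hδ := s.δ_pos
  have hu₀ := s.u₀_pos
  have hM := s.M_nonneg
  have hw := s.solution
  set B := M * K * c + ((lam + δ) + lam) * M * c with hB
  have hB0 : 0 ≤ B := by positivity
  set E := ((lam + δ) ^ 2 + (lam + δ) * ((lam + δ) + lam) + (δ ^ 2 + (lam + δ) ^ 2)) * M with hE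
  have hE0 : 0 ≤ E := by positivity
  -- This constant does not depend on `ε`; only the admissible step length does, through the modulus
  -- of continuity of `w'` at `d`.
  refine ⟨E + B + M * lam ^ 2, by positivity, fun ε hε => ?_⟩
  set ε' := ε / (2 * u₀) with hε'
  have hε'0 : 0 < ε' := by positivity
  have hε'' : 2 * ε' * u₀ = ε := by rw [hε']; field_simp
  have hd1 : deriv w d = 1 :=
    le_antisymm (hw.deriv_le_one d le_rfl) (hw.one_le_deriv d s.d_pos le_rfl)
  obtain ⟨ρ, hρ0, hρ⟩ := Metric.continuousAt_iff.mp hw.continuousAt_deriv ε' hε'0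
  simp only [Real.dist_eq, hd1] at hρ
  -- Adding 1 to `c` keeps the quotient meaningful for `c = 0` and still gives `c h < ρ`.
  refine ⟨ρ / (c + 1), by positivity, ?_⟩
  intro t h ht hh hhη htL
  have hcρ : c * h < ρ := by
    rw [lt_div_iff₀ (by linarith)] at hhη
    nlinarith
  set a := Real.exp (-(δ * h)) with ha
  have ha0 : 0 < a := Real.exp_pos _
  have ha1 : a ≤ 1 := by
    have := one_sub_exp_neg_nonneg (z := δ * h) (by positivity)
    linarith
  set q := Real.exp (-(lam * h)) with hq
  have hq0 : 0 < q := Real.exp_pos _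
  have hq1 : 0 ≤ 1 - q := one_sub_exp_neg_nonneg (by positivity)
  let R : ℝ → ℝ := fun y => (lam + δ) * w y - lam * ∫ z, w (y - z) ∂(expMeasure α)
  let A : ℝ → ℝ := fun y => a * (w y + R y * h - (B * h ^ 2 + ε * h))
  -- For the lower bound the drift and the dividends in a step with claims are simply dropped; if
  -- the claims exceed the initial surplus, `w` vanishes at the argument.
  let f : ℝ → ℝ := fun z => a * w z
  have hA : Measurable A :=
    (((hw.measurable.add (s.measurable_generator.mul_const h)).sub_const _).const_mul a)
  have hf : Measurable f := hw.measurable.const_mul a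
  have hf0 : ∀ y, 0 ≤ f y := fun y => by
    have := hw.nonneg y
    positivity
  have hfC : ∀ y, f y ≤ M := fun y => by
    have h3 : a * w y ≤ 1 * M := mul_le_mul ha1 (hw.le y) (hw.nonneg y) zero_le_one
    simpa using h3
  have hCA : ∀ y, |A y| ≤ M + ((lam + δ) + lam) * M * h + (B * h ^ 2 + ε * h) := by
    intro y
    rw [abs_mul, abs_of_pos ha0]
    have h1 : |w y + R y * h - (B * h ^ 2 + ε * h)|
        ≤ M + ((lam + δ) + lam) * M * h + (B * h ^ 2 + ε * h) := by
      refine (abs_sub _ _).trans (add_le_add ((abs_add_le _ _).trans ?_)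
        (le_of_eq (abs_of_nonneg (by positivity))))
      rw [abs_of_nonneg (hw.nonneg y), abs_mul, abs_of_pos hh]
      have e1 := hw.le y
      have e2 := mul_le_mul_of_nonneg_right (s.abs_generator_le y) hh.le
      linarith
    calc _ ≤ 1 * (M + ((lam + δ) + lam) * M * h + (B * h ^ 2 + ε * h)) :=
          mul_le_mul ha1 h1 (abs_nonneg _) zero_le_one
      _ = _ := one_mul _
  have hlaw := s.abs_integral_step_le ht hh.le hA hCA hf hf0 hfC
  have hpath : ∀ᵐ ω ∂P, (if X t ω < 0 then 0 else
        if aggregateClaims T Y (t + h) ω - aggregateClaims T Y t ω = 0 then A (X t ω)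
          else f (X t ω - (aggregateClaims T Y (t + h) ω - aggregateClaims T Y t ω)))
      ≤ a * w (X (t + h) ω) + cellDividends u X t h ω := by
    filter_upwards [s.ae_isGoodPath, hu] with ω hω huω
    have hth : t ≤ t + h := by linarith
    have hcω : ∀ r, 0 ≤ r → r ≤ t + h → 0 ≤ X r ω → g (X r ω) ≤ c := fun r hr hrt hXr =>
      s.drift_le hω r hr (hrt.trans htL) hXr
    have h4 := hω.path.integral_rate_nonneg ht hth
    have h0 : 0 ≤ a * w (X (t + h) ω) := mul_nonneg ha0.le (hw.nonneg _)
    rw [cellDividends]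
    split_ifs with h1 h2
    · linarith
    · have h3 := hω.path.le_value_increment hw hlam.le hδ.le hM hu₀.le s.lt_drift s.lipschitz ht hh
        hcω (not_lt.mp h1) h2 huω hε'0.le (fun y hy => (hρ hy).le) hcρ
      rw [← hw.integral_eq s.α_pos (not_lt.mp h1), hε''] at h3
      have h6 := mul_le_mul_of_nonneg_left h3 ha0.le
      have h7 : a * (∫ r in t..t + h, u r ω) ≤ ∫ r in t..t + h, u r ω :=
        mul_le_of_le_one_left h4 ha1
      simp only [A, R]
      linarith
    · have h8 : f (X t ω - (aggregateClaims T Y (t + h) ω - aggregateClaims T Y t ω))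
          ≤ a * w (X (t + h) ω) := by
        refine mul_le_mul_of_nonneg_left ?_ ha0.le
        rcases lt_or_ge (X t ω - (aggregateClaims T Y (t + h) ω - aggregateClaims T Y t ω)) 0
          with h9 | h9
        · rw [hw.eq_zero_of_neg _ h9]
          exact hw.nonneg _
        · exact hw.monotone (hω.path.le_of_sub_nonneg s.lt_drift ht hth (not_lt.mp h1) h9)
      linarith
  have hI1 : Integrable (fun ω => a * w (X (t + h) ω) + cellDividends u X t h ω) P :=
    ((hw.integrable_comp (s.surplus.measurable (by linarith))).const_mul _).add
      (integrable_cellDividends s.rate s.surplus hu₀.le ht hh.le)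
  have hle1 := integral_mono_ae (s.integrable_mixed ht hA hCA hf hf0 hfC) hI1 hpath
  have hle2 : ∫ ω, (w (X t ω) - ((E + B) * h ^ 2 + ε * h)) ∂P
      ≤ ∫ ω, (if X t ω < 0 then 0 else q * A (X t ω)
      + (1 - q) * ∫ y, f (X t ω - y) ∂(expMeasure α)) ∂P := by
    refine integral_mono ((hw.integrable_comp (s.surplus.measurable ht)).sub (integrable_const _))
      (s.integrable_average ht hh.le hA hCA hf hf0 hfC) fun ω => ?_
    simp only
    split_ifs with h1
    · have := hw.eq_zero_of_neg _ h1
      rw [this]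
      have : 0 ≤ (E + B) * h ^ 2 + ε * h := by positivity
      linarith
    · have hX0 := not_lt.mp h1
      set y := X t ω with hy
      have h2 := (abs_le.mp (s.abs_mixture_sub_le y hh.le)).1
      have h3 : ∫ z, f (y - z) ∂(expMeasure α) = a * (∫ z, w (y - z) ∂(expMeasure α)) :=
        integral_const_mul _ _
      have h5 : q * (a * (B * h ^ 2 + ε * h)) ≤ B * h ^ 2 + ε * h := by
        have : q * a ≤ 1 := mul_le_one₀ (by linarith) ha0.le ha1
        calc q * (a * (B * h ^ 2 + ε * h)) = q * a * (B * h ^ 2 + ε * h) := by ring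
          _ ≤ 1 * (B * h ^ 2 + ε * h) := mul_le_mul_of_nonneg_right this (by positivity)
          _ = _ := one_mul _
      rw [h3]
      simp only [A, R]
      linarith
  rw [integral_sub (hw.integrable_comp (s.surplus.measurable ht)) (integrable_const _)] at hle2
  simp only [integral_const, probReal_univ, one_smul] at hle2
  have := (abs_le.mp hlaw).1
  linarith

end Setting

/-! ### Discounted dividends and their Riemann sums -/

section discounted

/-- The discount factor, set to zero from the time `τ` on. -/
noncomputable def killedDiscount (δ : ℝ) (τ : ℝ≥0∞) (t : ℝ) : ℝ :=
  if ENNReal.ofReal t < τ then Real.exp (-δ * t) else 0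

variable {δ u₀ : ℝ} {τ : ℝ≥0∞} {v : ℝ → ℝ}

theorem killedDiscount_nonneg (t : ℝ) : 0 ≤ killedDiscount δ τ t := by
  rw [killedDiscount]
  split_ifs
  · exact (Real.exp_pos _).le
  · exact le_rfl

theorem killedDiscount_le (t : ℝ) : killedDiscount δ τ t ≤ Real.exp (-δ * t) := by
  rw [killedDiscount]
  split_ifs
  · exact le_rfl
  · exact (Real.exp_pos _).le

theorem killedDiscount_antitone (hδ : 0 ≤ δ) : Antitone (killedDiscount δ τ) := by
  intro s t hst
  by_cases ht : ENNReal.ofReal t < τ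
  · rw [killedDiscount, killedDiscount, if_pos ht,
      if_pos ((ENNReal.ofReal_le_ofReal hst).trans_lt ht)]
    exact Real.exp_le_exp.mpr (by nlinarith)
  · rw [killedDiscount, if_neg ht]
    exact killedDiscount_nonneg s

theorem integrableOn_killedDiscount_mul (hδ : 0 < δ) (hv : Measurable v)
    (hv0 : ∀ t, 0 ≤ t → 0 ≤ v t) (hv1 : ∀ t, 0 ≤ t → v t ≤ u₀) :
    IntegrableOn (fun t => killedDiscount δ τ t * v t) (Ioi 0) := by
  have h1 : IntegrableOn (fun t => u₀ * Real.exp (-δ * t)) (Ioi 0) :=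
    (exp_neg_integrableOn_Ioi 0 hδ).const_mul u₀
  refine Integrable.mono' h1
    ((killedDiscount_antitone hδ.le).measurable.mul hv).aestronglyMeasurable ?_
  filter_upwards [ae_restrict_mem measurableSet_Ioi] with t ht
  have ht0 : 0 ≤ t := le_of_lt ht
  rw [Real.norm_eq_abs, abs_mul, abs_of_nonneg (killedDiscount_nonneg t),
    abs_of_nonneg (hv0 t ht0), mul_comm]
  exact mul_le_mul (hv1 t ht0) (killedDiscount_le t) (killedDiscount_nonneg t)
    ((hv0 t ht0).trans (hv1 t ht0))

theorem integral_killedDiscount_eq :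
    ∫ t in {t : ℝ | 0 ≤ t ∧ ENNReal.ofReal t < τ}, Real.exp (-δ * t) * v t
      = ∫ t in Ioi 0, killedDiscount δ τ t * v t := by
  rw [← integral_Ici_eq_integral_Ioi]
  have hm : MeasurableSet {t : ℝ | ENNReal.ofReal t < τ} :=
    measurableSet_lt ENNReal.measurable_ofReal measurable_const
  have h1 : {t : ℝ | 0 ≤ t ∧ ENNReal.ofReal t < τ} = Ici 0 ∩ {t : ℝ | ENNReal.ofReal t < τ} := rfl
  rw [h1, ← setIntegral_indicator hm]
  refine integral_congr_ae (Eventually.of_forall fun t => ?_)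
  by_cases ht : ENNReal.ofReal t < τ
  · simp [killedDiscount, indicator, ht]
  · simp [killedDiscount, indicator, ht]

/-- The killed discount factor is decreasing, so the errors of freezing it at left endpoints
telescope to at most `u₀ h`. This also covers the cell in which ruin occurs, whose dividends the sum
counts in full; the exponential term is the tail beyond time `N h`. -/
theorem abs_integral_sub_sum_le (hδ : 0 < δ) (hv : Measurable v)
    (hv0 : ∀ t, 0 ≤ t → 0 ≤ v t) (hv1 : ∀ t, 0 ≤ t → v t ≤ u₀) {h : ℝ} (hh : 0 ≤ h) (N : ℕ) :
    |(∫ t in {t : ℝ | 0 ≤ t ∧ ENNReal.ofReal t < τ}, Real.exp (-δ * t) * v t)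
      - ∑ j ∈ Finset.range N, killedDiscount δ τ (j * h) * ∫ t in (j * h)..(j * h + h), v t|
      ≤ u₀ * h + u₀ / δ * Real.exp (-δ * (N * h)) := by
  have hu₀ : 0 ≤ u₀ := (hv0 0 le_rfl).trans (hv1 0 le_rfl)
  set φ := killedDiscount δ τ with hφ
  have hint := integrableOn_killedDiscount_mul (τ := τ) hδ hv hv0 hv1
  have hII : ∀ a b : ℝ, 0 ≤ a → 0 ≤ b → IntervalIntegrable (fun t => φ t * v t) volume a b := by
    intro a b ha hb
    rw [intervalIntegrable_iff]
    exact hint.mono_set fun t ht => (le_min ha hb).trans_lt ht.1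
  have hIv : ∀ a b : ℝ, 0 ≤ a → a ≤ b → IntervalIntegrable v volume a b := by
    intro a b ha hab
    rw [intervalIntegrable_iff_integrableOn_Ioc_of_le hab]
    refine Measure.integrableOn_of_bounded (M := u₀) (by simp) hv.aestronglyMeasurable ?_
    filter_upwards [ae_restrict_mem measurableSet_Ioc] with r hr
    have hr0 : 0 ≤ r := ha.trans hr.1.le
    rw [Real.norm_eq_abs, abs_of_nonneg (hv0 r hr0)]
    exact hv1 r hr0
  have hNh : 0 ≤ (N : ℝ) * h := by positivity
  have hsum : ∀ n : ℕ, |(∫ t in (0 : ℝ)..(n * h), φ t * v t)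
      - ∑ j ∈ Finset.range n, φ (j * h) * ∫ t in (j * h)..(j * h + h), v t|
      ≤ u₀ * h * (φ 0 - φ (n * h)) := by
    intro n
    induction n with
    | zero => simp
    | succ n ih =>
      have hn : 0 ≤ (n : ℝ) * h := by positivity
      have e0 : ((n + 1 : ℕ) : ℝ) * h = n * h + h := by push_cast; ring
      rw [e0, Finset.sum_range_succ, ← intervalIntegral.integral_add_adjacent_intervals
        (hII 0 (n * h) le_rfl hn) (hII (n * h) (n * h + h) hn (by linarith))]
      have e1 : |(∫ t in (n * h : ℝ)..(n * h + h), φ t * v t)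
          - φ (n * h) * ∫ t in (n * h : ℝ)..(n * h + h), v t|
          ≤ u₀ * h * (φ (n * h) - φ (n * h + h)) := by
        rw [← intervalIntegral.integral_const_mul, ← intervalIntegral.integral_sub
          (hII _ _ hn (by linarith)) ((hIv _ _ hn (by linarith)).const_mul _)]
        have := intervalIntegral.norm_integral_le_of_norm_le_const (a := n * h) (b := n * h + h)
          (f := fun t => φ t * v t - φ (n * h) * v t) (C := (φ (n * h) - φ (n * h + h)) * u₀) ?_
        · rw [add_sub_cancel_left, abs_of_nonneg hh, Real.norm_eq_abs] at this
          linarith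
        · intro t ht
          rw [uIoc_of_le (by linarith)] at ht
          have ht0 : 0 ≤ t := hn.trans ht.1.le
          have a1 := killedDiscount_antitone (τ := τ) hδ.le ht.1.le
          have a2 := killedDiscount_antitone (τ := τ) hδ.le ht.2
          rw [← sub_mul, Real.norm_eq_abs, abs_mul, abs_of_nonneg (hv0 t ht0), abs_sub_comm,
            abs_of_nonneg (sub_nonneg.mpr a1)]
          exact mul_le_mul (sub_le_sub_left a2 _) (hv1 t ht0) (hv0 t ht0)
            (sub_nonneg.mpr (a2.trans a1))
      rw [add_sub_add_comm]
      refine (abs_add_le _ _).trans ((add_le_add ih e1).trans (le_of_eq ?_))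
      ring
  have hsplit : ∫ t in Ioi 0, φ t * v t
      = (∫ t in (0 : ℝ)..(N * h), φ t * v t) + ∫ t in Ioi (N * h), φ t * v t := by
    rw [intervalIntegral.integral_of_le hNh, ← setIntegral_union Ioc_disjoint_Ioi_same
      measurableSet_Ioi (hint.mono_set fun t ht => ht.1) (hint.mono_set fun t ht => hNh.trans_lt ht),
      Ioc_union_Ioi_eq_Ioi hNh]
  have htail : |∫ t in Ioi (N * h), φ t * v t| ≤ u₀ / δ * Real.exp (-δ * (N * h)) := by
    have h1 : ∫ t in Ioi (N * h), u₀ * Real.exp (-δ * t) = u₀ / δ * Real.exp (-δ * (N * h)) := by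
      rw [integral_const_mul, integral_exp_mul_Ioi (by linarith)]
      field_simp
    rw [← h1, ← Real.norm_eq_abs]
    refine norm_integral_le_of_norm_le ((exp_neg_integrableOn_Ioi _ hδ).const_mul u₀) ?_
    filter_upwards [ae_restrict_mem measurableSet_Ioi] with t ht
    have ht0 : 0 ≤ t := hNh.trans (le_of_lt ht)
    rw [Real.norm_eq_abs, abs_mul, abs_of_nonneg (killedDiscount_nonneg t),
      abs_of_nonneg (hv0 t ht0), mul_comm]
    exact mul_le_mul (hv1 t ht0) (killedDiscount_le t) (killedDiscount_nonneg t) hu₀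
  rw [integral_killedDiscount_eq, hsplit, add_sub_right_comm]
  refine (abs_add_le _ _).trans (add_le_add ((hsum N).trans ?_) htail)
  have h0 : φ 0 ≤ 1 := by
    have := killedDiscount_le (δ := δ) (τ := τ) 0
    simpa using this
  have h1 : 0 ≤ φ (N * h) := killedDiscount_nonneg _
  calc u₀ * h * (φ 0 - φ (N * h)) ≤ u₀ * h * 1 :=
        mul_le_mul_of_nonneg_left (by linarith) (by positivity)
    _ = _ := mul_one _

end discounted

/-! ### Verification -/

/-- A Riemann sum for the discounted dividends. -/
noncomputable def dividendSum {Ω : Type*} (δ : ℝ) (u X : ℝ → Ω → ℝ) (N : ℕ) (h : ℝ) (ω : Ω) : ℝ :=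
  ∑ j ∈ Finset.range N, Real.exp (-δ * (j * h)) * cellDividends u X (j * h) h ω

namespace Setting

variable {Ω : Type*} {mΩ : MeasurableSpace Ω} {P : Measure Ω}
  {ℱ : Filtration ℝ≥0 mΩ} {lam α δ u₀ d M x : ℝ} {T Y : ℕ → Ω → ℝ} {g w : ℝ → ℝ}
  {u X : ℝ → Ω → ℝ} {K : ℝ≥0} [IsProbabilityMeasure P]

omit [IsProbabilityMeasure P] in
theorem abs_sub_dividendSum_le (s : Setting P ℱ lam α δ u₀ d M x K T Y g w u X) {h : ℝ}
    (hh : 0 ≤ h) (N : ℕ) {ω : Ω} (hω : IsGoodPath T Y g u₀ x u X ω) :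
    |(∫ t in {t : ℝ | 0 ≤ t ∧ ENNReal.ofReal t < ruinTime (fun r => X r ω)},
        Real.exp (-δ * t) * u t ω) - dividendSum δ u X N h ω|
      ≤ u₀ * h + u₀ / δ * Real.exp (-δ * (N * h)) := by
  have h1 := abs_integral_sub_sum_le (τ := ruinTime (fun r => X r ω)) s.δ_pos
    hω.path.measurable_rate hω.path.rate_nonneg hω.path.rate_le hh N
  convert! h1 using 3
  refine Finset.sum_congr rfl fun j _ => ?_
  have h2 := hω.path.lt_ruinTime_iff (t := j * h) (by positivity)
  rw [cellDividends, killedDiscount]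
  by_cases h3 : X (j * h) ω < 0
  · rw [if_pos h3, if_neg (by rw [h2]; exact not_le.mpr h3)]
    simp
  · rw [if_neg h3, if_pos (by rw [h2]; exact not_lt.mp h3)]

theorem integrable_dividendSum (s : Setting P ℱ lam α δ u₀ d M x K T Y g w u X) {h : ℝ}
    (hh : 0 ≤ h) (N : ℕ) : Integrable (dividendSum δ u X N h) P := by
  unfold dividendSum
  exact integrable_finsetSum _ fun j _ =>
    (integrable_cellDividends s.rate s.surplus s.u₀_pos.le (by positivity) hh).const_mul _

theorem integrable_dividends (s : Setting P ℱ lam α δ u₀ d M x K T Y g w u X) :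
    Integrable (fun ω => ∫ t in {t : ℝ | 0 ≤ t ∧ ENNReal.ofReal t < ruinTime (fun r => X r ω)},
      Real.exp (-δ * t) * u t ω) P := by
  have hm : AEStronglyMeasurable (fun ω =>
      ∫ t in {t : ℝ | 0 ≤ t ∧ ENNReal.ofReal t < ruinTime (fun r => X r ω)},
        Real.exp (-δ * t) * u t ω) P := by
    refine aestronglyMeasurable_of_tendsto_ae atTop
      -- Mesh `1 / (n + 1)` and horizon `n + 1`, so both the discretisation error and the tail
      -- vanish.
      (f := fun n : ℕ => dividendSum δ u X ((n + 1) * (n + 1)) (1 / ((n : ℝ) + 1)))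
      (fun n => (s.integrable_dividendSum (by positivity) _).aestronglyMeasurable) ?_
    filter_upwards [s.ae_isGoodPath] with ω hω
    rw [tendsto_iff_dist_tendsto_zero]
    have hlim : Tendsto (fun n : ℕ => u₀ * (1 / ((n : ℝ) + 1))
        + u₀ / δ * Real.exp (-δ * ((n : ℝ) + 1))) atTop (𝓝 (u₀ * 0 + u₀ / δ * 0)) := by
      refine (tendsto_one_div_add_atTop_nhds_zero_nat.const_mul u₀).add (Tendsto.const_mul _ ?_)
      refine Real.tendsto_exp_atBot.comp ?_
      have : Tendsto (fun n : ℕ => (n : ℝ) + 1) atTop atTop :=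
        tendsto_atTop_add_const_right _ _ tendsto_natCast_atTop_atTop
      exact this.const_mul_atTop_of_neg (by linarith [s.δ_pos])
    simp only [mul_zero, add_zero] at hlim
    refine squeeze_zero (fun _ => dist_nonneg) (fun n => ?_) hlim
    rw [dist_comm, Real.dist_eq]
    refine (s.abs_sub_dividendSum_le (by positivity) _ hω).trans (le_of_eq ?_)
    congr 4
    push_cast
    field_simp
  refine Integrable.of_bound hm (u₀ / δ) ?_
  filter_upwards [s.ae_isGoodPath] with ω hω
  -- With no cells the estimate reduces to the bound `u₀ / δ` for the whole integral.
  have h1 := s.abs_sub_dividendSum_le le_rfl 0 hω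
  simpa [dividendSum] using h1

theorem abs_expectedDividends_sub_le (s : Setting P ℱ lam α δ u₀ d M x K T Y g w u X) {h : ℝ}
    (hh : 0 ≤ h) (N : ℕ) :
    |expectedDividends P δ u X - ∫ ω, dividendSum δ u X N h ω ∂P|
      ≤ u₀ * h + u₀ / δ * Real.exp (-δ * (N * h)) := by
  rw [expectedDividends, ← integral_sub s.integrable_dividends (s.integrable_dividendSum hh N)]
  have := norm_integral_le_of_norm_le_const (μ := P) (C := u₀ * h + u₀ / δ * Real.exp (-δ * (N * h)))
    (f := fun ω => (∫ t in {t : ℝ | 0 ≤ t ∧ ENNReal.ofReal t < ruinTime (fun r => X r ω)},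
      Real.exp (-δ * t) * u t ω) - dividendSum δ u X N h ω) (by
    filter_upwards [s.ae_isGoodPath] with ω hω using s.abs_sub_dividendSum_le hh N hω)
  simpa using this

theorem integral_start (s : Setting P ℱ lam α δ u₀ d M x K T Y g w u X) :
    ∫ ω, w (X 0 ω) ∂P = w x := by
  have : ∀ᵐ ω ∂P, w (X 0 ω) = w x := by
    filter_upwards [s.ae_isGoodPath] with ω hω
    have := (hω.path.dynamics 0 le_rfl (by simp)).2
    simp only [intervalIntegral.integral_same, add_zero, hω.path.claims_zero, sub_zero] at this
    rw [this]
  rw [integral_congr_ae this]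
  simp

theorem integral_step_eq (s : Setting P ℱ lam α δ u₀ d M x K T Y g w u X) {t h : ℝ} (ht : 0 ≤ t)
    (hh : 0 ≤ h) :
    ∫ ω, (Real.exp (-(δ * h)) * w (X (t + h) ω) + cellDividends u X t h ω) ∂P
      = Real.exp (-(δ * h)) * (∫ ω, w (X (t + h) ω) ∂P) + ∫ ω, cellDividends u X t h ω ∂P := by
  rw [integral_add ((s.solution.integrable_comp (s.surplus.measurable (by linarith))).const_mul _)
    (integrable_cellDividends s.rate s.surplus s.u₀_pos.le ht hh), integral_const_mul]

theorem integral_dividendSum_succ (s : Setting P ℱ lam α δ u₀ d M x K T Y g w u X) {h : ℝ}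
    (hh : 0 ≤ h) (N : ℕ) :
    ∫ ω, dividendSum δ u X (N + 1) h ω ∂P = (∫ ω, dividendSum δ u X N h ω ∂P)
      + Real.exp (-δ * (N * h)) * ∫ ω, cellDividends u X (N * h) h ω ∂P := by
  rw [← integral_const_mul, ← integral_add (s.integrable_dividendSum hh N)
    ((integrable_cellDividends s.rate s.surplus s.u₀_pos.le (by positivity) hh).const_mul _)]
  simp only [dividendSum, Finset.sum_range_succ]

/-- The one-step inequalities telescope after multiplication by the discount factors; as these are
at most 1, each step adds an error of at most `C`. -/
theorem sum_le (s : Setting P ℱ lam α δ u₀ d M x K T Y g w u X) {L C h : ℝ} (hC : 0 ≤ C)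
    (hh : 0 < h) (hstep : ∀ t, 0 ≤ t → t + h ≤ L →
      ∫ ω, (Real.exp (-(δ * h)) * w (X (t + h) ω) + cellDividends u X t h ω) ∂P
        ≤ (∫ ω, w (X t ω) ∂P) + C) (N : ℕ) (hN : N * h ≤ L) :
    Real.exp (-δ * (N * h)) * (∫ ω, w (X (N * h) ω) ∂P) + ∫ ω, dividendSum δ u X N h ω ∂P
      ≤ w x + N * C := by
  induction N with
  | zero => simp [dividendSum, s.integral_start]
  | succ n ih =>
    have e0 : ((n + 1 : ℕ) : ℝ) * h = n * h + h := by push_cast; ring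
    rw [e0] at hN ⊢
    have hn : 0 ≤ (n : ℝ) * h := by positivity
    have h1 := hstep (n * h) hn hN
    rw [s.integral_step_eq hn hh.le] at h1
    have h2 := ih (by linarith)
    rw [s.integral_dividendSum_succ hh.le]
    have h3 := mul_le_mul_of_nonneg_left h1 (Real.exp_pos (-δ * (n * h))).le
    have h4 : Real.exp (-δ * (n * h + h)) = Real.exp (-δ * (n * h)) * Real.exp (-(δ * h)) := by
      rw [← Real.exp_add]; ring_nf
    have h5 : Real.exp (-δ * (n * h)) * C ≤ C := by
      refine mul_le_of_le_one_left hC (Real.exp_le_one_iff.mpr ?_)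
      nlinarith [s.δ_pos]
    rw [h4]
    push_cast
    linarith

theorem le_sum (s : Setting P ℱ lam α δ u₀ d M x K T Y g w u X) {L C h : ℝ} (hC : 0 ≤ C)
    (hh : 0 < h) (hstep : ∀ t, 0 ≤ t → t + h ≤ L → (∫ ω, w (X t ω) ∂P) - C
      ≤ ∫ ω, (Real.exp (-(δ * h)) * w (X (t + h) ω) + cellDividends u X t h ω) ∂P)
    (N : ℕ) (hN : N * h ≤ L) :
    w x - N * C ≤ Real.exp (-δ * (N * h)) * (∫ ω, w (X (N * h) ω) ∂P)
      + ∫ ω, dividendSum δ u X N h ω ∂P := by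
  induction N with
  | zero => simp [dividendSum, s.integral_start]
  | succ n ih =>
    have e0 : ((n + 1 : ℕ) : ℝ) * h = n * h + h := by push_cast; ring
    rw [e0] at hN ⊢
    have hn : 0 ≤ (n : ℝ) * h := by positivity
    have h1 := hstep (n * h) hn hN
    rw [s.integral_step_eq hn hh.le] at h1
    have h2 := ih (by linarith)
    rw [s.integral_dividendSum_succ hh.le]
    have h3 := mul_le_mul_of_nonneg_left h1 (Real.exp_pos (-δ * (n * h))).le
    have h4 : Real.exp (-δ * (n * h + h)) = Real.exp (-δ * (n * h)) * Real.exp (-(δ * h)) := by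
      rw [← Real.exp_add]; ring_nf
    have h5 : Real.exp (-δ * (n * h)) * C ≤ C := by
      refine mul_le_of_le_one_left hC (Real.exp_le_one_iff.mpr ?_)
      nlinarith [s.δ_pos]
    rw [h4]
    push_cast
    linarith

/-- No admissible rate does better than the solution of the Hamilton-Jacobi-Bellman equation. -/
theorem expectedDividends_le (s : Setting P ℱ lam α δ u₀ d M x K T Y g w u X) :
    expectedDividends P δ u X ≤ w x := by
  have key : ∀ L : ℝ, 0 < L →
      expectedDividends P δ u X ≤ w x + u₀ / δ * Real.exp (-δ * L) := by
    intro L hL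
    obtain ⟨C, hC, hstep⟩ := s.exists_step_le hL.le
    have hlim : Tendsto (fun N : ℕ => w x + C * L ^ 2 * (1 / ((N : ℝ) + 1))
        + (u₀ * L * (1 / ((N : ℝ) + 1)) + u₀ / δ * Real.exp (-δ * L))) atTop
        (𝓝 (w x + C * L ^ 2 * 0 + (u₀ * L * 0 + u₀ / δ * Real.exp (-δ * L)))) := by
      have h0 := tendsto_one_div_add_atTop_nhds_zero_nat (𝕜 := ℝ)
      exact ((h0.const_mul _).const_add _).add ((h0.const_mul _).add_const _)
    simp only [mul_zero, add_zero, zero_add] at hlim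
    refine ge_of_tendsto hlim ?_
    filter_upwards [tendsto_natCast_atTop_atTop.eventually_ge_atTop L] with N hN
    have hN1 : (0 : ℝ) < (N : ℝ) + 1 := by positivity
    -- With `N + 1` steps of this length the accumulated error `(N + 1) C h²` is `C L² / (N + 1)`.
    set h := L / ((N : ℝ) + 1) with hh
    have hh0 : 0 < h := by positivity
    have hh1 : h ≤ 1 := by
      rw [hh, div_le_one hN1]
      linarith
    have hNh : ((N + 1 : ℕ) : ℝ) * h = L := by
      rw [hh]; push_cast; field_simp
    have h1 := s.sum_le (L := L) (C := C * h ^ 2) (by positivity) hh0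
      (fun t ht htL => hstep t h ht hh0 hh1 htL) (N + 1) hNh.le
    have h2 := (abs_le.mp (s.abs_expectedDividends_sub_le hh0.le (N + 1))).2
    have h3 : 0 ≤ Real.exp (-δ * (((N + 1 : ℕ) : ℝ) * h))
        * (∫ ω, w (X (((N + 1 : ℕ) : ℝ) * h) ω) ∂P) :=
      mul_nonneg (Real.exp_pos _).le (integral_nonneg fun ω => s.solution.nonneg _)
    have h4 : ((N + 1 : ℕ) : ℝ) * (C * h ^ 2) = C * L ^ 2 * (1 / ((N : ℝ) + 1)) := by
      rw [hh]; push_cast; field_simp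
    have h5 : u₀ * h = u₀ * L * (1 / ((N : ℝ) + 1)) := by
      rw [hh]; field_simp
    rw [h4] at h1
    rw [hNh, h5] at h2
    linarith
  have hlim : Tendsto (fun L : ℝ => w x + u₀ / δ * Real.exp (-δ * L)) atTop
      (𝓝 (w x + u₀ / δ * 0)) := by
    refine (Tendsto.const_mul _ ?_).const_add _
    exact Real.tendsto_exp_atBot.comp (tendsto_id.const_mul_atTop_of_neg (by linarith [s.δ_pos]))
  simp only [mul_zero, add_zero] at hlim
  refine ge_of_tendsto hlim ?_
  filter_upwards [eventually_gt_atTop 0] with L hL using key L hL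

/-- The threshold strategy attains the solution of the Hamilton-Jacobi-Bellman equation. -/
theorem le_expectedDividends (s : Setting P ℱ lam α δ u₀ d M x K T Y g w u X)
    (hu : ∀ᵐ ω ∂P, ∀ t : ℝ, 0 ≤ t → ENNReal.ofReal t < ruinTime (fun r => X r ω) →
      u t ω = if X t ω < d then 0 else u₀) :
    w x ≤ expectedDividends P δ u X := by
  have key : ∀ L : ℝ, 0 < L → ∀ ε : ℝ, 0 < ε →
      w x - L * ε - (M + u₀ / δ) * Real.exp (-δ * L) ≤ expectedDividends P δ u X := by
    intro L hL ε hε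
    obtain ⟨C, hC, hstep⟩ := s.exists_le_step hL.le hu
    obtain ⟨η, hη, hstep⟩ := hstep ε hε
    have hlim : Tendsto (fun N : ℕ => w x - C * L ^ 2 * (1 / ((N : ℝ) + 1)) - L * ε
        - u₀ * L * (1 / ((N : ℝ) + 1)) - (M + u₀ / δ) * Real.exp (-δ * L)) atTop
        (𝓝 (w x - C * L ^ 2 * 0 - L * ε - u₀ * L * 0 - (M + u₀ / δ) * Real.exp (-δ * L))) := by
      have h0 := tendsto_one_div_add_atTop_nhds_zero_nat (𝕜 := ℝ)
      exact ((((h0.const_mul _).const_sub _).sub_const _).sub (h0.const_mul _)).sub_const _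
    simp only [mul_zero, sub_zero] at hlim
    refine le_of_tendsto hlim ?_
    filter_upwards [tendsto_natCast_atTop_atTop.eventually_ge_atTop (L / η)] with N hN
    have hN1 : (0 : ℝ) < (N : ℝ) + 1 := by positivity
    set h := L / ((N : ℝ) + 1) with hh
    have hh0 : 0 < h := by positivity
    have hh1 : h < η := by
      rw [hh, div_lt_iff₀ hN1]
      rw [div_le_iff₀ hη] at hN
      linarith
    have hNh : ((N + 1 : ℕ) : ℝ) * h = L := by
      rw [hh]; push_cast; field_simp
    have h1 := s.le_sum (L := L) (C := C * h ^ 2 + ε * h) (by positivity) hh0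
      (fun t ht htL => by
        have := hstep t h ht hh0 hh1 htL
        linarith) (N + 1) hNh.le
    have h2 := (abs_le.mp (s.abs_expectedDividends_sub_le hh0.le (N + 1))).1
    rw [hNh] at h1
    have h3 : Real.exp (-δ * L) * (∫ ω, w (X L ω) ∂P) ≤ Real.exp (-δ * L) * M := by
      refine mul_le_mul_of_nonneg_left ?_ (Real.exp_pos _).le
      have := integral_mono (s.solution.integrable_comp (P := P) (s.surplus.measurable hL.le))
        (integrable_const M) fun ω => s.solution.le (X L ω)
      simpa using this
    have h4 : ((N + 1 : ℕ) : ℝ) * (C * h ^ 2 + ε * h) = C * L ^ 2 * (1 / ((N : ℝ) + 1)) + L * ε := by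
      rw [mul_add, ← mul_assoc _ ε h, mul_comm _ ε, mul_assoc, hNh, mul_comm ε]
      congr 1
      rw [hh]; push_cast; field_simp
    have h5 : u₀ * h = u₀ * L * (1 / ((N : ℝ) + 1)) := by
      rw [hh]; field_simp
    rw [h4] at h1
    rw [hNh, h5] at h2
    linarith
  have key2 : ∀ L : ℝ, 0 < L →
      w x - (M + u₀ / δ) * Real.exp (-δ * L) ≤ expectedDividends P δ u X := by
    intro L hL
    refine le_of_forall_pos_le_add fun ε hε => ?_
    -- The losses `ε h` of the single steps add up to `L ε`, hence the rescaling by `L`.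
    have := key L hL (ε / L) (by positivity)
    rw [mul_div_cancel₀ _ hL.ne'] at this
    linarith
  have hlim : Tendsto (fun L : ℝ => w x - (M + u₀ / δ) * Real.exp (-δ * L)) atTop
      (𝓝 (w x - (M + u₀ / δ) * 0)) := by
    refine (Tendsto.const_mul _ ?_).const_sub _
    exact Real.tendsto_exp_atBot.comp (tendsto_id.const_mul_atTop_of_neg (by linarith [s.δ_pos]))
  simp only [mul_zero, sub_zero] at hlim
  refine le_of_tendsto hlim ?_
  filter_upwards [eventually_gt_atTop 0] with L hL using key2 L hL

end Setting

/-! ### The flow of the surplus between claims under the threshold strategy -/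

/-- The rate of the threshold strategy. -/
noncomputable def thresholdRate (u₀ d y : ℝ) : ℝ := if y < d then 0 else u₀

theorem measurable_thresholdRate (u₀ d : ℝ) : Measurable (thresholdRate u₀ d) :=
  Measurable.ite measurableSet_Iio measurable_const measurable_const

/-- `F t z` is the surplus at time `t` under the threshold strategy if there are no claims and the
initial surplus is `z`; negative surplus does not move. -/
structure IsThresholdFlow (g : ℝ → ℝ) (u₀ d : ℝ) (F : ℝ → ℝ → ℝ) : Prop where
  measurable : Measurable fun p : ℝ × ℝ => F p.1 p.2
  of_neg : ∀ t z, z < 0 → F t z = z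
  le : ∀ t z, 0 ≤ t → 0 ≤ z → z ≤ F t z
  intervalIntegrable : ∀ t z, 0 ≤ t → 0 ≤ z →
    IntervalIntegrable (fun s => g (F s z)) volume 0 t
  eq : ∀ t z, 0 ≤ t → 0 ≤ z →
    F t z = z + (∫ s in (0 : ℝ)..t, g (F s z)) - ∫ s in (0 : ℝ)..t, thresholdRate u₀ d (F s z)

section flow

variable {a b : ℝ → ℝ} {d : ℝ}

/-- The time that the surplus needs to move from `d` to `y` with speed `a` below `d` and `b`
above. -/
noncomputable def travelTime (a b : ℝ → ℝ) (d y : ℝ) : ℝ :=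
  (∫ s in d..min y d, (a s)⁻¹) + ∫ s in d..max y d, (b s)⁻¹

theorem travelTime_of_le {y : ℝ} (hy : y ≤ d) : travelTime a b d y = ∫ s in d..y, (a s)⁻¹ := by
  simp [travelTime, min_eq_left hy, max_eq_right hy]

theorem travelTime_of_ge {y : ℝ} (hy : d ≤ y) : travelTime a b d y = ∫ s in d..y, (b s)⁻¹ := by
  simp [travelTime, min_eq_right hy, max_eq_left hy]

theorem hasDerivAt_integral_inv (ha : Continuous a) (ha0 : ∀ y, 0 < a y) (y : ℝ) :
    HasDerivAt (fun y => ∫ s in d..y, (a s)⁻¹) (a y)⁻¹ y :=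
  ((ha.inv₀ fun y => (ha0 y).ne').integral_hasStrictDerivAt d y).hasDerivAt

theorem continuous_travelTime (ha : Continuous a) (ha0 : ∀ y, 0 < a y) (hb : Continuous b)
    (hb0 : ∀ y, 0 < b y) : Continuous (travelTime a b d) := by
  have h1 : Continuous fun y => ∫ s in d..y, (a s)⁻¹ :=
    continuous_iff_continuousAt.mpr fun y => (hasDerivAt_integral_inv ha ha0 y).continuousAt
  have h2 : Continuous fun y => ∫ s in d..y, (b s)⁻¹ :=
    continuous_iff_continuousAt.mpr fun y => (hasDerivAt_integral_inv hb hb0 y).continuousAt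
  exact (h1.comp (continuous_id.min continuous_const)).add
    (h2.comp (continuous_id.max continuous_const))

theorem hasDerivAt_travelTime (ha : Continuous a) (ha0 : ∀ y, 0 < a y) (hb : Continuous b)
    (hb0 : ∀ y, 0 < b y) {y : ℝ} (hy : y ≠ d) :
    HasDerivAt (travelTime a b d) (if y < d then a y else b y)⁻¹ y := by
  rcases lt_or_gt_of_ne hy with h | h
  · rw [if_pos h]
    refine (hasDerivAt_integral_inv (d := d) ha ha0 y).congr_of_eventuallyEq ?_
    filter_upwards [Iio_mem_nhds h] with z hz using travelTime_of_le (le_of_lt hz)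
  · rw [if_neg (not_lt.mpr h.le)]
    refine (hasDerivAt_integral_inv (d := d) hb hb0 y).congr_of_eventuallyEq ?_
    filter_upwards [Ioi_mem_nhds h] with z hz using travelTime_of_ge (le_of_lt hz)

theorem strictMono_integral_inv (ha : Continuous a) (ha0 : ∀ y, 0 < a y) :
    StrictMono fun y => ∫ s in d..y, (a s)⁻¹ :=
  strictMono_of_deriv_pos fun y => by
    rw [(hasDerivAt_integral_inv ha ha0 y).deriv]
    exact inv_pos.mpr (ha0 y)

theorem strictMono_travelTime (ha : Continuous a) (ha0 : ∀ y, 0 < a y) (hb : Continuous b)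
    (hb0 : ∀ y, 0 < b y) : StrictMono (travelTime a b d) := by
  have h1 : StrictMonoOn (travelTime a b d) (Iic d) := fun y hy z hz hyz => by
    rw [travelTime_of_le hy, travelTime_of_le hz]
    exact strictMono_integral_inv ha ha0 hyz
  have h2 : StrictMonoOn (travelTime a b d) (Ici d) := fun y hy z hz hyz => by
    rw [travelTime_of_ge hy, travelTime_of_ge hz]
    exact strictMono_integral_inv hb hb0 hyz
  exact StrictMonoOn.Iic_union_Ici h1 h2

/-- Linear growth of the speed excludes explosion: reaching `y` takes at least logarithmically long.
On the negative axis the speed is bounded, so travel times tend to `-∞` there. -/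
theorem surjective_travelTime (ha : Continuous a) (ha0 : ∀ y, 0 < a y) (hb : Continuous b)
    (hb0 : ∀ y, 0 < b y) {A : ℝ} (hA0 : 0 < A) (hd : 0 < d) (hA : ∀ y ≤ 0, a y ≤ A)
    (hB : ∀ y, d ≤ y → b y ≤ A * (1 + y)) : Function.Surjective (travelTime a b d) := by
  refine (continuous_travelTime ha ha0 hb hb0).surjective ?_ ?_
  · have h1 : ∀ y, d ≤ y →
        A⁻¹ * Real.log (1 + y) - A⁻¹ * Real.log (1 + d) ≤ travelTime a b d y := by
      intro y hy
      have hder : ∀ z, 0 < z → HasDerivAt (fun z => A⁻¹ * Real.log (1 + z)) (A⁻¹ * (1 / (1 + z))) z :=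
        fun z hz => by
          have := ((hasDerivAt_id z).const_add 1).log (by simp only [id]; linarith)
          exact this.const_mul _
      have hc : ContinuousOn (fun z => A⁻¹ * (1 / (1 + z))) (uIcc d y) := by
        rw [uIcc_of_le hy]
        refine continuousOn_const.mul (continuousOn_const.div (by fun_prop) fun z hz => ?_)
        have := hz.1
        linarith
      have h2 := intervalIntegral.integral_eq_sub_of_hasDerivAt (a := d) (b := y)
        (f := fun z => A⁻¹ * Real.log (1 + z)) (f' := fun z => A⁻¹ * (1 / (1 + z)))
        (fun z hz => by
          rw [uIcc_of_le hy] at hz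
          exact hder z (hd.trans_le hz.1)) hc.intervalIntegrable
      rw [travelTime_of_ge hy, ← h2]
      refine intervalIntegral.integral_mono_on hy hc.intervalIntegrable
        ((hb.inv₀ fun y => (hb0 y).ne').intervalIntegrable _ _) fun z hz => ?_
      rw [one_div, ← mul_inv]
      exact inv_anti₀ (hb0 z) (hB z hz.1)
    refine tendsto_atTop_mono' atTop (f₁ := fun y => A⁻¹ * Real.log (1 + y) - A⁻¹ * Real.log (1 + d))
      ((eventually_ge_atTop d).mono h1) ?_
    refine tendsto_atTop_add_const_right _ _ (Tendsto.const_mul_atTop (by positivity) ?_)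
    exact Real.tendsto_log_atTop.comp (tendsto_atTop_add_const_left _ _ tendsto_id)
  · have h1 : ∀ y, y ≤ 0 → travelTime a b d y ≤ A⁻¹ * y := by
      intro y hy
      have e0 : travelTime a b d 0 ≤ 0 := by
        have := (strictMono_travelTime ha ha0 hb hb0 (d := d)) hd
        have e : travelTime a b d d = 0 := by simp [travelTime]
        linarith
      have e1 : travelTime a b d 0 - travelTime a b d y = ∫ s in y..0, (a s)⁻¹ := by
        rw [travelTime_of_le hd.le, travelTime_of_le (hy.trans hd.le),
          intervalIntegral.integral_interval_sub_left]
        · exact (ha.inv₀ fun y => (ha0 y).ne').intervalIntegrable _ _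
        · exact (ha.inv₀ fun y => (ha0 y).ne').intervalIntegrable _ _
      have e2 : ∫ _ in y..0, A⁻¹ ≤ ∫ s in y..0, (a s)⁻¹ :=
        intervalIntegral.integral_mono_on hy intervalIntegrable_const
          ((ha.inv₀ fun y => (ha0 y).ne').intervalIntegrable _ _)
          fun z hz => inv_anti₀ (ha0 z) (hA z hz.2)
      rw [intervalIntegral.integral_const, smul_eq_mul] at e2
      linarith
    refine tendsto_atBot_mono' atBot (f₁ := fun y => A⁻¹ * y) ((eventually_le_atBot 0).mono h1) ?_
    exact tendsto_id.const_mul_atBot (by positivity)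

end flow

/-- The closed-loop drift is discontinuous at `d`, so the equation is integrated by separation of
variables: with `e` the travel time from `d`, the flow is translation by `t` in the coordinate `e`.
-/
theorem exists_isThresholdFlow {g : ℝ → ℝ} {u₀ d : ℝ} {K : ℝ≥0} (hK : LipschitzOnWith K g (Ici 0))
    (hu₀ : 0 < u₀) (hd : 0 < d) (hg : ∀ x, 0 ≤ x → u₀ < g x) :
    ∃ F, IsThresholdFlow g u₀ d F := by
  let a : ℝ → ℝ := fun y => g (max y 0)
  let b : ℝ → ℝ := fun y => g (max y 0) - u₀
  have ha : Continuous a := hK.continuousOn.comp_continuous (by fun_prop) fun y =>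
    mem_Ici.mpr (le_max_right _ _)
  have hb : Continuous b := ha.sub continuous_const
  have ha0 : ∀ y, 0 < a y := fun y => hu₀.trans (hg _ (le_max_right _ _))
  have hb0 : ∀ y, 0 < b y := fun y => sub_pos.mpr (hg _ (le_max_right _ _))
  have hg0 : 0 < g 0 := hu₀.trans (hg 0 le_rfl)
  have hsurj : Function.Surjective (travelTime a b d) := by
    refine surjective_travelTime ha ha0 hb hb0 (A := g 0 + K) (by have := K.2; positivity) hd
      (fun y hy => ?_) fun y hy => ?_
    · simp only [a, max_eq_right hy]
      linarith [K.2]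
    · have hy0 : 0 ≤ y := hd.le.trans hy
      have h1 := hK.dist_le_mul y hy0 0 (mem_Ici.mpr le_rfl)
      rw [Real.dist_eq, Real.dist_eq, sub_zero, abs_of_nonneg hy0] at h1
      have h2 := (le_abs_self _).trans h1
      simp only [b, max_eq_left hy0]
      nlinarith [K.2, mul_nonneg hg0.le hy0]
  have hmono := strictMono_travelTime ha ha0 hb hb0 (d := d)
  let e : ℝ ≃o ℝ := hmono.orderIsoOfSurjective _ hsurj
  have he : ∀ y, e y = travelTime a b d y := fun y => rfl
  have hec : Continuous e := e.continuous
  have hsc : Continuous e.symm := e.symm.continuous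
  let F : ℝ → ℝ → ℝ := fun t z => if z < 0 then z else e.symm (e z + t)
  have hF : ∀ t z, 0 ≤ z → F t z = e.symm (e z + t) := fun t z hz => if_neg (not_lt.mpr hz)
  have hle : ∀ t z, 0 ≤ t → 0 ≤ z → z ≤ F t z := by
    intro t z ht hz
    rw [hF t z hz]
    conv_lhs => rw [← e.symm_apply_apply z]
    exact e.symm.monotone (by linarith)
  have hgF : ∀ t z, 0 ≤ t → 0 ≤ z → g (F t z) = a (e.symm (e z + t)) := by
    intro t z ht hz
    have := hle t z ht hz
    rw [hF t z hz] at this ⊢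
    simp only [a, max_eq_left (hz.trans this)]
  have hca : ∀ z, Continuous fun s => a (e.symm (e z + s)) := fun z =>
    ha.comp (hsc.comp (continuous_const.add continuous_id))
  have hint : ∀ t z, 0 ≤ t → 0 ≤ z → IntervalIntegrable (fun s => g (F s z)) volume 0 t := by
    intro t z ht hz
    refine ((hca z).intervalIntegrable 0 t).congr fun s hs => ?_
    rw [uIoc_of_le ht] at hs
    exact (hgF s z hs.1.le hz).symm
  have hrate : ∀ t z, 0 ≤ z →
      IntervalIntegrable (fun s => thresholdRate u₀ d (e.symm (e z + s))) volume 0 t := by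
    intro t z hz
    rw [intervalIntegrable_iff]
    refine Measure.integrableOn_of_bounded (M := u₀) (by simp [uIoc])
      ((measurable_thresholdRate u₀ d).comp
        (hsc.comp (continuous_const.add continuous_id)).measurable).aestronglyMeasurable
      (Eventually.of_forall fun s => ?_)
    rw [thresholdRate]
    split_ifs
    · simpa using hu₀.le
    · rw [Real.norm_eq_abs, abs_of_pos hu₀]
  refine ⟨F, ?_, fun t z hz => if_pos hz, hle, hint, ?_⟩
  · exact Measurable.ite (measurableSet_lt measurable_snd measurable_const) measurable_snd
      (hsc.measurable.comp ((hec.measurable.comp measurable_snd).add measurable_fst))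
  · intro t z ht hz
    have h1 : ∫ s in (0 : ℝ)..t, g (F s z) = ∫ s in (0 : ℝ)..t, a (e.symm (e z + s)) := by
      refine intervalIntegral.integral_congr fun s hs => ?_
      rw [uIcc_of_le ht] at hs
      exact hgF s z hs.1 hz
    have h2 : ∫ s in (0 : ℝ)..t, thresholdRate u₀ d (F s z)
        = ∫ s in (0 : ℝ)..t, thresholdRate u₀ d (e.symm (e z + s)) := by
      refine intervalIntegral.integral_congr fun s hs => ?_
      simp only [hF s z hz]
    rw [h1, h2, hF t z hz, add_sub_assoc, ← intervalIntegral.integral_sub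
      ((hca z).intervalIntegrable 0 t) (hrate t z hz)]
    -- As `e d = 0`, the excluded time is the one at which the path passes `d`. A single exceptional
    -- time does not affect the fundamental theorem of calculus for this continuous path.
    have h3 : ∀ s, e z + s ≠ 0 → HasDerivAt (fun s => e.symm (e z + s))
        (a (e.symm (e z + s)) - thresholdRate u₀ d (e.symm (e z + s))) s := by
      intro s hs
      set y := e.symm (e z + s) with hy
      have hyd : y ≠ d := by
        intro h
        apply hs
        rw [← e.apply_symm_apply (e z + s), ← hy, h, he]
        simp [travelTime]
      have h4 : HasDerivAt e (if y < d then a y else b y)⁻¹ y :=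
        hasDerivAt_travelTime ha ha0 hb hb0 hyd
      have h5 : (if y < d then a y else b y)⁻¹ ≠ 0 := by
        split_ifs
        · exact inv_ne_zero (ha0 y).ne'
        · exact inv_ne_zero (hb0 y).ne'
      have h6 := h4.of_local_left_inverse (g := e.symm) (a := e z + s) hsc.continuousAt h5
        (Eventually.of_forall e.apply_symm_apply)
      have h7 := h6.comp_const_add (e z) s
      convert! h7 using 1
      rw [inv_inv, thresholdRate]
      split_ifs
      · simp
      · rfl
    have h8 := integral_eq_of_hasDerivAt_off_countable
      (fun s => e.symm (e z + s))
      (fun s => a (e.symm (e z + s)) - thresholdRate u₀ d (e.symm (e z + s)))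
      (s := {-e z}) (countable_singleton _) (a := 0) (b := t)
      (hsc.comp (continuous_const.add continuous_id)).continuousOn
      (fun s hs => h3 s fun h => hs.2 (by rw [mem_singleton_iff]; linarith))
      (((hca z).intervalIntegrable 0 t).sub (hrate t z hz))
    rw [h8]
    simp

/-! ### The surplus under the threshold strategy -/

section process

variable {Ω : Type*}

/-- The surplus immediately after the `n`-th claim. -/
noncomputable def postClaimSurplus (F : ℝ → ℝ → ℝ) (x : ℝ) (T Y : ℕ → Ω → ℝ) : ℕ → Ω → ℝ
  | 0, _ => x
  | n + 1, ω =>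
    if postClaimSurplus F x T Y n ω < 0 then postClaimSurplus F x T Y n ω
    else F (T (n + 1) ω - T n ω) (postClaimSurplus F x T Y n ω) - Y n ω

/-- The surplus at time `t`, which follows the flow `F` since the last claim. -/
noncomputable def flowSurplus (F : ℝ → ℝ → ℝ) (x : ℝ) (T Y : ℕ → Ω → ℝ) (t : ℝ) (ω : Ω) : ℝ :=
  F (t - T (claimCount T t ω) ω) (postClaimSurplus F x T Y (claimCount T t ω) ω)

variable {F : ℝ → ℝ → ℝ} {x : ℝ} {T Y : ℕ → Ω → ℝ}

/-- Regarding time as a random variable on `ℝ × Ω` turns measurability at a random time into joint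
measurability in time and outcome. -/
theorem postClaimSurplus_snd (n : ℕ) (p : ℝ × Ω) :
    postClaimSurplus F x (fun k (p : ℝ × Ω) => T k p.2) (fun k p => Y k p.2) n p
      = postClaimSurplus F x T Y n p.2 := by
  induction n with
  | zero => rfl
  | succ n ih => simp only [postClaimSurplus, ih]

section measurability

variable [MeasurableSpace Ω]

theorem measurable_postClaimSurplus (hF : Measurable fun p : ℝ × ℝ => F p.1 p.2)
    (hT : ∀ k, Measurable (T k)) (hY : ∀ k, Measurable (Y k)) (n : ℕ) :
    Measurable (postClaimSurplus F x T Y n) := by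
  induction n with
  | zero => exact measurable_const
  | succ n ih =>
    exact Measurable.ite (measurableSet_lt ih measurable_const) ih
      ((hF.comp (((hT (n + 1)).sub (hT n)).prodMk ih)).sub (hY n))

theorem measurable_flowSurplus_comp (hF : Measurable fun p : ℝ × ℝ => F p.1 p.2)
    (hmono : ∀ ω, Monotone fun k => T k ω) (hT : ∀ k, Measurable (T k)) (hY : ∀ k, Measurable (Y k))
    {t : Ω → ℝ} (ht : Measurable t) : Measurable fun ω => flowSurplus F x T Y (t ω) ω := by
  have hN := measurable_claimCount hmono hT ht
  exact hF.comp ((ht.sub (Measurable.nat_apply hT hN)).prodMk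
    (Measurable.nat_apply (fun n => measurable_postClaimSurplus hF hT hY n) hN))

theorem measurable_flowSurplus (hF : Measurable fun p : ℝ × ℝ => F p.1 p.2)
    (hmono : ∀ ω, Monotone fun k => T k ω) (hT : ∀ k, Measurable (T k))
    (hY : ∀ k, Measurable (Y k)) : Measurable fun p : ℝ × Ω => flowSurplus F x T Y p.1 p.2 := by
  have h1 := measurable_flowSurplus_comp (x := x) (T := fun k (p : ℝ × Ω) => T k p.2)
    (Y := fun k p => Y k p.2) hF (fun p => hmono p.2) (fun k => (hT k).comp measurable_snd)
    (fun k => (hY k).comp measurable_snd) measurable_fst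
  convert! h1 using 2 with p
  simp only [flowSurplus, postClaimSurplus_snd]
  rfl

theorem measurable_integral_flowSurplus (hF : Measurable fun p : ℝ × ℝ => F p.1 p.2)
    (hmono : ∀ ω, Monotone fun k => T k ω) (hT : ∀ k, Measurable (T k))
    (hY : ∀ k, Measurable (Y k)) {r : ℝ → ℝ} (hr : Measurable r) {t : ℝ} (ht : 0 ≤ t) :
    Measurable fun ω => ∫ s in (0 : ℝ)..t, r (flowSurplus F x T Y s ω) := by
  simp only [intervalIntegral.integral_of_le ht]
  have h1 : StronglyMeasurable fun p : ℝ × Ω => r (flowSurplus F x T Y p.1 p.2) :=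
    (hr.comp (measurable_flowSurplus hF hmono hT hY)).stronglyMeasurable
  exact h1.integral_prod_left'.measurable

end measurability

/-! #### Only the claims up to the present matter -/

/-- The arrival times as known at time `t`. -/
noncomputable def knownArrival (T : ℕ → Ω → ℝ) (t : ℝ) (k : ℕ) (ω : Ω) : ℝ :=
  if T k ω ≤ t then T k ω else t + 1

/-- The claim sizes as known at time `t`. -/
noncomputable def knownClaim (T Y : ℕ → Ω → ℝ) (t : ℝ) (k : ℕ) : Ω → ℝ :=
  {ω | T (k + 1) ω ≤ t}.indicator (Y k)

theorem knownArrival_le_iff {s t : ℝ} (hst : s ≤ t) (k : ℕ) (ω : Ω) :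
    knownArrival T t k ω ≤ s ↔ T k ω ≤ s := by
  rw [knownArrival]
  split_ifs with h
  · exact Iff.rfl
  · constructor <;> intro h' <;> linarith

/-- Strict monotonicity is lost, since all unseen arrivals are placed at `t + 1`; the measurability
lemmas for counts and surplus ask only for monotone arrivals for this reason. -/
theorem monotone_knownArrival {ω : Ω} (hT : Monotone fun k => T k ω) (t : ℝ) :
    Monotone fun k => knownArrival T t k ω := by
  intro i j hij
  have := hT hij
  simp only [knownArrival] at this ⊢
  split_ifs <;> linarith

theorem measurable_knownArrival_of_le [MeasurableSpace Ω] {t : ℝ} (ht : 0 ≤ t) {k : ℕ}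
    (h0 : ∀ ω, 0 ≤ T k ω) (h : ∀ r, 0 ≤ r → r ≤ t → MeasurableSet {ω | T k ω ≤ r}) :
    Measurable (knownArrival T t k) := by
  refine measurable_of_Iic fun r => ?_
  rcases lt_or_ge r (t + 1) with hr | hr
  · rcases lt_or_ge r 0 with hr0 | hr0
    · have : knownArrival T t k ⁻¹' Iic r = ∅ := by
        ext ω
        simp only [mem_preimage, mem_Iic, mem_empty_iff_false, iff_false, not_le, knownArrival]
        split_ifs
        · exact hr0.trans_le (h0 ω)
        · exact hr
      rw [this]
      exact MeasurableSet.empty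
    · have : knownArrival T t k ⁻¹' Iic r = {ω | T k ω ≤ min r t} := by
        ext ω
        simp only [mem_preimage, mem_Iic, mem_ofPred_eq, knownArrival, le_min_iff]
        split_ifs with h2
        · exact ⟨fun h3 => ⟨h3, h2⟩, fun h3 => h3.1⟩
        · exact ⟨fun h3 => absurd hr (not_lt.mpr h3), fun h3 => absurd h3.2 h2⟩
      rw [this]
      exact h _ (le_min hr0 ht) (min_le_right _ _)
  · have : knownArrival T t k ⁻¹' Iic r = univ := by
      ext ω
      simp only [mem_preimage, mem_Iic, mem_univ, iff_true, knownArrival]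
      split_ifs <;> linarith
    rw [this]
    exact MeasurableSet.univ

theorem claimCount_knownArrival {s t : ℝ} (hst : s ≤ t) (ω : Ω) :
    claimCount (knownArrival T t) s ω = claimCount T s ω := by
  simp only [claimCount, knownArrival_le_iff hst]

theorem postClaimSurplus_known {ω : Ω} (hT : Monotone fun k => T k ω) {t : ℝ} (n : ℕ)
    (hn : T n ω ≤ t) :
    postClaimSurplus F x (knownArrival T t) (knownClaim T Y t) n ω
      = postClaimSurplus F x T Y n ω := by
  induction n with
  | zero => rfl
  | succ n ih =>
    have h1 : T n ω ≤ t := (hT (Nat.le_succ n)).trans hn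
    have h2 : knownArrival T t n ω = T n ω := if_pos h1
    have h3 : knownArrival T t (n + 1) ω = T (n + 1) ω := if_pos hn
    have h4 : knownClaim T Y t n ω = Y n ω := indicator_of_mem (show ω ∈ {ω | _} from hn) _
    simp only [postClaimSurplus, ih h1, h2, h3, h4]

/-- Up to time `t` the surplus can be rebuilt from data measurable at time `t`. Adaptedness thus
follows from the general measurability lemmas, read with the σ-algebra `ℱ t`. -/
theorem flowSurplus_known {ω : Ω} (hT : Monotone fun k => T k ω) (h0 : T 0 ω = 0) {s t : ℝ}
    (hst : s ≤ t) (ht : 0 ≤ t) :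
    flowSurplus F x (knownArrival T t) (knownClaim T Y t) s ω = flowSurplus F x T Y s ω := by
  have h1 : T (claimCount T s ω) ω ≤ t := by
    rcases eq_or_ne (claimCount T s ω) 0 with h | h
    · rw [h, h0]; exact ht
    · exact (claimCount_spec hT rfl h).1.trans hst
  have h2 : knownArrival T t (claimCount T s ω) ω = T (claimCount T s ω) ω := if_pos h1
  rw [flowSurplus, flowSurplus, claimCount_knownArrival hst, postClaimSurplus_known hT _ h1, h2]

end process

/-! ### Adaptedness and admissibility of the threshold strategy -/

section adapted

variable {Ω : Type*} {mΩ : MeasurableSpace Ω} {P : Measure Ω}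
  {ℱ : Filtration ℝ≥0 mΩ} {lam α u₀ d : ℝ} {T Y : ℕ → Ω → ℝ} {F : ℝ → ℝ → ℝ} {x : ℝ} {g : ℝ → ℝ}

theorem IsExpClaimProcess.measurable_knownArrival (h : IsExpClaimProcess P ℱ lam α T Y) (t : ℝ≥0)
    (k : ℕ) : Measurable[ℱ t] (knownArrival T t k) :=
  @measurable_knownArrival_of_le Ω T (ℱ t) t t.coe_nonneg k (h.arrival_nonneg k)
    fun r hr hrt => ℱ.mono (show (⟨r, hr⟩ : ℝ≥0) ≤ t from hrt) _ (h.arrival_adapted k ⟨r, hr⟩)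

theorem IsExpClaimProcess.measurable_knownClaim (h : IsExpClaimProcess P ℱ lam α T Y) (t : ℝ≥0)
    (k : ℕ) : Measurable[ℱ t] (knownClaim T Y t k) := h.claim_adapted k t

theorem IsExpClaimProcess.adapted_flowSurplus (h : IsExpClaimProcess P ℱ lam α T Y)
    (hF : Measurable fun p : ℝ × ℝ => F p.1 p.2) (t : ℝ≥0) :
    Measurable[ℱ t] (flowSurplus F x T Y t) := by
  have h1 : flowSurplus F x T Y t
      = fun ω => flowSurplus F x (knownArrival T t) (knownClaim T Y t) t ω := by
    ext ω
    exact (flowSurplus_known (h.mono ω) (h.arrival_zero ω) le_rfl t.coe_nonneg).symm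
  rw [h1]
  exact @measurable_flowSurplus_comp Ω F x _ _ (ℱ t) hF
    (fun ω => monotone_knownArrival (h.mono ω) t) (h.measurable_knownArrival t)
    (h.measurable_knownClaim t) (fun _ => (t : ℝ)) (@measurable_const _ _ _ (ℱ t) _)

theorem IsExpClaimProcess.isAdmissibleRate_threshold (h : IsExpClaimProcess P ℱ lam α T Y)
    (hF : Measurable fun p : ℝ × ℝ => F p.1 p.2) (hu₀ : 0 ≤ u₀) :
    IsAdmissibleRate ℱ u₀ fun t ω => thresholdRate u₀ d (flowSurplus F x T Y t ω) where
  measurable := (measurable_thresholdRate u₀ d).comp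
    (measurable_flowSurplus hF h.mono h.measurable_arrival h.measurable_claim)
  adapted t := (measurable_thresholdRate u₀ d).comp (h.adapted_flowSurplus hF t)
  cumulative_adapted t := by
    -- Adaptedness at each single time would not give measurability of the integral; the known data
    -- make the integrand jointly measurable over `ℱ t`.
    have h1 : (fun ω => ∫ s in (0 : ℝ)..t, thresholdRate u₀ d (flowSurplus F x T Y s ω))
        = fun ω => ∫ s in (0 : ℝ)..t, thresholdRate u₀ d
            (flowSurplus F x (knownArrival T t) (knownClaim T Y t) s ω) := by
      ext ω
      refine intervalIntegral.integral_congr fun s hs => ?_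
      rw [uIcc_of_le t.coe_nonneg] at hs
      rw [flowSurplus_known (h.mono ω) (h.arrival_zero ω) hs.2 t.coe_nonneg]
    rw [h1]
    exact @measurable_integral_flowSurplus Ω F x _ _ (ℱ t) hF
      (fun ω => monotone_knownArrival (h.mono ω) t) (h.measurable_knownArrival t)
      (h.measurable_knownClaim t) _ (measurable_thresholdRate u₀ d) t t.coe_nonneg
  nonneg t _ ω := by
    rw [thresholdRate]
    split_ifs
    exacts [le_rfl, hu₀]
  le_max t _ ω := by
    rw [thresholdRate]
    split_ifs
    exacts [hu₀, le_rfl]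

end adapted

/-! ### The dynamics of the surplus under the threshold strategy -/

section path

theorem IsThresholdFlow.apply_zero {g : ℝ → ℝ} {u₀ d : ℝ} {F : ℝ → ℝ → ℝ}
    (hF : IsThresholdFlow g u₀ d F) (z : ℝ) : F 0 z = z := by
  rcases lt_or_ge z 0 with h | h
  · exact hF.of_neg 0 z h
  · simpa using hF.eq 0 z le_rfl h

variable {Ω : Type*} {F : ℝ → ℝ → ℝ} {g : ℝ → ℝ} {u₀ d x : ℝ} {T Y : ℕ → Ω → ℝ} {ω : Ω} {t : ℝ}
  {m n : ℕ}

theorem flowSurplus_eq (hT : Monotone fun k => T k ω) (h1 : T n ω ≤ t) (h2 : t < T (n + 1) ω) :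
    flowSurplus F x T Y t ω = F (t - T n ω) (postClaimSurplus F x T Y n ω) := by
  rw [flowSurplus, claimCount_eq hT h1 h2]

theorem postClaimSurplus_eq_of_neg (hn : postClaimSurplus F x T Y n ω < 0) (hmn : n ≤ m) :
    postClaimSurplus F x T Y m ω = postClaimSurplus F x T Y n ω := by
  induction m, hmn using Nat.le_induction with
  | base => rfl
  | succ m _ ih => rw [postClaimSurplus, if_pos (by rwa [ih]), ih]

theorem flowSurplus_neg_iff (hF : IsThresholdFlow g u₀ d F) (hT : Monotone fun k => T k ω)
    (h1 : T n ω ≤ t) (h2 : t < T (n + 1) ω) :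
    flowSurplus F x T Y t ω < 0 ↔ postClaimSurplus F x T Y n ω < 0 := by
  rw [flowSurplus_eq hT h1 h2]
  constructor
  · intro h
    by_contra! h'
    exact absurd (hF.le _ _ (sub_nonneg.mpr h1) h') (by linarith)
  · intro h
    rwa [hF.of_neg _ _ h]

theorem flowSurplus_arrival (hF : IsThresholdFlow g u₀ d F) (hT : StrictMono fun k => T k ω)
    (n : ℕ) : flowSurplus F x T Y (T n ω) ω = postClaimSurplus F x T Y n ω := by
  rw [flowSurplus_eq hT.monotone le_rfl (hT n.lt_succ_self), sub_self, hF.apply_zero]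

theorem eqOn_flowSurplus (hT : Monotone fun k => T k ω) (h1 : T n ω ≤ t) (h2 : t ≤ T (n + 1) ω)
    (r : ℝ → ℝ) :
    EqOn (fun s => r (flowSurplus F x T Y s ω))
      (fun s => r (F (s - T n ω) (postClaimSurplus F x T Y n ω))) (uIoo (T n ω) t) := by
  intro s hs
  rw [uIoo_of_le h1] at hs
  simp only [flowSurplus_eq hT hs.1.le (hs.2.trans_le h2)]

theorem integral_flowSurplus_eq (hT : Monotone fun k => T k ω) (h1 : T n ω ≤ t)
    (h2 : t ≤ T (n + 1) ω) (r : ℝ → ℝ) :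
    ∫ s in T n ω..t, r (flowSurplus F x T Y s ω)
      = ∫ s in (0 : ℝ)..(t - T n ω), r (F s (postClaimSurplus F x T Y n ω)) := by
  rw [intervalIntegral.integral_congr_uIoo (eqOn_flowSurplus hT h1 h2 r),
    intervalIntegral.integral_comp_sub_right
      (fun s => r (F s (postClaimSurplus F x T Y n ω))), sub_self]

theorem intervalIntegrable_flowSurplus_piece (hF : IsThresholdFlow g u₀ d F)
    (hT : Monotone fun k => T k ω) (h1 : T n ω ≤ t) (h2 : t ≤ T (n + 1) ω)
    (hn : 0 ≤ postClaimSurplus F x T Y n ω) :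
    IntervalIntegrable (fun s => g (flowSurplus F x T Y s ω)) volume (T n ω) t := by
  have h3 := (hF.intervalIntegrable (t - T n ω) _ (sub_nonneg.mpr h1) hn).comp_sub_right (T n ω)
  rw [zero_add, sub_add_cancel] at h3
  exact h3.congr_uIoo (eqOn_flowSurplus hT h1 h2 g).symm

theorem flow_eq_integral_flowSurplus (hF : IsThresholdFlow g u₀ d F)
    (hT : Monotone fun k => T k ω) (h1 : T n ω ≤ t) (h2 : t ≤ T (n + 1) ω)
    (hn : 0 ≤ postClaimSurplus F x T Y n ω) :
    F (t - T n ω) (postClaimSurplus F x T Y n ω) = postClaimSurplus F x T Y n ω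
      + (∫ s in T n ω..t, g (flowSurplus F x T Y s ω))
      - ∫ s in T n ω..t, thresholdRate u₀ d (flowSurplus F x T Y s ω) := by
  rw [integral_flowSurplus_eq hT h1 h2 g, integral_flowSurplus_eq hT h1 h2 (thresholdRate u₀ d)]
  exact hF.eq _ _ (sub_nonneg.mpr h1) hn

/-- The path follows the flow up to time `t` in the interval between the claims `n` and `n + 1`. -/
theorem flow_eq_of_postClaimSurplus_nonneg (hF : IsThresholdFlow g u₀ d F)
    (hT : Monotone fun k => T k ω) (h0 : T 0 ω = 0)
    (hr : ∀ s t, 0 ≤ s → 0 ≤ t →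
      IntervalIntegrable (fun r => thresholdRate u₀ d (flowSurplus F x T Y r ω)) volume s t)
    (hn : 0 ≤ postClaimSurplus F x T Y n ω)
    (h : IntervalIntegrable (fun s => g (flowSurplus F x T Y s ω)) volume 0 (T n ω) ∧
      postClaimSurplus F x T Y n ω = x + (∫ s in (0 : ℝ)..T n ω, g (flowSurplus F x T Y s ω))
        - (∑ k ∈ Finset.range n, Y k ω)
        - ∫ s in (0 : ℝ)..T n ω, thresholdRate u₀ d (flowSurplus F x T Y s ω))
    (h1 : T n ω ≤ t) (h2 : t ≤ T (n + 1) ω) :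
    IntervalIntegrable (fun s => g (flowSurplus F x T Y s ω)) volume 0 t ∧
      F (t - T n ω) (postClaimSurplus F x T Y n ω)
        = x + (∫ s in (0 : ℝ)..t, g (flowSurplus F x T Y s ω)) - (∑ k ∈ Finset.range n, Y k ω)
          - ∫ s in (0 : ℝ)..t, thresholdRate u₀ d (flowSurplus F x T Y s ω) := by
  have hp := intervalIntegrable_flowSurplus_piece hF hT h1 h2 hn
  have hn0 : 0 ≤ T n ω := h0 ▸ hT n.zero_le
  refine ⟨h.1.trans hp, ?_⟩
  rw [flow_eq_integral_flowSurplus hF hT h1 h2 hn,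
    ← intervalIntegral.integral_add_adjacent_intervals h.1 hp,
    ← intervalIntegral.integral_add_adjacent_intervals (hr 0 _ le_rfl hn0)
      (hr _ t hn0 (hn0.trans h1))]
  linarith [h.2]

theorem postClaimSurplus_eq_integral (hF : IsThresholdFlow g u₀ d F)
    (hT : Monotone fun k => T k ω) (h0 : T 0 ω = 0)
    (hr : ∀ s t, 0 ≤ s → 0 ≤ t →
      IntervalIntegrable (fun r => thresholdRate u₀ d (flowSurplus F x T Y r ω)) volume s t)
    (n : ℕ) (hn : ∀ i < n, 0 ≤ postClaimSurplus F x T Y i ω) :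
    IntervalIntegrable (fun s => g (flowSurplus F x T Y s ω)) volume 0 (T n ω) ∧
      postClaimSurplus F x T Y n ω = x + (∫ s in (0 : ℝ)..T n ω, g (flowSurplus F x T Y s ω))
        - (∑ k ∈ Finset.range n, Y k ω)
        - ∫ s in (0 : ℝ)..T n ω, thresholdRate u₀ d (flowSurplus F x T Y s ω) := by
  induction n with
  | zero => simp [h0, postClaimSurplus]
  | succ n ih =>
    have hn' := hn n n.lt_succ_self
    obtain ⟨h1, h2⟩ := flow_eq_of_postClaimSurplus_nonneg hF hT h0 hr hn'
      (ih fun i hi => hn i (hi.trans n.lt_succ_self)) (hT n.le_succ) le_rfl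
    refine ⟨h1, ?_⟩
    rw [postClaimSurplus, if_neg (not_lt.mpr hn'), h2, Finset.sum_range_succ]
    ring

theorem ruinTime_le {X : ℝ → ℝ} {t : ℝ} (ht : 0 ≤ t) (h : X t < 0) :
    ruinTime X ≤ ENNReal.ofReal t := sInf_le ⟨t, ⟨ht, h⟩, rfl⟩

/-- The flow never falls between claims, so ruin happens at a claim. Up to and including ruin, all
earlier post-claim values are nonnegative, and the integral equations of the pieces add up. -/
theorem flowSurplus_dynamics (hF : IsThresholdFlow g u₀ d F)
    (hT : StrictMono fun k => T k ω) (h0 : T 0 ω = 0)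
    (hlim : Tendsto (fun k => T k ω) atTop atTop)
    (hr : ∀ s t, 0 ≤ s → 0 ≤ t →
      IntervalIntegrable (fun r => thresholdRate u₀ d (flowSurplus F x T Y r ω)) volume s t)
    (ht : 0 ≤ t) (hτ : ENNReal.ofReal t ≤ ruinTime fun r => flowSurplus F x T Y r ω) :
    IntervalIntegrable (fun s => g (flowSurplus F x T Y s ω)) volume 0 t ∧
      flowSurplus F x T Y t ω = x + (∫ s in (0 : ℝ)..t, g (flowSurplus F x T Y s ω))
        - aggregateClaims T Y t ω
        - ∫ s in (0 : ℝ)..t, thresholdRate u₀ d (flowSurplus F x T Y s ω) := by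
  obtain ⟨n, h1, h2⟩ : ∃ n, T n ω ≤ t ∧ t < T (n + 1) ω :=
    ⟨_, exists_claimCount_eq hT.monotone h0 hlim ht⟩
  have hpos : ∀ i, 0 ≤ T i ω := fun i => h0 ▸ hT.monotone i.zero_le
  have hle : ∀ i, postClaimSurplus F x T Y i ω < 0 → t ≤ T i ω := fun i hi => by
    have := hτ.trans (ruinTime_le (hpos i) (by rwa [flowSurplus_arrival hF hT]))
    exact (ENNReal.ofReal_le_ofReal_iff (hpos i)).mp this
  have hlt : ∀ i < n, 0 ≤ postClaimSurplus F x T Y i ω := fun i hi => by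
    by_contra! h
    exact absurd (hle i h) (not_le.mpr ((hT hi).trans_le h1))
  have hZ := postClaimSurplus_eq_integral hF hT.monotone h0 hr n hlt
  rw [aggregateClaims, claimCount_eq hT.monotone h1 h2]
  rcases lt_or_ge (postClaimSurplus F x T Y n ω) 0 with hn | hn
  -- A negative value after the last claim means that `t` is the ruin time itself, where the
  -- equation is still required.
  · obtain rfl : T n ω = t := le_antisymm h1 (hle n hn)
    rw [flowSurplus_arrival hF hT]
    exact hZ
  · rw [flowSurplus_eq hT.monotone h1 h2]
    exact flow_eq_of_postClaimSurplus_nonneg hF hT.monotone h0 hr hn hZ h1 h2.le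

theorem flowSurplus_stopped (hF : IsThresholdFlow g u₀ d F)
    (hT : StrictMono fun k => T k ω) (h0 : T 0 ω = 0)
    (hlim : Tendsto (fun k => T k ω) atTop atTop) (ht : 0 ≤ t)
    (hτ : ruinTime (fun r => flowSurplus F x T Y r ω) ≤ ENNReal.ofReal t) :
    flowSurplus F x T Y t ω
      = flowSurplus F x T Y (ruinTime fun r => flowSurplus F x T Y r ω).toReal ω := by
  have hpos : ∀ i, 0 ≤ T i ω := fun i => h0 ▸ hT.monotone i.zero_le
  have hex : ∃ n, postClaimSurplus F x T Y n ω < 0 := by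
    by_contra! h
    have : ruinTime (fun r => flowSurplus F x T Y r ω) = ⊤ := by
      rw [ruinTime, sInf_eq_top]
      rintro _ ⟨s, ⟨hs, hs'⟩, rfl⟩
      obtain ⟨h1, h2⟩ := exists_claimCount_eq hT.monotone h0 hlim hs
      exact absurd ((flowSurplus_neg_iff hF hT.monotone h1 h2).mp hs') (not_lt.mpr (h _))
    rw [this] at hτ
    exact absurd hτ (by simp)
  classical
  obtain ⟨n, hn, hmin⟩ : ∃ n, postClaimSurplus F x T Y n ω < 0 ∧
      ∀ i < n, ¬ postClaimSurplus F x T Y i ω < 0 :=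
    ⟨Nat.find hex, Nat.find_spec hex, fun i hi => Nat.find_min hex hi⟩
  -- Ruin is the first claim with a negative post-claim value; from then on both the recursion and
  -- the flow are frozen.
  have hruin : ruinTime (fun r => flowSurplus F x T Y r ω) = ENNReal.ofReal (T n ω) := by
    refine le_antisymm (ruinTime_le (hpos n) (by rwa [flowSurplus_arrival hF hT])) ?_
    refine le_sInf ?_
    rintro _ ⟨s, ⟨hs, hs'⟩, rfl⟩
    obtain ⟨h1, h2⟩ := exists_claimCount_eq hT.monotone h0 hlim hs
    have h3 := (flowSurplus_neg_iff hF hT.monotone h1 h2).mp hs'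
    have h4 : n ≤ claimCount T s ω := not_lt.mp fun h => hmin _ h h3
    exact ENNReal.ofReal_le_ofReal ((hT.monotone h4).trans h1)
  have hnt : T n ω ≤ t := by
    rw [hruin] at hτ
    exact (ENNReal.ofReal_le_ofReal_iff ht).mp hτ
  rw [hruin, ENNReal.toReal_ofReal (hpos n), flowSurplus_arrival hF hT]
  obtain ⟨h1, h2⟩ := exists_claimCount_eq hT.monotone h0 hlim ht
  have h4 : n ≤ claimCount T t ω := by
    by_contra! h
    exact absurd (hnt.trans_lt h2) (not_lt.mpr (hT.monotone h))
  rw [flowSurplus_eq hT.monotone h1 h2, postClaimSurplus_eq_of_neg hn h4, hF.of_neg _ _ hn]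

end path

theorem IsExpClaimProcess.isThresholdStrategy_flowSurplus {Ω : Type*} {mΩ : MeasurableSpace Ω}
    {P : Measure Ω} [IsProbabilityMeasure P] {ℱ : Filtration ℝ≥0 mΩ} {lam α u₀ d x : ℝ}
    {T Y : ℕ → Ω → ℝ} {g : ℝ → ℝ} {F : ℝ → ℝ → ℝ} (h : IsExpClaimProcess P ℱ lam α T Y)
    (hF : IsThresholdFlow g u₀ d F) (hu₀ : 0 ≤ u₀) :
    IsThresholdStrategy P ℱ T Y g u₀ d x
      (fun t ω => thresholdRate u₀ d (flowSurplus F x T Y t ω)) (flowSurplus F x T Y) where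
  admissible := h.isAdmissibleRate_threshold hF.measurable hu₀
  surplus :=
    { adapted := h.adapted_flowSurplus hF.measurable
      dynamics := by
        filter_upwards [h.ae_tendsto_arrival] with ω hlim t ht hτ
        exact flowSurplus_dynamics hF (h.arrival_strictMono ω) (h.arrival_zero ω) hlim
          (fun s t hs ht =>
            (h.isAdmissibleRate_threshold hF.measurable hu₀).intervalIntegrable ω hs ht) ht hτ
      stopped := by
        filter_upwards [h.ae_tendsto_arrival] with ω hlim t ht hτ
        exact flowSurplus_stopped hF (h.arrival_strictMono ω) (h.arrival_zero ω) hlim ht hτ }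
  feedback := ae_of_all _ fun _ _ _ _ => rfl

end Dividend

/-! ### The optimality theorem -/

theorem theorem3p4 {Ω : Type*} {mΩ : MeasurableSpace Ω} (P : Measure Ω) [IsProbabilityMeasure P]
    (ℱ : Filtration ℝ≥0 mΩ) (lam α δ u₀ : ℝ)
    (hlam : 0 < lam) (hα : 0 < α) (hδ : 0 < δ) (hu₀ : 0 < u₀)
    (T Y : ℕ → Ω → ℝ) (hclaims : Dividend.IsExpClaimProcess P ℱ lam α T Y)
    (g : ℝ → ℝ) (hg_lip : ∃ K : ℝ≥0, LipschitzOnWith K g (Set.Ici 0))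
    (hg_diff : ∀ x : ℝ, 0 < x → DifferentiableAt ℝ g x)
    (hg_gt : ∀ x : ℝ, 0 ≤ x → u₀ < g x)
    (ψ₁ ψ₂ : ℝ → ℝ)
    (hψ₁ : Dividend.SolvesIDE g lam α δ ψ₁) (hψ₁_mono : StrictMonoOn ψ₁ (Set.Ici 0))
    (hψ₂ : Dividend.SolvesODE g lam α δ u₀ ψ₂)
    (hψ₂_bdd : ∃ C : ℝ, ∀ x : ℝ, 0 < x → |ψ₂ x| ≤ C)
    (hψ₂_conc : ConcaveOn ℝ (Set.Ioi 0) ψ₂)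
    (d : ℝ) (hd : Dividend.IsThreshold ψ₁ ψ₂ u₀ δ d)
    (hd_unique : ∀ d' : ℝ, Dividend.IsThreshold ψ₁ ψ₂ u₀ δ d' → d' = d) :
    ∀ x : ℝ, 0 ≤ x →
      Dividend.restrictedValue P ℱ T Y g u₀ δ x =
          (if x < d then ψ₁ x / deriv ψ₁ d else u₀ / δ + ψ₂ x / deriv ψ₂ d) ∧
      (∃ u X : ℝ → Ω → ℝ, Dividend.IsThresholdStrategy P ℱ T Y g u₀ d x u X) ∧
      (∀ u X : ℝ → Ω → ℝ, Dividend.IsThresholdStrategy P ℱ T Y g u₀ d x u X →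
        Dividend.expectedDividends P δ u X = Dividend.restrictedValue P ℱ T Y g u₀ δ x ∧
        IsGreatest (Dividend.performances P ℱ T Y g u₀ δ x)
          (Dividend.expectedDividends P δ u X)) := by
  intro x hx
  obtain ⟨K, hK⟩ := hg_lip
  obtain ⟨M, hM, hw⟩ := Dividend.exists_isClassicalSolution_candidate hlam hα hδ hu₀ hg_diff hg_gt
    hψ₁ hψ₁_mono hψ₂ hψ₂_bdd hψ₂_conc hd
  obtain ⟨F, hF⟩ := Dividend.exists_isThresholdFlow hK hu₀ hd.pos hg_gt
  have setting : ∀ {u X : ℝ → Ω → ℝ}, Dividend.IsAdmissibleRate ℱ u₀ u →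
      Dividend.IsControlledSurplus P ℱ T Y g x u X →
      Dividend.Setting P ℱ lam α δ u₀ d M x K T Y g
        (Dividend.candidate ψ₁ ψ₂ u₀ δ d) u X := fun hu hX =>
    ⟨hlam, hα, hδ, hu₀, hM, hx, hd.pos, hg_gt, hK, hclaims, hw, hu, hX⟩
  have value : ∀ {u X : ℝ → Ω → ℝ}, Dividend.IsThresholdStrategy P ℱ T Y g u₀ d x u X →
      Dividend.expectedDividends P δ u X = Dividend.candidate ψ₁ ψ₂ u₀ δ d x := fun h =>
    le_antisymm (setting h.admissible h.surplus).expectedDividends_le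
      ((setting h.admissible h.surplus).le_expectedDividends h.feedback)
  have greatest : ∀ {u X : ℝ → Ω → ℝ}, Dividend.IsThresholdStrategy P ℱ T Y g u₀ d x u X →
      IsGreatest (Dividend.performances P ℱ T Y g u₀ δ x)
        (Dividend.expectedDividends P δ u X) := by
    intro u X h
    refine ⟨⟨u, X, h.admissible, h.surplus, rfl⟩, ?_⟩
    rintro _ ⟨u', X', hu', hX', rfl⟩
    rw [value h]
    exact (setting hu' hX').expectedDividends_le
  have hthr := hclaims.isThresholdStrategy_flowSurplus (x := x) hF hu₀.le
  -- The constructed strategy makes the supremum a maximum, which identifies the value function with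
  -- the candidate.
  refine ⟨?_, ⟨_, _, hthr⟩, fun u X h => ⟨(greatest h).csSup_eq.symm, greatest h⟩⟩
  rw [Dividend.restrictedValue, (greatest hthr).csSup_eq, value hthr]
  split_ifs with hxd
  · exact Dividend.candidate_of_lt hx hxd
  · exact Dividend.candidate_of_ge hd.pos (not_lt.mp hxd)
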